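/- Let $M$ be an oriented smooth surface diffeomorphic to the $2$-sphere, and let $\Sigma=\{F=1\}\subset TM$ be the unit tangent bundle of a smooth, strongly convex, not necessarily symmetric Finsler norm $F:TM\to\mathbb R$ whose flag (Finsler--Gauss) curvature satisfies $K\equiv 1$. By a $\Sigma$-geodesic we mean a unit speed geodesic of $F$, and $\Psi_t:\Sigma\to\Sigma$ denotes the geodesic flow. Suppose that $(M,\Sigma)$ is geodesically reversible, i.e. every $\Sigma$-geodesic defined on an open interval can be reparametrized, by an orientation-reversing diffeomorphism of open intervals, so as to be again a $\Sigma$-geodesic. Then there is exactly one quasi-antipodal map of $(M,\Sigma)$, i.e. exactly one orientation-reversing Finsler isometry (diffeomorphism preserving $F$) $\alpha:M\to M$ whose differential satisfies $\alpha'=\Psi_\pi$ on $\Sigma$, and it satisfies $\alpha\circ\alpha=\mathrm{id}_M$. Consequently every $\Sigma$-geodesic is closed of length $2\pi$: it extends to a $\Sigma$-geodesic $\mathbb R\to M$ that is periodic with least period $2\pi$. -/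

import Mathlib

open Set Function
open scoped Manifold ContDiff Topology

noncomputable section

namespace Finsler

/-- The model plane of a surface. -/
abbrev Plane : Type := EuclideanSpace ℝ (Fin 2)

variable {M : Type*} [TopologicalSpace M] [ChartedSpace Plane M] [IsManifold (𝓡 2) ∞ M]

variable (M) in
/-- A smooth Finsler structure on a surface `M`, given by its norm `F : TM → ℝ`, which need not be
symmetric. It is smooth off the zero section, positively homogeneous, and strongly convex:
the fundamental tensor `g_y(v, v) = (1/2) d²/ds² F²(y + s v)` at `s = 0` is positive definite. -/
structure Metric where
  /-- The norm of a tangent vector. -/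
  norm : TangentBundle (𝓡 2) M → ℝ
  continuous_norm : Continuous norm
  contMDiffOn_norm : ContMDiffOn (𝓡 2).tangent 𝓘(ℝ, ℝ) ∞ norm {u | u.2 ≠ 0}
  norm_pos : ∀ (p : M) (y : TangentSpace (𝓡 2) p), y ≠ 0 → 0 < norm ⟨p, y⟩
  norm_smul : ∀ (p : M) (y : TangentSpace (𝓡 2) p) (r : ℝ), 0 ≤ r →
    norm ⟨p, r • y⟩ = r * norm ⟨p, y⟩
  strongly_convex : ∀ (p : M) (y v : TangentSpace (𝓡 2) p), y ≠ 0 → v ≠ 0 →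
    0 < iteratedDeriv 2 (fun s : ℝ => norm ⟨p, y + s • v⟩ ^ 2) 0

/-- The unit tangent bundle `Σ = {F = 1} ⊆ TM`. -/
def Metric.unitBundle (F : Metric M) : Set (TangentBundle (𝓡 2) M) := {u | F.norm u = 1}

/-! ### Local coordinates

`c : M` selects the chart `chartAt c`; `x` is the coordinate of the base point and `y` the
coordinate of the tangent vector `∑ yⁱ ∂/∂xⁱ`. -/

/-- The tangent vector with coordinates `(x, y)` in the chart at `c`. -/
def chartVector (c : M) (x y : Plane) : TangentBundle (𝓡 2) M :=
  ⟨(extChartAt (𝓡 2) c).symm x, mfderiv 𝓘(ℝ, Plane) (𝓡 2) (extChartAt (𝓡 2) c).symm x y⟩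

namespace Metric

/-- `F²` in the chart at `c`. -/
def sq (F : Metric M) (c : M) (x y : Plane) : ℝ := F.norm (chartVector c x y) ^ 2

/-- The fundamental tensor `g_{ij} = (1/2) [F²]_{yⁱ yʲ}`. -/
def tensor (F : Metric M) (c : M) (x y : Plane) : Plane →L[ℝ] Plane →L[ℝ] ℝ :=
  (1 / 2 : ℝ) • fderiv ℝ (fderiv ℝ (F.sq c x)) y

/-- The covector `[F²]_{xᵏ yˡ} yᵏ - [F²]_{xˡ}`. -/
def sprayCovector (F : Metric M) (c : M) (x y : Plane) : Plane →L[ℝ] ℝ :=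
  fderiv ℝ (fun x' => fderiv ℝ (F.sq c x') y) x y - fderiv ℝ (fun x' => F.sq c x' y) x

/-- The spray coefficients `Gⁱ = (1/4) g^{il} ([F²]_{xᵏ yˡ} yᵏ - [F²]_{xˡ})`. -/
def spray (F : Metric M) (c : M) (x y : Plane) : Plane :=
  (1 / 4 : ℝ) • (F.tensor c x y).inverse (F.sprayCovector c x y)

/-- The nonlinear connection `Nⁱ_k = ∂Gⁱ/∂yᵏ`. -/
def connection (F : Metric M) (c : M) (x y : Plane) : Plane →L[ℝ] Plane :=
  fderiv ℝ (F.spray c x) y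

/-- The Riemann curvature `R_y(v)`,
`Rⁱ_k = 2 ∂Gⁱ/∂xᵏ - yʲ ∂²Gⁱ/∂xʲ∂yᵏ + 2 Gʲ ∂²Gⁱ/∂yʲ∂yᵏ - (∂Gⁱ/∂yʲ)(∂Gʲ/∂yᵏ)`. -/
def riemann (F : Metric M) (c : M) (x y v : Plane) : Plane :=
  (2 : ℝ) • fderiv ℝ (fun x' => F.spray c x' y) x v
    - fderiv ℝ (fun x' => F.connection c x' y v) x y
    + (2 : ℝ) • fderiv ℝ (fun y' => F.connection c x y' v) y (F.spray c x y)
    - F.connection c x y (F.connection c x y v)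

/-- The flag curvature with flagpole `y` and transverse edge `v`. -/
def flagCurvature (F : Metric M) (c : M) (x y v : Plane) : ℝ :=
  F.tensor c x y (F.riemann c x y v) v /
    (F.tensor c x y y y * F.tensor c x y v v - F.tensor c x y y v ^ 2)

/-- `K ≡ 1`: every flag has flag curvature one. -/
def CurvatureOne (F : Metric M) : Prop :=
  ∀ (c : M), ∀ x ∈ (extChartAt (𝓡 2) c).target, ∀ y v : Plane,
    LinearIndependent ℝ ![y, v] → F.flagCurvature c x y v = 1

end Metric

/-! ### Geodesics -/

/-- The tangential lift `γ'` of a curve. -/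
def lift (γ : ℝ → M) (t : ℝ) : TangentBundle (𝓡 2) M :=
  ⟨γ t, mfderiv 𝓘(ℝ, ℝ) (𝓡 2) γ t (1 : ℝ)⟩

namespace Metric

/-- `γ` is a unit speed geodesic on the open set `s` of times: it is smooth there, `γ'` lies in
`Σ`, and in local coordinates `x'' + 2 G(x, x') = 0`. -/
structure IsGeodesicOn (F : Metric M) (γ : ℝ → M) (s : Set ℝ) : Prop where
  contMDiffOn : ContMDiffOn 𝓘(ℝ, ℝ) (𝓡 2) ∞ γ s
  unit_speed : ∀ t ∈ s, lift γ t ∈ F.unitBundle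
  equation : ∀ t ∈ s, ∀ c : M, γ t ∈ (extChartAt (𝓡 2) c).source →
    deriv (deriv fun τ => extChartAt (𝓡 2) c (γ τ)) t
      + (2 : ℝ) • F.spray c (extChartAt (𝓡 2) c (γ t))
          (deriv (fun τ => extChartAt (𝓡 2) c (γ τ)) t) = 0

/-- Geodesic reversibility: every unit speed geodesic on an open interval `s` can be
reparametrized, by an orientation-reversing diffeomorphism `h` from an open interval `s'`
onto `s`, as a unit speed geodesic. -/
def GeodesicallyReversible (F : Metric M) : Prop :=
  ∀ (γ : ℝ → M) (s : Set ℝ), IsOpen s → s.OrdConnected → F.IsGeodesicOn γ s →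
    ∃ (h : ℝ → ℝ) (s' : Set ℝ), IsOpen s' ∧ s'.OrdConnected ∧ BijOn h s' s ∧
      ContDiffOn ℝ ∞ h s' ∧ (∀ t ∈ s', deriv h t < 0) ∧ F.IsGeodesicOn (γ ∘ h) s'

/-- The graph of the geodesic flow: `Ψ_t(u) = w`. -/
def GeodesicFlow (F : Metric M) (t : ℝ) (u w : TangentBundle (𝓡 2) M) : Prop :=
  ∃ γ : ℝ → M, F.IsGeodesicOn γ univ ∧ lift γ 0 = u ∧ lift γ t = w

end Metric

/-! ### Orientations and the quasi-antipodal map -/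

variable (M) in
/-- An orientation of the surface `M`, represented by a positive 2-form: a continuous 2-form
that vanishes nowhere. -/
structure OrientationForm where
  /-- The value of the form at a point. -/
  form : ∀ p : M, TangentSpace (𝓡 2) p [⋀^Fin 2]→ₗ[ℝ] ℝ
  form_ne_zero : ∀ p, form p ≠ 0
  continuousOn_form : ∀ (c : M) (v w : Plane),
    ContinuousOn (fun x : Plane => form (chartVector c x v).1
      ![(chartVector c x v).2, (chartVector c x w).2]) (extChartAt (𝓡 2) c).target

/-- `α` reverses the orientation: it carries positively oriented frames to negatively oriented
ones. -/
def OrientationForm.IsReversedBy (o : OrientationForm M) (α : M → M) : Prop :=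
  ∀ (p : M) (v w : TangentSpace (𝓡 2) p), 0 < o.form p ![v, w] →
    o.form (α p) ![mfderiv (𝓡 2) (𝓡 2) α p v, mfderiv (𝓡 2) (𝓡 2) α p w] < 0

/-- `α` is a quasi-antipodal map of `(M, Σ)`: an orientation-reversing Finsler isometry whose
differential `α'` agrees on `Σ` with the time `π` map `Ψ_π` of the geodesic flow. -/
structure Metric.IsQuasiAntipodal (F : Metric M) (o : OrientationForm M)
    (α : Diffeomorph (𝓡 2) (𝓡 2) M M ∞) : Prop where
  isometry : ∀ u : TangentBundle (𝓡 2) M, F.norm (tangentMap (𝓡 2) (𝓡 2) α u) = F.norm u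
  reverses : o.IsReversedBy α
  flow : ∀ u ∈ F.unitBundle, F.GeodesicFlow Real.pi u (tangentMap (𝓡 2) (𝓡 2) α u)

end Finsler

end

/-! For curvature one, the covariant Jacobi equation of a field normal to a unit speed geodesic is
`D²J = -J`. Hence `q = g(J, J)` satisfies `q''' = -4 q'`, and if `J` vanishes at time `0` then `q`
is a multiple of `sin²` (`verticalHess_eq_mul_sin_sq`). At time `π` the variation field of every
pencil of geodesics through `p` therefore vanishes, so the end point does not depend on the
direction: the punctured tangent plane is connected, and all geodesics from `p` meet at one point
`α(p)`, written `conj π p` (`geo_eq_conj`). Since `α` shifts every geodesic by time `π`, its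
differential on unit vectors is `Ψ_π`. So `α` is an isometry with inverse `conj (-π)`, and it is the
only map with this differential.

Orientation: the area spanned by the velocity and a Jacobi field `J` with `J(0) = 0` has a simple
zero at time `0` and no other zero in `(-π, π)`. It has opposite signs at `-π/2` and `π/2`, and `α`
carries the first frame to the second (`area_mul_neg`, `reverses_conj`).

Involution: `exp_p` is a local homeomorphism on the open `F`-ball of radius `π` and collapses the
bounding sphere to `α(p)`. Over the complement of `α(p)`, which is a plane, it restricts to a
covering with connected total space, hence is injective there. A neighbourhood argument shows that
`α(p)` itself is not attained inside the ball, so `exp_p` is injective on the whole open ball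
(`injOn_expMap`): two different geodesics from a point do not meet again before time `π`.

Now reverse the geodesic through `p` with direction `e`. The reversed geodesic runs from `p` to
`α⁻¹(p)`, in some time `T`. If `T = π`, then `α⁻¹(p) = α(p)`. If `T < π`, a geodesic from `p`
reaches `α⁻¹(p)` early, which by injectivity happens for at most one `e`. If `T > π`, a geodesic
from `α⁻¹(p)` reaches `α(p)` early, again for at most one `e`. Three directions rule out the last
two cases (`conj_cases`, `conj_neg_eq`), so `α² = id` and all geodesics have period `2π`.
Injectivity of `exp_p` excludes shorter periods.

Much of the file supplies foundations: smooth dependence of flows on initial data, the spray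
calculus of `F²` in a chart, chart independence of the geodesic equation, and completeness and
smoothness of the geodesic flow. -/

noncomputable section

namespace Finsler

/-! ### Smooth dependence of flows on initial data, through the implicit function theorem in spaces
of continuous curves. -/

section Superposition

universe u

variable {K : Type*} [TopologicalSpace K] [CompactSpace K]
  {E F : Type u} [NormedAddCommGroup E] [NormedSpace ℝ E] [NormedAddCommGroup F] [NormedSpace ℝ F]

/-- Pointwise application of a continuous family of linear maps. -/
def pointwiseApply : C(K, E →L[ℝ] F) →L[ℝ] C(K, E) →L[ℝ] C(K, F) :=
  LinearMap.mkContinuous₂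
    (LinearMap.mk₂ ℝ (fun (A : C(K, E →L[ℝ] F)) (h : C(K, E)) => (⟨fun t => A t (h t), by fun_prop⟩ : C(K, F)))
      (fun _ _ _ => by ext; simp) (fun _ _ _ => by ext; simp) (fun _ _ _ => by ext; simp)
      (fun _ _ _ => by ext; simp)) 1 (by
    intro A h
    rw [ContinuousMap.norm_le _ (by positivity)]
    intro t
    simp only [LinearMap.mk₂_apply, ContinuousMap.coe_mk, one_mul]
    exact (ContinuousLinearMap.le_opNorm _ _).trans
      (mul_le_mul (A.norm_coe_le_norm t) (h.norm_coe_le_norm t) (norm_nonneg _) (norm_nonneg A)))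

@[simp] theorem pointwiseApply_apply (A : C(K, E →L[ℝ] F)) (h : C(K, E)) (t : K) :
    pointwiseApply A h t = A t (h t) := rfl

/-- The derivative of `f` is uniformly close to its values on the compact image of `α`, and the mean
value inequality turns this into a remainder estimate that is uniform in the point of `K`. -/
theorem hasFDerivAt_superposition {f : E → F} (hf : ContDiff ℝ 1 f) (α : C(K, E)) :
    HasFDerivAt (fun α : C(K, E) => (⟨f, hf.continuous⟩ : C(E, F)).comp α)
      (pointwiseApply ((⟨fderiv ℝ f, hf.continuous_fderiv one_ne_zero⟩ : C(E, E →L[ℝ] F)).comp α))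
      α := by
  have hc : Continuous (fderiv ℝ f) := hf.continuous_fderiv one_ne_zero
  rw [hasFDerivAt_iff_isLittleO_nhds_zero, Asymptotics.isLittleO_iff]
  intro ε hε
  have h1 : ∀ᶠ v : E in 𝓝 0, ∀ t ∈ (univ : Set K), ‖fderiv ℝ f (α t + v) - fderiv ℝ f (α t)‖ < ε := by
    refine isCompact_univ.eventually_forall_of_forall_eventually fun t _ => ?_
    have : ContinuousAt (fun p : E × K => ‖fderiv ℝ f (α p.2 + p.1) - fderiv ℝ f (α p.2)‖) (0, t) := by
      fun_prop
    exact this.eventually (gt_mem_nhds (by simpa using hε))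
  obtain ⟨δ, hδ, h2⟩ := Metric.eventually_nhds_iff_ball.1 h1
  filter_upwards [Metric.ball_mem_nhds (0 : C(K, E)) hδ] with h hh
  rw [ContinuousMap.norm_le _ (by positivity)]
  intro t
  have hht : ‖h t‖ < δ := (h.norm_coe_le_norm t).trans_lt (by simpa using hh)
  have h3 := (convex_ball (α t) δ).norm_image_sub_le_of_norm_hasFDerivWithin_le' (f := f)
    (f' := fderiv ℝ f) (φ := fderiv ℝ f (α t)) (C := ε) (x := α t) (y := α t + h t)
    (fun x _ => (hf.differentiable one_ne_zero x).hasFDerivAt.hasFDerivWithinAt)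
    (fun x hx => by
      have := h2 (x - α t) (by simpa [dist_eq_norm] using hx) t (mem_univ _)
      simpa using this.le)
    (by simpa using hδ) (by simpa using hht)
  simp only [add_sub_cancel_left] at h3
  refine (le_trans ?_ h3).trans (by gcongr; exact h.norm_coe_le_norm t)
  simp

/-- The derivative of a superposition operator is again one, with `f` replaced by `fderiv ℝ f`; this
gives the induction. The target changes from `F` to `E →L[ℝ] F`, so `F` is quantified inside the
induction and shares its universe with `E`. -/
theorem contDiff_superposition_nat (n : ℕ) : ∀ {F : Type u} [NormedAddCommGroup F] [NormedSpace ℝ F]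
    {f : E → F} (hf : ContDiff ℝ n f),
    ContDiff ℝ n (fun α : C(K, E) => (⟨f, hf.continuous⟩ : C(E, F)).comp α) := by
  induction n with
  | zero =>
    intro F _ _ f hf
    exact contDiff_zero.2 (ContinuousMap.continuous_postcomp _)
  | succ n ih =>
    intro F _ _ f hf
    have hf1 : ContDiff ℝ 1 f := hf.of_le (by exact_mod_cast Nat.le_add_left 1 n)
    have hf2 : ContDiff ℝ n (fderiv ℝ f) := hf.fderiv_right (by norm_cast)
    have hd : ∀ α : C(K, E), HasFDerivAt _ _ α := hasFDerivAt_superposition (K := K) hf1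
    refine contDiff_succ_iff_hasFDerivAt (n := n) |>.2 ⟨_, ?_, hd⟩
    exact pointwiseApply.contDiff.comp (ih hf2)

theorem contDiff_superposition {n : ℕ∞} {f : E → F} (hf : ContDiff ℝ n f) :
    ContDiff ℝ n (fun α : C(K, E) => (⟨f, hf.continuous⟩ : C(E, F)).comp α) := by
  rw [contDiff_iff_forall_nat_le]
  intro m hm
  exact contDiff_superposition_nat m (hf.of_le (by exact_mod_cast hm))

end Superposition

section Primitive

variable {E : Type*} [NormedAddCommGroup E] [NormedSpace ℝ E]

/-- The primitive vanishing at `0` of a continuous function on the unit interval. -/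
def primitive : C(Icc (0 : ℝ) 1, E) →L[ℝ] C(Icc (0 : ℝ) 1, E) :=
  LinearMap.mkContinuous
    { toFun := fun α => ⟨fun t => ∫ τ in (0 : ℝ)..t, IccExtend zero_le_one α τ, by
        have : Continuous (IccExtend zero_le_one α) := α.continuous.Icc_extend'
        exact (intervalIntegral.continuous_primitive
          (fun a b => this.intervalIntegrable a b) 0).comp continuous_subtype_val⟩
      map_add' := fun α β => by
        ext t
        have h1 : Continuous (IccExtend zero_le_one α) := α.continuous.Icc_extend'
        have h2 : Continuous (IccExtend zero_le_one β) := β.continuous.Icc_extend'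
        simp only [ContinuousMap.coe_mk, ContinuousMap.add_apply]
        rw [← intervalIntegral.integral_add (h1.intervalIntegrable _ _) (h2.intervalIntegrable _ _)]
        rfl
      map_smul' := fun c α => by
        ext t
        simp only [ContinuousMap.coe_mk, ContinuousMap.smul_apply, RingHom.id_apply]
        rw [← intervalIntegral.integral_smul]
        rfl } 1 (by
    intro α
    rw [ContinuousMap.norm_le _ (by positivity)]
    intro t
    simp only [LinearMap.coe_mk, AddHom.coe_mk, ContinuousMap.coe_mk, one_mul]
    refine (intervalIntegral.norm_integral_le_of_norm_le_const
      (C := ‖α‖) fun x _ => α.norm_coe_le_norm _).trans ?_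
    have h0 := t.2.1
    have h1 := t.2.2
    rw [sub_zero, abs_of_nonneg h0]
    exact mul_le_of_le_one_right (norm_nonneg _) h1)

end Primitive

section Flow

universe u

variable {E : Type u} [NormedAddCommGroup E] [NormedSpace ℝ E] [CompleteSpace E]

/-- The local flow of a `C^n` vector field is `C^n`. -/
theorem exists_contDiffAt_flow {n : ℕ∞} (hn : 1 ≤ n) {f : E → E} (hf : ContDiff ℝ n f) (x₀ : E) :
    ∃ φ : E × ℝ → E, ContDiffAt ℝ n φ (x₀, 0) ∧ ∀ᶠ p : E × ℝ in 𝓝 (x₀, 0),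
      φ (p.1, 0) = p.1 ∧ HasDerivAt (fun s => φ (p.1, s)) (f (φ p)) p.2 := by
  have hn1 : (1 : ℕ∞ω) ≤ n := by exact_mod_cast hn
  have hn0 : (n : ℕ∞ω) ≠ 0 := by
    intro h
    rw [h] at hn1
    simp at hn1
  have hf1 : ContDiffAt ℝ 1 f x₀ := (hf.of_le hn1).contDiffAt
  obtain ⟨ε, hε, a, r, _, _, hr, hpl⟩ := IsPicardLindelof.of_contDiffAt_one hf1
  obtain ⟨Y, hY, hYc⟩ := (hpl 0).exists_forall_mem_closedBall_eq_hasDerivWithinAt_continuousOn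
  simp only [zero_sub, zero_add] at hY hYc
  have hnhds : Metric.closedBall x₀ r ×ˢ Icc (-ε) ε ∈ 𝓝 (x₀, (0 : ℝ)) :=
    prod_mem_nhds (Metric.closedBall_mem_nhds _ (by exact_mod_cast hr))
      (Icc_mem_nhds (by linarith) hε)
  have hYat : ContinuousAt Y (x₀, 0) := hYc.continuousAt hnhds
  have hY0 : ∀ x ∈ Metric.closedBall x₀ (r : ℝ), Y (x, 0) = x := fun x hx => (hY x hx).1
  set I := Icc (0 : ℝ) 1
  -- Time is rescaled to the unit interval: a zero `β` of `P ((x, s), ·)` satisfies `β t = x + s ∫₀ᵗ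
  -- f(β)`, so `β t` is the flow of `x` at time `s * t`. The duration `s` becomes an ordinary
  -- parameter and the flow is read off at `t = 1`.
  let P : (E × ℝ) × C(I, E) → C(I, E) := fun q =>
    q.2 - ContinuousMap.const I q.1.1
      - q.1.2 • primitive ((⟨f, hf.continuous⟩ : C(E, E)).comp q.2)
  let cst : E →L[ℝ] C(I, E) := LinearMap.mkContinuous
    { toFun := fun x => ContinuousMap.const I x
      map_add' := fun _ _ => rfl
      map_smul' := fun _ _ => rfl } 1 (fun x => by
        rw [ContinuousMap.norm_le _ (by positivity)]
        intro t
        rw [one_mul]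
        exact le_rfl)
  have hP : ContDiff ℝ n P := by
    have h1 := (contDiff_superposition (K := I) hf)
    refine (contDiff_snd.sub (cst.contDiff.comp (contDiff_fst.comp contDiff_fst))).sub ?_
    exact (contDiff_snd.comp contDiff_fst).smul
      (primitive.contDiff.comp (h1.comp contDiff_snd))
  let u : (E × ℝ) × C(I, E) := ((x₀, 0), ContinuousMap.const I x₀)
  have hPu : P u = 0 := by
    ext t
    simp [P, u]
  -- At `s = 0` the integral term disappears, so the partial derivative in the curve is the
  -- identity.
  have hinv : (fderiv ℝ P u ∘L .inr ℝ (E × ℝ) C(I, E)).IsInvertible := by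
    have h1 : HasFDerivAt (fun β : C(I, E) => P ((x₀, 0), β))
        (fderiv ℝ P u ∘L .inr ℝ (E × ℝ) C(I, E)) (ContinuousMap.const I x₀) :=
      HasFDerivAt.comp (ContinuousMap.const I x₀)
        ((hP.differentiable hn0 u).hasFDerivAt) (hasFDerivAt_prodMk_right _ _)
    have h2 : HasFDerivAt (fun β : C(I, E) => P ((x₀, 0), β))
        (ContinuousLinearMap.id ℝ C(I, E)) (ContinuousMap.const I x₀) := by
      have : (fun β : C(I, E) => P ((x₀, 0), β)) = fun β => β - ContinuousMap.const I x₀ := by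
        ext β t
        simp [P]
      rw [this]
      exact (hasFDerivAt_id _).sub_const _
    rw [h1.unique h2]
    exact ⟨ContinuousLinearEquiv.refl ℝ _, rfl⟩
  have hPat : ContDiffAt ℝ n P u := hP.contDiffAt
  have huniq := hPat.eventually_apply_eq_iff_implicitFunction hn0 hinv
  have hsm := hPat.contDiffAt_implicitFunction hn0 hinv
  set ψ := hPat.implicitFunction hn0 hinv
  refine ⟨fun p => ψ p ⟨1, by simp [I]⟩, ?_, ?_⟩
  · exact (ContinuousMap.evalCLM ℝ (⟨1, by simp [I]⟩ : I)).contDiff.contDiffAt.comp (x₀, (0 : ℝ)) hsm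
  -- The Picard–Lindelöf curve `t ↦ Y (x, s * t)` also solves `P = 0` and is uniformly near `x₀`.
  -- Local uniqueness of the implicit function identifies the two, which transfers the differential
  -- equation to `ψ`.
  have key : ∀ᶠ p : E × ℝ in 𝓝 (x₀, 0), ψ p ⟨1, by simp [I]⟩ = Y p := by
    rw [show 𝓝 u = 𝓝 (x₀, (0 : ℝ)) ×ˢ 𝓝 (ContinuousMap.const I x₀) from nhds_prod_eq,
      Filter.eventually_prod_iff] at huniq
    obtain ⟨pa, hpa, pb, hpb, hab⟩ := huniq
    obtain ⟨η, hη, hball⟩ := Metric.eventually_nhds_iff_ball.1 hpb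
    have h1 : ∀ᶠ p : E × ℝ in 𝓝 (x₀, 0), p ∈ Metric.closedBall x₀ r ×ˢ Icc (-ε) ε ∧
        dist (Y p) x₀ < η / 2 := by
      have := hYat.eventually (Metric.ball_mem_nhds _ (half_pos hη))
      filter_upwards [hnhds, this] with p hp1 hp
      rw [hY0 x₀ (by simp)] at hp
      exact ⟨hp1, hp⟩
    obtain ⟨δ, hδ, hδb⟩ := Metric.eventually_nhds_iff_ball.1 h1
    filter_upwards [Metric.ball_mem_nhds _ hδ, hpa] with p hp hpap
    obtain ⟨x, s⟩ := p
    have hmem : ∀ t : ℝ, t ∈ I → (x, s * t) ∈ Metric.ball (x₀, (0 : ℝ)) δ := by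
      intro t ht
      rw [Metric.mem_ball, Prod.dist_eq, max_lt_iff] at hp ⊢
      refine ⟨hp.1, lt_of_le_of_lt ?_ hp.2⟩
      simp only [dist_zero_right, Real.norm_eq_abs, abs_mul]
      exact mul_le_of_le_one_right (abs_nonneg _) (by rw [abs_of_nonneg ht.1]; exact ht.2)
    have hcont : ContinuousOn (fun t => Y (x, s * t)) I :=
      hYc.comp (by fun_prop) fun t ht => (hδb _ (hmem t ht)).1
    let β : C(I, E) := ⟨fun t => Y (x, s * t), hcont.domRestrict⟩
    have hβ : dist β (ContinuousMap.const I x₀) < η := by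
      refine lt_of_le_of_lt ((ContinuousMap.dist_le (half_pos hη).le).2 fun t => ?_) (half_lt_self hη)
      exact (hδb _ (hmem t t.2)).2.le
    have hx : x ∈ Metric.closedBall x₀ (r : ℝ) := (hδb _ hp).1.1
    have hder : ∀ t ∈ I, HasDerivWithinAt (fun t => Y (x, s * t)) (s • f (Y (x, s * t))) I t := by
      intro t ht
      have h2 := (hY x hx).2 (s * t) (hδb _ (hmem t ht)).1.2
      have h3 : HasDerivWithinAt (fun t : ℝ => s * t) s I t := by
        simpa using ((hasDerivAt_id t).const_mul s).hasDerivWithinAt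
      exact HasDerivWithinAt.scomp t h2 h3 fun t ht => (hδb _ (hmem t ht)).1.2
    have hPβ : P ((x, s), β) = 0 := by
      ext t
      have hfc : ContinuousOn (fun t => s • f (Y (x, s * t))) I :=
        (hf.continuous.comp_continuousOn hcont).const_smul s
      have hsub : Icc (0 : ℝ) t ⊆ I := Icc_subset_Icc_right t.2.2
      have h4 : ∫ τ in (0 : ℝ)..t, s • f (Y (x, s * τ)) = Y (x, s * t) - Y (x, s * 0) := by
        refine intervalIntegral.integral_eq_sub_of_hasDeriv_right_of_le t.2.1 (hcont.mono hsub) ?_ ?_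
        · intro τ hτ
          have hτ' : τ ∈ Ioo (0 : ℝ) 1 := ⟨hτ.1, hτ.2.trans_le t.2.2⟩
          exact ((hder τ ⟨hτ'.1.le, hτ'.2.le⟩).hasDerivAt
            (Icc_mem_nhds hτ'.1 hτ'.2)).hasDerivWithinAt
        · refine ContinuousOn.intervalIntegrable ?_
          rw [uIcc_of_le t.2.1]
          exact hfc.mono hsub
      have h5 : s • (∫ τ in (0 : ℝ)..t, IccExtend zero_le_one
          ((⟨f, hf.continuous⟩ : C(E, E)).comp β) τ) = Y (x, s * t) - x := by
        rw [← intervalIntegral.integral_smul, ← hY0 x hx, hY0 x hx]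
        rw [mul_zero, hY0 x hx] at h4
        rw [← h4]
        refine intervalIntegral.integral_congr fun τ hτ => ?_
        rw [uIcc_of_le t.2.1] at hτ
        simp only [IccExtend_of_mem zero_le_one _ (hsub hτ), ContinuousMap.comp_apply]
        rfl
      change β t - x - s • (∫ τ in (0 : ℝ)..t, IccExtend zero_le_one
          ((⟨f, hf.continuous⟩ : C(E, E)).comp β) τ) = 0
      rw [h5]
      exact sub_self _
    have h6 := (hab hpap (hball β hβ)).1 (by rw [hPβ, hPu])
    have h7 : ψ (x, s) = β := h6
    rw [h7]
    change Y (x, s * 1) = Y (x, s)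
    rw [mul_one]
  filter_upwards [key.eventually_nhds, prod_mem_nhds
    (Metric.ball_mem_nhds x₀ (ε := r) (by exact_mod_cast hr))
      (Ioo_mem_nhds (neg_lt_zero.2 hε) hε), 
    (show ∀ᶠ p : E × ℝ in 𝓝 (x₀, 0), ψ (p.1, 0) ⟨1, by simp [I]⟩ = Y (p.1, 0) from by
      have : Filter.Tendsto (fun p : E × ℝ => (p.1, (0 : ℝ))) (𝓝 (x₀, 0)) (𝓝 (x₀, 0)) :=
        ((continuous_fst.prodMk continuous_const).tendsto (x₀, (0 : ℝ)))
      exact this.eventually key)] with p hp hpm hp0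
  have hx : p.1 ∈ Metric.closedBall x₀ (r : ℝ) := Metric.ball_subset_closedBall hpm.1
  refine ⟨hp0.trans (hY0 _ hx), ?_⟩
  have h8 := ((hY p.1 hx).2 p.2 ⟨hpm.2.1.le, hpm.2.2.le⟩).hasDerivAt (Icc_mem_nhds hpm.2.1 hpm.2.2)
  have h9 : (fun s => ψ (p.1, s) ⟨1, by simp [I]⟩) =ᶠ[𝓝 p.2] fun s => Y (p.1, s) := by
    have : Filter.Tendsto (fun s : ℝ => (p.1, s)) (𝓝 p.2) (𝓝 p) :=
      (continuous_const.prodMk continuous_id).tendsto p.2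
    exact this.eventually hp
  have h10 := h8.congr_of_eventuallyEq h9
  rwa [← hp.self_of_nhds] at h10

end Flow

end Finsler

end

noncomputable section

namespace Finsler

/-! ### Flows of vector fields defined on an open set only. -/

section LocalFlow

variable {E : Type*} [NormedAddCommGroup E] [NormedSpace ℝ E] [FiniteDimensional ℝ E]

/-- The local flow of a vector field that is `C^n` near a point is `C^n`. -/
theorem exists_contDiffAt_flow_of_contDiffOn {n : ℕ∞} (hn : 1 ≤ n) {f : E → E} {U : Set E}
    (hU : IsOpen U) (hf : ContDiffOn ℝ n f U) {x₀ : E} (hx₀ : x₀ ∈ U) :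
    ∃ φ : E × ℝ → E, ContDiffAt ℝ n φ (x₀, 0) ∧ ∀ᶠ p : E × ℝ in 𝓝 (x₀, 0),
      φ p ∈ U ∧ φ (p.1, 0) = p.1 ∧ HasDerivAt (fun s => φ (p.1, s)) (f (φ p)) p.2 := by
  obtain ⟨r, hr, hrU⟩ := Metric.isOpen_iff.1 hU x₀ hx₀
  -- Multiplication by a bump function makes the field global without changing it on the ball of
  -- radius `r / 4`, where short trajectories stay.
  let χ : ContDiffBump x₀ := ⟨r / 4, r / 2, by positivity, by linarith⟩
  have hg : ContDiff ℝ n (fun x => χ x • f x) := by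
    rw [contDiff_iff_contDiffAt]
    intro x
    by_cases hx : x ∈ Metric.ball x₀ r
    · exact χ.contDiff.contDiffAt.smul (hf.contDiffAt (hU.mem_nhds (hrU hx)))
    · have : (fun x => χ x • f x) =ᶠ[𝓝 x] fun _ => 0 := by
        have hx' : x ∈ (Metric.closedBall x₀ (r / 2))ᶜ := by
          simp only [Metric.mem_ball, not_lt, mem_compl_iff, Metric.mem_closedBall, not_le] at hx ⊢
          linarith
        filter_upwards [Metric.isClosed_closedBall.isOpen_compl.mem_nhds hx'] with z hz
        have : χ z = 0 := χ.zero_of_le_dist (by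
          simp only [mem_compl_iff, Metric.mem_closedBall, not_le] at hz
          exact hz.le)
        simp [this]
      exact contDiffAt_const.congr_of_eventuallyEq this
  have := FiniteDimensional.complete ℝ E
  obtain ⟨φ, hφ, hφ'⟩ := exists_contDiffAt_flow hn hg x₀
  refine ⟨φ, hφ, ?_⟩
  have h0 : φ (x₀, 0) = x₀ := hφ'.self_of_nhds.1
  have h1 : ∀ᶠ p in 𝓝 (x₀, (0 : ℝ)), φ p ∈ Metric.ball x₀ (r / 4) := by
    refine hφ.continuousAt.eventually ?_
    rw [h0]
    exact Metric.ball_mem_nhds _ (by positivity)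
  filter_upwards [hφ', h1] with p hp hp1
  refine ⟨hrU (Metric.ball_subset_ball (by linarith) hp1), hp.1, ?_⟩
  have h2 : χ (φ p) = 1 := χ.one_of_mem_closedBall (Metric.ball_subset_closedBall hp1)
  simpa [h2] using hp.2

end LocalFlow

/-! ### Partial derivatives in position and velocity, and Euler's identities for homogeneous
functions. -/

section Partial

variable {E E' V : Type*} [NormedAddCommGroup E] [NormedSpace ℝ E] [NormedAddCommGroup E']
  [NormedSpace ℝ E'] [NormedAddCommGroup V] [NormedSpace ℝ V] {G : E → E' → V} {W : Set (E × E')}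

/-- The derivative in the first variable. -/
abbrev dx (G : E → E' → V) (x : E) (y : E') : E →L[ℝ] V := fderiv ℝ (fun x' => G x' y) x

/-- The derivative in the second variable. -/
abbrev dy (G : E → E' → V) (x : E) (y : E') : E' →L[ℝ] V := fderiv ℝ (G x) y

theorem dx_eq {x : E} {y : E'} (h : DifferentiableAt ℝ (uncurry G) (x, y)) :
    dx G x y = fderiv ℝ (uncurry G) (x, y) ∘L .inl ℝ E E' :=
  (HasFDerivAt.comp (g := uncurry G) (f := fun x' => (x', y)) x h.hasFDerivAt
    (hasFDerivAt_prodMk_left x y)).fderiv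

theorem dy_eq {x : E} {y : E'} (h : DifferentiableAt ℝ (uncurry G) (x, y)) :
    dy G x y = fderiv ℝ (uncurry G) (x, y) ∘L .inr ℝ E E' :=
  (HasFDerivAt.comp (g := uncurry G) y h.hasFDerivAt (hasFDerivAt_prodMk_right x y)).fderiv

theorem contDiffOn_dx (hW : IsOpen W) (hG : ContDiffOn ℝ ∞ (uncurry G) W) :
    ContDiffOn ℝ ∞ (uncurry (dx G)) W := by
  have h1 : ContDiffOn ℝ ∞ (fun z => fderiv ℝ (uncurry G) z ∘L .inl ℝ E E') W :=
    (hG.fderiv_of_isOpen hW (by norm_num)).clm_comp contDiffOn_const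
  refine h1.congr fun z hz => ?_
  exact dx_eq ((hG.contDiffAt (hW.mem_nhds hz)).differentiableAt (by norm_num))

theorem contDiffOn_dy (hW : IsOpen W) (hG : ContDiffOn ℝ ∞ (uncurry G) W) :
    ContDiffOn ℝ ∞ (uncurry (dy G)) W := by
  have h1 : ContDiffOn ℝ ∞ (fun z => fderiv ℝ (uncurry G) z ∘L .inr ℝ E E') W :=
    (hG.fderiv_of_isOpen hW (by norm_num)).clm_comp contDiffOn_const
  refine h1.congr fun z hz => ?_
  exact dy_eq ((hG.contDiffAt (hW.mem_nhds hz)).differentiableAt (by norm_num))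

theorem differentiableAt_uncurry (hW : IsOpen W) (hG : ContDiffOn ℝ ∞ (uncurry G) W) {x : E}
    {y : E'} (h : (x, y) ∈ W) : DifferentiableAt ℝ (uncurry G) (x, y) :=
  (hG.contDiffAt (hW.mem_nhds h)).differentiableAt (by norm_num)

theorem differentiableAt_fst (hW : IsOpen W) (hG : ContDiffOn ℝ ∞ (uncurry G) W) {x : E}
    {y : E'} (h : (x, y) ∈ W) : DifferentiableAt ℝ (fun x' => G x' y) x :=
  (HasFDerivAt.comp (g := uncurry G) (f := fun x' => (x', y)) x
    (differentiableAt_uncurry hW hG h).hasFDerivAt (hasFDerivAt_prodMk_left x y)).differentiableAt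

theorem differentiableAt_snd (hW : IsOpen W) (hG : ContDiffOn ℝ ∞ (uncurry G) W) {x : E}
    {y : E'} (h : (x, y) ∈ W) : DifferentiableAt ℝ (G x) y :=
  (HasFDerivAt.comp (g := uncurry G) y (differentiableAt_uncurry hW hG h).hasFDerivAt
    (hasFDerivAt_prodMk_right x y)).differentiableAt

theorem dx_dy_comm (hW : IsOpen W) (hG : ContDiffOn ℝ ∞ (uncurry G) W) {x : E} {y : E'}
    (h : (x, y) ∈ W) (a : E) (b : E') : dx (dy G) x y a b = dy (dx G) x y b a := by
  have hc : ContDiffAt ℝ ∞ (uncurry G) (x, y) := hG.contDiffAt (hW.mem_nhds h)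
  have hd : DifferentiableAt ℝ (fderiv ℝ (uncurry G)) (x, y) :=
    (hc.fderiv_right (m := 1) (by norm_cast)).differentiableAt one_ne_zero
  have hev : ∀ᶠ z : E × E' in 𝓝 (x, y), z ∈ W := hW.mem_nhds h
  have h1 : dx (dy G) x y = fderiv ℝ (fun x' => fderiv ℝ (uncurry G) (x', y) ∘L .inr ℝ E E') x := by
    refine Filter.EventuallyEq.fderiv_eq ?_
    have : Filter.Tendsto (fun x' => (x', y)) (𝓝 x) (𝓝 (x, y)) :=
      (Continuous.prodMk_left y).tendsto x
    filter_upwards [this.eventually hev] with x' hx'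
    exact dy_eq (differentiableAt_uncurry hW hG hx')
  have h2 : dy (dx G) x y = fderiv ℝ (fun y' => fderiv ℝ (uncurry G) (x, y') ∘L .inl ℝ E E') y := by
    refine Filter.EventuallyEq.fderiv_eq ?_
    have : Filter.Tendsto (fun y' => (x, y')) (𝓝 y) (𝓝 (x, y)) :=
      (Continuous.prodMk_right x).tendsto y
    filter_upwards [this.eventually hev] with y' hy'
    exact dx_eq (differentiableAt_uncurry hW hG hy')
  have h3 : HasFDerivAt (fun x' => fderiv ℝ (uncurry G) (x', y))
      (fderiv ℝ (fderiv ℝ (uncurry G)) (x, y) ∘L .inl ℝ E E') x :=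
    HasFDerivAt.comp x hd.hasFDerivAt (hasFDerivAt_prodMk_left x y)
  have h4 : HasFDerivAt (fun y' => fderiv ℝ (uncurry G) (x, y'))
      (fderiv ℝ (fderiv ℝ (uncurry G)) (x, y) ∘L .inr ℝ E E') y :=
    HasFDerivAt.comp y hd.hasFDerivAt (hasFDerivAt_prodMk_right x y)
  rw [h1, h2, (h3.clm_comp (hasFDerivAt_const _ _)).fderiv, (h4.clm_comp (hasFDerivAt_const _ _)).fderiv]
  have hs := hc.isSymmSndFDerivAt (by simp; norm_cast)
  simpa using hs (a, 0) (0, b)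

theorem dy_dy_comm (hW : IsOpen W) (hG : ContDiffOn ℝ ∞ (uncurry G) W) {x : E} {y : E'}
    (h : (x, y) ∈ W) (a b : E') : dy (dy G) x y a b = dy (dy G) x y b a := by
  have hc : ContDiffAt ℝ ∞ (uncurry G) (x, y) := hG.contDiffAt (hW.mem_nhds h)
  have h1 : ContDiffAt ℝ ∞ (G x) y := hc.comp y (contDiffAt_const.prodMk contDiffAt_id)
  exact h1.isSymmSndFDerivAt (by simp; norm_cast) a b

/-- The chain rule for a function of two variables along a curve. -/
theorem hasDerivAt_comp₂ {x : ℝ → E} {y : ℝ → E'} {a : E} {b : E'} {t : ℝ}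
    (h : DifferentiableAt ℝ (uncurry G) (x t, y t)) (hx : HasDerivAt x a t) (hy : HasDerivAt y b t) :
    HasDerivAt (fun t => G (x t) (y t)) (dx G (x t) (y t) a + dy G (x t) (y t) b) t := by
  have h1 := h.hasFDerivAt.comp_hasDerivAt t (hx.prodMk hy)
  rw [dx_eq h, dy_eq h]
  convert! h1 using 1
  simp [← map_add]

/-- Euler's identity. -/
theorem fderiv_self_of_homogeneous {H : E → V} {k : ℕ} {y : E} (hd : DifferentiableAt ℝ H y)
    (hH : ∀ r : ℝ, 0 < r → H (r • y) = r ^ k • H y) : fderiv ℝ H y y = (k : ℝ) • H y := by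
  have h1 : HasDerivAt (fun r : ℝ => H (r • y)) (fderiv ℝ H y y) 1 := by
    have h2 : HasDerivAt (fun r : ℝ => r • y) y 1 := by
      simpa using (hasDerivAt_id (1 : ℝ)).smul_const y
    exact HasFDerivAt.comp_hasDerivAt (1 : ℝ) (by simpa using hd.hasFDerivAt) h2
  have h3 : HasDerivAt (fun r : ℝ => r ^ k • H y) ((k : ℝ) • H y) 1 := by
    simpa using (hasDerivAt_pow k (1 : ℝ)).smul_const (H y)
  refine h1.unique (h3.congr_of_eventuallyEq ?_)
  filter_upwards [lt_mem_nhds (zero_lt_one' ℝ)] with r hr using hH r hr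

/-- The derivative of a homogeneous function is homogeneous. -/
theorem fderiv_smul_of_homogeneous {H : E → V} {k : ℕ} {y : E} {r : ℝ} (hr : 0 < r)
    (hd : DifferentiableAt ℝ H (r • y))
    (hH : ∀ᶠ z in 𝓝 y, H (r • z) = r ^ k • H z) : r • fderiv ℝ H (r • y) = r ^ k • fderiv ℝ H y := by
  have h1 : HasFDerivAt (fun z => H (r • z)) (r • fderiv ℝ H (r • y)) y := by
    have h2 : HasFDerivAt (fun z : E => r • z) (r • ContinuousLinearMap.id ℝ E) y :=
      (hasFDerivAt_id y).const_smul r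
    convert! HasFDerivAt.comp y hd.hasFDerivAt h2 using 1
    ext v
    simp
  have h3 : fderiv ℝ (fun z => H (r • z)) y = r ^ k • fderiv ℝ H y := by
    rw [Filter.EventuallyEq.fderiv_eq hH]
    have := fderiv_const_smul_field (𝕜 := ℝ) (f := H) (r ^ k)
    exact congrFun this y
  rw [← h3, h1.fderiv]

end Partial

end Finsler

end

noncomputable section

namespace Finsler

/-! ### The geometry of a function `L = F²` on an open set of the plane -/

section Lagrangian

/-- The fundamental tensor of `L`. -/
abbrev tensorOf (L : Plane → Plane → ℝ) (x y : Plane) : Plane →L[ℝ] Plane →L[ℝ] ℝ :=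
  (1 / 2 : ℝ) • dy (dy L) x y

/-- The spray covector of `L`. -/
abbrev sprayCovectorOf (L : Plane → Plane → ℝ) (x y : Plane) : Plane →L[ℝ] ℝ :=
  dx (dy L) x y y - dx L x y

/-- The spray coefficients of `L`. -/
def sprayOf (L : Plane → Plane → ℝ) (x y : Plane) : Plane :=
  (1 / 4 : ℝ) • (tensorOf L x y).inverse (sprayCovectorOf L x y)

/-- The Riemann curvature of a spray. -/
abbrev riemannOf (G : Plane → Plane → Plane) (x y v : Plane) : Plane :=
  (2 : ℝ) • dx G x y v - fderiv ℝ (fun x' => dy G x' y v) x y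
    + (2 : ℝ) • fderiv ℝ (fun y' => dy G x y' v) y (G x y) - dy G x y (dy G x y v)

/-- The square of a Finsler norm on an open set of the plane. -/
structure IsFinslerSq (U : Set Plane) (L : Plane → Plane → ℝ) : Prop where
  isOpen : IsOpen U
  contDiffOn : ContDiffOn ℝ ∞ (uncurry L) (U ×ˢ {0}ᶜ)
  smul : ∀ x ∈ U, ∀ (y : Plane) (r : ℝ), 0 < r → L x (r • y) = r ^ 2 * L x y
  pos : ∀ x ∈ U, ∀ y : Plane, y ≠ 0 → 0 < L x y
  convex : ∀ x ∈ U, ∀ y v : Plane, y ≠ 0 → v ≠ 0 → 0 < dy (dy L) x y v v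

namespace IsFinslerSq

variable {U : Set Plane} {L : Plane → Plane → ℝ} {x y : Plane}

theorem isOpen_phase (h : IsFinslerSq U L) : IsOpen (U ×ˢ ({0}ᶜ : Set Plane)) :=
  h.isOpen.prod isOpen_compl_singleton

theorem mem_phase (hx : x ∈ U) (hy : y ≠ 0) : (x, y) ∈ U ×ˢ ({0}ᶜ : Set Plane) := ⟨hx, hy⟩

theorem contDiffOn_hess (h : IsFinslerSq U L) :
    ContDiffOn ℝ ∞ (uncurry (dy (dy L))) (U ×ˢ {0}ᶜ) :=
  contDiffOn_dy h.isOpen_phase (contDiffOn_dy h.isOpen_phase h.contDiffOn)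

theorem contDiffOn_tensor (h : IsFinslerSq U L) :
    ContDiffOn ℝ ∞ (uncurry (tensorOf L)) (U ×ˢ {0}ᶜ) :=
  h.contDiffOn_hess.const_smul (1 / 2 : ℝ)

theorem contDiffOn_sprayCovector (h : IsFinslerSq U L) :
    ContDiffOn ℝ ∞ (uncurry (sprayCovectorOf L)) (U ×ˢ {0}ᶜ) :=
  ((contDiffOn_dx h.isOpen_phase (contDiffOn_dy h.isOpen_phase h.contDiffOn)).clm_apply
    contDiffOn_snd).sub (contDiffOn_dx h.isOpen_phase h.contDiffOn)

/-- The fundamental tensor as an isomorphism onto the dual space. -/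
theorem tensor_isInvertible (h : IsFinslerSq U L) (hx : x ∈ U) (hy : y ≠ 0) :
    (tensorOf L x y).IsInvertible := by
  have hinj : Injective (tensorOf L x y) := by
    rw [injective_iff_map_eq_zero]
    intro v hv
    by_contra hne
    have h1 := h.convex x hx y v hy hne
    have h2 : tensorOf L x y v v = 0 := by rw [hv]; rfl
    simp only [tensorOf, smul_apply, smul_eq_mul] at h2
    linarith
  have hfr : Module.finrank ℝ Plane = Module.finrank ℝ (Plane →L[ℝ] ℝ) := by
    rw [← LinearEquiv.finrank_eq (LinearMap.toContinuousLinearMap (𝕜 := ℝ) (E := Plane) (F' := ℝ))]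
    exact (Subspace.dual_finrank_eq (K := ℝ) (V := Plane)).symm
  let e : Plane ≃ₗ[ℝ] (Plane →L[ℝ] ℝ) :=
    LinearEquiv.ofInjectiveOfFinrankEq (tensorOf L x y).toLinearMap hinj hfr
  refine ⟨e.toContinuousLinearEquiv, ?_⟩
  ext v w
  rfl

theorem contDiffOn_spray (h : IsFinslerSq U L) :
    ContDiffOn ℝ ∞ (uncurry (sprayOf L)) (U ×ˢ {0}ᶜ) := by
  have h1 : ContDiffOn ℝ ∞ (fun z : Plane × Plane => (tensorOf L z.1 z.2).inverse) (U ×ˢ {0}ᶜ) := by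
    intro z hz
    obtain ⟨e, he⟩ := h.tensor_isInvertible (x := z.1) (y := z.2) hz.1 hz.2
    have h2 : ContDiffAt ℝ ∞ (ContinuousLinearMap.inverse :
        (Plane →L[ℝ] Plane →L[ℝ] ℝ) → _) (tensorOf L z.1 z.2) := by
      rw [← he]
      exact contDiffAt_map_inverse e
    exact h2.comp_contDiffWithinAt z (h.contDiffOn_tensor z hz)
  exact (h1.clm_apply h.contDiffOn_sprayCovector).const_smul (1 / 4 : ℝ)

theorem contDiffOn_connection (h : IsFinslerSq U L) :
    ContDiffOn ℝ ∞ (uncurry (dy (sprayOf L))) (U ×ˢ {0}ᶜ) :=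
  contDiffOn_dy h.isOpen_phase h.contDiffOn_spray

/-- The equation defining the spray. -/
theorem hess_spray (h : IsFinslerSq U L) (hx : x ∈ U) (hy : y ≠ 0) (w : Plane) :
    2 * dy (dy L) x y (sprayOf L x y) w = dx (dy L) x y y w - dx L x y w := by
  obtain ⟨e, he⟩ := h.tensor_isInvertible hx hy
  have h1 : tensorOf L x y ((tensorOf L x y).inverse (sprayCovectorOf L x y))
      = sprayCovectorOf L x y := by
    rw [← he, ContinuousLinearMap.inverse_equiv]
    exact e.apply_symm_apply _
  have h2 := congrArg (fun T : Plane →L[ℝ] ℝ => T w) h1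
  simp only [tensorOf, smul_apply, sub_apply,
    smul_eq_mul] at h2
  simp only [sprayOf, map_smul, smul_apply, smul_eq_mul]
  linarith

theorem hess_symm (h : IsFinslerSq U L) (hx : x ∈ U) (hy : y ≠ 0) (v w : Plane) :
    dy (dy L) x y v w = dy (dy L) x y w v :=
  dy_dy_comm h.isOpen_phase h.contDiffOn (mem_phase hx hy) v w

theorem smul_mem {r : ℝ} (hr : 0 < r) (hy : y ≠ 0) : r • y ≠ 0 := smul_ne_zero hr.ne' hy

theorem dy_smul (h : IsFinslerSq U L) (hx : x ∈ U) (hy : y ≠ 0) {r : ℝ} (hr : 0 < r) :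
    dy L x (r • y) = r ^ 1 • dy L x y := by
  have h1 := fderiv_smul_of_homogeneous (k := 2) hr
    (differentiableAt_snd h.isOpen_phase h.contDiffOn (mem_phase hx (smul_mem hr hy)))
    (Filter.Eventually.of_forall fun z => by rw [h.smul x hx z r hr, smul_eq_mul])
  have : r • dy L x (r • y) = r • (r ^ 1 • dy L x y) := by
    rw [smul_smul, ← pow_succ']
    exact h1
  exact smul_right_injective _ hr.ne' this

theorem hess_smul (h : IsFinslerSq U L) (hx : x ∈ U) (hy : y ≠ 0) {r : ℝ} (hr : 0 < r) :
    dy (dy L) x (r • y) = dy (dy L) x y := by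
  have h1 := fderiv_smul_of_homogeneous (k := 1) hr
    (differentiableAt_snd h.isOpen_phase (contDiffOn_dy h.isOpen_phase h.contDiffOn)
      (mem_phase hx (smul_mem hr hy)))
    (by
      filter_upwards [isOpen_compl_singleton.mem_nhds (show y ∈ ({0}ᶜ : Set Plane) from hy)] with z hz
      exact h.dy_smul hx hz hr)
  rw [pow_one] at h1
  exact smul_right_injective _ hr.ne' h1

theorem dx_smul (h : IsFinslerSq U L) (hx : x ∈ U) {r : ℝ} (hr : 0 < r) :
    dx L x (r • y) = r ^ 2 • dx L x y := by
  have : (fun x' => L x' (r • y)) =ᶠ[𝓝 x] fun x' => r ^ 2 • L x' y := by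
    filter_upwards [h.isOpen.mem_nhds hx] with x' hx'
    rw [h.smul x' hx' y r hr, smul_eq_mul]
  rw [dx, this.fderiv_eq]
  exact congrFun (fderiv_const_smul_field (𝕜 := ℝ) (f := fun x' => L x' y) (r ^ 2)) x

theorem dx_dy_smul (h : IsFinslerSq U L) (hx : x ∈ U) (hy : y ≠ 0) {r : ℝ} (hr : 0 < r) :
    dx (dy L) x (r • y) = r • dx (dy L) x y := by
  have : (fun x' => dy L x' (r • y)) =ᶠ[𝓝 x] fun x' => r • dy L x' y := by
    filter_upwards [h.isOpen.mem_nhds hx] with x' hx'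
    rw [h.dy_smul hx' hy hr, pow_one]
  rw [dx, this.fderiv_eq]
  exact congrFun (fderiv_const_smul_field (𝕜 := ℝ) (f := fun x' => dy L x' y) r) x

theorem spray_smul (h : IsFinslerSq U L) (hx : x ∈ U) (hy : y ≠ 0) {r : ℝ} (hr : 0 < r) :
    sprayOf L x (r • y) = r ^ 2 • sprayOf L x y := by
  have h1 : sprayCovectorOf L x (r • y) = r ^ 2 • sprayCovectorOf L x y := by
    simp only [sprayCovectorOf]
    rw [h.dx_dy_smul hx hy hr, h.dx_smul hx hr, smul_sub]
    congr 1
    simp only [smul_apply, map_smul, smul_smul]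
    ring_nf
  simp only [sprayOf, tensorOf]
  rw [h.hess_smul hx hy hr, h1, map_smul, smul_comm]

/-- The connection is homogeneous of degree one. -/
theorem connection_smul (h : IsFinslerSq U L) (hx : x ∈ U) (hy : y ≠ 0) {r : ℝ} (hr : 0 < r) :
    dy (sprayOf L) x (r • y) = r ^ 1 • dy (sprayOf L) x y := by
  have h1 := fderiv_smul_of_homogeneous (k := 2) hr
    (differentiableAt_snd h.isOpen_phase h.contDiffOn_spray (mem_phase hx (smul_mem hr hy)))
    (by
      filter_upwards [isOpen_compl_singleton.mem_nhds (show y ∈ ({0}ᶜ : Set Plane) from hy)] with z hz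
      exact h.spray_smul hx hz hr)
  have : r • dy (sprayOf L) x (r • y) = r • (r ^ 1 • dy (sprayOf L) x y) := by
    rw [smul_smul, ← pow_succ']
    exact h1
  exact smul_right_injective _ hr.ne' this

theorem dy_self (h : IsFinslerSq U L) (hx : x ∈ U) (hy : y ≠ 0) : dy L x y y = 2 * L x y := by
  have := fderiv_self_of_homogeneous (k := 2)
    (differentiableAt_snd h.isOpen_phase h.contDiffOn (mem_phase hx hy))
    (fun r hr => by rw [h.smul x hx y r hr, smul_eq_mul])
  simpa using this

theorem hess_self (h : IsFinslerSq U L) (hx : x ∈ U) (hy : y ≠ 0) :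
    dy (dy L) x y y = dy L x y := by
  have := fderiv_self_of_homogeneous (k := 1)
    (differentiableAt_snd h.isOpen_phase (contDiffOn_dy h.isOpen_phase h.contDiffOn)
      (mem_phase hx hy)) (fun r hr => h.dy_smul hx hy hr)
  simpa using this

theorem connection_self (h : IsFinslerSq U L) (hx : x ∈ U) (hy : y ≠ 0) :
    dy (sprayOf L) x y y = (2 : ℝ) • sprayOf L x y := by
  have := fderiv_self_of_homogeneous (k := 2)
    (differentiableAt_snd h.isOpen_phase h.contDiffOn_spray (mem_phase hx hy))
    (fun r hr => h.spray_smul hx hy hr)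
  simpa using this

theorem dy_connection_self (h : IsFinslerSq U L) (hx : x ∈ U) (hy : y ≠ 0) :
    dy (dy (sprayOf L)) x y y = dy (sprayOf L) x y := by
  have := fderiv_self_of_homogeneous (k := 1)
    (differentiableAt_snd h.isOpen_phase h.contDiffOn_connection (mem_phase hx hy))
    (fun r hr => h.connection_smul hx hy hr)
  simpa using this

theorem riemann_eq (h : IsFinslerSq U L) (hx : x ∈ U) (hy : y ≠ 0) (v : Plane) :
    riemannOf (sprayOf L) x y v = (2 : ℝ) • dx (sprayOf L) x y v - dx (dy (sprayOf L)) x y y v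
      + (2 : ℝ) • dy (dy (sprayOf L)) x y (sprayOf L x y) v
      - dy (sprayOf L) x y (dy (sprayOf L) x y v) := by
  have h1 := differentiableAt_fst h.isOpen_phase h.contDiffOn_connection (mem_phase hx hy)
  have h2 := differentiableAt_snd h.isOpen_phase h.contDiffOn_connection (mem_phase hx hy)
  have e1 : fderiv ℝ (fun x' => dy (sprayOf L) x' y v) x y = dx (dy (sprayOf L)) x y y v := by
    rw [(h1.hasFDerivAt.clm_apply (hasFDerivAt_const v x)).fderiv]
    simp
  have e2 : fderiv ℝ (fun y' => dy (sprayOf L) x y' v) y (sprayOf L x y)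
      = dy (dy (sprayOf L)) x y (sprayOf L x y) v := by
    rw [(h2.hasFDerivAt.clm_apply (hasFDerivAt_const v y)).fderiv]
    simp
  simp only [riemannOf]
  rw [e1, e2]

/-- The spray is homogeneous of degree two in `y`, so Euler gives `N y = 2 G` and `dN(y) = N`; the
four terms of the curvature then cancel in pairs. -/
theorem riemann_self (h : IsFinslerSq U L) (hx : x ∈ U) (hy : y ≠ 0) :
    riemannOf (sprayOf L) x y y = 0 := by
  rw [h.riemann_eq hx hy, dy_dy_comm h.isOpen_phase h.contDiffOn_spray (mem_phase hx hy),
    h.dy_connection_self hx hy, h.connection_self hx hy]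
  have h1 : dx (dy (sprayOf L)) x y y y = (2 : ℝ) • dx (sprayOf L) x y y := by
    have h3 := differentiableAt_fst h.isOpen_phase h.contDiffOn_connection (mem_phase hx hy)
    have e1 : fderiv ℝ (fun x' => dy (sprayOf L) x' y y) x y = dx (dy (sprayOf L)) x y y y := by
      rw [(h3.hasFDerivAt.clm_apply (hasFDerivAt_const y x)).fderiv]
      simp
    rw [← e1]
    have : (fun x' => dy (sprayOf L) x' y y) =ᶠ[𝓝 x] fun x' => (2 : ℝ) • sprayOf L x' y := by
      filter_upwards [h.isOpen.mem_nhds hx] with x' hx' using h.connection_self hx' hy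
    rw [this.fderiv_eq]
    exact congrArg (fun T : Plane →L[ℝ] Plane => T y)
      (congrFun (fderiv_const_smul_field (𝕜 := ℝ) (f := fun x' => sprayOf L x' y) (2 : ℝ)) x)
  rw [h1, map_smul]
  abel

/-- The fundamental tensor is compatible with the connection along geodesics. -/
theorem compat (h : IsFinslerSq U L) (hx : x ∈ U) (hy : y ≠ 0) (v w : Plane) :
    dx (dy (dy L)) x y y v w - 2 * dy (dy (dy L)) x y (sprayOf L x y) v w
      = dy (dy L) x y (dy (sprayOf L) x y v) w + dy (dy L) x y v (dy (sprayOf L) x y w) := by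
  have hmem := mem_phase hx hy
  have hW := h.isOpen_phase
  have hL1 := contDiffOn_dy hW h.contDiffOn
  -- This is the fibre derivative of `hess_spray` in the direction `v`. Adding it to the version
  -- with `v` and `w` exchanged cancels the antisymmetric part `dx (dy L) v w - dx (dy L) w v`, and
  -- what remains is the compatibility identity.
  have key : ∀ v w : Plane,
      2 * (dy (dy (dy L)) x y v (sprayOf L x y) w + dy (dy L) x y (dy (sprayOf L) x y v) w)
        = dy (dx (dy L)) x y v y w + dx (dy L) x y v w - dy (dx L) x y v w := by
    intro v w
    have d1 := (differentiableAt_snd hW h.contDiffOn_hess hmem).hasFDerivAt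
    have d2 := (differentiableAt_snd hW h.contDiffOn_spray hmem).hasFDerivAt
    have d3 := (differentiableAt_snd hW (contDiffOn_dx hW hL1) hmem).hasFDerivAt
    have d4 := (differentiableAt_snd hW (contDiffOn_dx hW h.contDiffOn) hmem).hasFDerivAt
    have e1 := ((d1.clm_apply d2).clm_apply (hasFDerivAt_const w y)).const_mul (2 : ℝ)
    have e2 := ((d3.clm_apply (hasFDerivAt_id y)).clm_apply (hasFDerivAt_const w y)).sub
      (d4.clm_apply (hasFDerivAt_const w y))
    have hev : (fun z => 2 * dy (dy L) x z (sprayOf L x z) w)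
        =ᶠ[𝓝 y] fun z => dx (dy L) x z z w - dx L x z w := by
      filter_upwards [isOpen_compl_singleton.mem_nhds (show y ∈ ({0}ᶜ : Set Plane) from hy)] with z hz
      exact h.hess_spray hx hz w
    have e3 := congrArg (fun T : Plane →L[ℝ] ℝ => T v)
      ((e1.congr_of_eventuallyEq hev.symm).unique e2)
    simp at e3
    linarith
  have k1 := key v w
  have k2 := key w v
  have s1 : dy (dx (dy L)) x y v y w = dx (dy (dy L)) x y y v w := by
    rw [dx_dy_comm hW hL1 hmem]
  have s2 : dy (dx (dy L)) x y w y v = dx (dy (dy L)) x y y v w := by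
    rw [← dx_dy_comm hW hL1 hmem]
    have h3 := differentiableAt_fst hW h.contDiffOn_hess hmem
    have e : ∀ a b : Plane, fderiv ℝ (fun x' => dy (dy L) x' y a b) x y
        = dx (dy (dy L)) x y y a b := by
      intro a b
      rw [((h3.hasFDerivAt.clm_apply (hasFDerivAt_const a x)).clm_apply
        (hasFDerivAt_const b x)).fderiv]
      simp
    rw [← e w v, ← e v w]
    refine congrArg (fun T : Plane →L[ℝ] ℝ => T y) (Filter.EventuallyEq.fderiv_eq ?_)
    filter_upwards [h.isOpen.mem_nhds hx] with x' hx' using h.hess_symm hx' hy w v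
  have s3 : dy (dy (dy L)) x y v (sprayOf L x y) w = dy (dy (dy L)) x y (sprayOf L x y) v w := by
    rw [dy_dy_comm hW hL1 hmem]
  have s4 : dy (dy (dy L)) x y w (sprayOf L x y) v = dy (dy (dy L)) x y (sprayOf L x y) v w := by
    rw [dy_dy_comm hW hL1 hmem]
    have h3 := differentiableAt_snd hW h.contDiffOn_hess hmem
    have e : ∀ a b : Plane, fderiv ℝ (fun y' => dy (dy L) x y' a b) y (sprayOf L x y)
        = dy (dy (dy L)) x y (sprayOf L x y) a b := by
      intro a b
      rw [((h3.hasFDerivAt.clm_apply (hasFDerivAt_const a y)).clm_apply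
        (hasFDerivAt_const b y)).fderiv]
      simp
    rw [← e w v, ← e v w]
    refine congrArg (fun T : Plane →L[ℝ] ℝ => T (sprayOf L x y)) (Filter.EventuallyEq.fderiv_eq ?_)
    filter_upwards [isOpen_compl_singleton.mem_nhds (show y ∈ ({0}ᶜ : Set Plane) from hy)] with z hz
    exact h.hess_symm hx hz w v
  have s5 : dy (dx L) x y v w = dx (dy L) x y w v := (dx_dy_comm hW h.contDiffOn hmem w v).symm
  have s6 : dy (dx L) x y w v = dx (dy L) x y v w := (dx_dy_comm hW h.contDiffOn hmem v w).symm
  have s7 := h.hess_symm hx hy v (dy (sprayOf L) x y w)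
  rw [s1, s3, s5] at k1
  rw [s2, s4, s6] at k2
  linarith

/-- If all flag curvatures with flagpole `y` are one, then `R_y v = L v - g(y, v) y`. -/
theorem riemann_of_flagCurvature_eq_one (h : IsFinslerSq U L) (hx : x ∈ U) (hy : y ≠ 0)
    (hK : ∀ v : Plane, LinearIndependent ℝ ![y, v] →
      tensorOf L x y (riemannOf (sprayOf L) x y v) v /
        (tensorOf L x y y y * tensorOf L x y v v - tensorOf L x y y v ^ 2) = 1)
    {v : Plane} (hv : dy L x y v = 0) : riemannOf (sprayOf L) x y v = L x y • v := by
  set H := dy (dy L) x y with hH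
  have hsymm : ∀ a b, H a b = H b a := h.hess_symm hx hy
  have hyy : H y y = 2 * L x y := by rw [hH, h.hess_self hx hy, h.dy_self hx hy]
  have hyv : ∀ w, H y w = dy L x y w := fun w => by rw [hH, h.hess_self hx hy]
  let R : Plane →ₗ[ℝ] Plane :=
    { toFun := riemannOf (sprayOf L) x y
      map_add' := fun a b => by
        simp only [h.riemann_eq hx hy, map_add, smul_add]
        abel
      map_smul' := fun c a => by
        simp only [h.riemann_eq hx hy, map_smul, smul_comm _ c, RingHom.id_apply, smul_sub, smul_add] }
  have hRy : R y = 0 := h.riemann_self hx hy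
  -- The curvature hypothesis cleared of denominators; `H` is twice the fundamental tensor, whence
  -- the factor `2`. It extends to `w` parallel to `y` because `R y = 0`, and can therefore be
  -- polarised.
  have hquad : ∀ w, 2 * H (R w) w = H y y * H w w - H y w ^ 2 := by
    intro w
    by_cases hli : LinearIndependent ℝ ![y, w]
    · have h1 := hK w hli
      have h2 := (div_eq_one_iff_eq (fun h0 => by rw [h0, div_zero] at h1; exact zero_ne_one h1)).1 h1
      simp only [tensorOf, smul_apply, smul_eq_mul] at h2
      change 1 / 2 * H (R w) w = 1 / 2 * H y y * (1 / 2 * H w w) - (1 / 2 * H y w) ^ 2 at h2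
      linarith
    · rw [LinearIndependent.pair_iff' hy] at hli
      push Not at hli
      obtain ⟨a, rfl⟩ := hli
      simp only [map_smul, hRy, smul_zero, smul_apply, smul_eq_mul, map_zero,
        zero_apply]
      ring
  have hpolar : ∀ a b, 2 * (H (R a) b + H (R b) a) = 2 * (H y y * H a b - H y a * H y b) := by
    intro a b
    have h1 := hquad (a + b)
    have h2 := hquad a
    have h3 := hquad b
    simp only [map_add, add_apply] at h1
    have h4 := hsymm a b
    rw [← h4] at h1
    nlinarith
  have hRv : H y (R v) = 0 := by
    have := hpolar v y
    rw [hRy, map_zero, zero_apply, hsymm (R v) y, hyv v, hv, hsymm v y, hyv v,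
      hv] at this
    linarith
  have hLpos := h.pos x hx y hy
  change R v = L x y • v
  by_contra hne
  -- Polarisation controls only the symmetric part of `R`, and the dimension does the rest: `d` and
  -- `v` both lie on the line orthogonal to `y`, while `H d v = 0`. So `H d d` would vanish unless
  -- `v = 0`.
  set d := R v - L x y • v with hd
  have hd0 : d ≠ 0 := sub_ne_zero.2 hne
  have hyd : H y d = 0 := by
    rw [hd, map_sub, map_smul, hRv, hyv v, hv]
    simp
  have hli : LinearIndependent ℝ ![y, d] := by
    rw [LinearIndependent.pair_iff' hy]
    intro a ha
    have : a * H y y = 0 := by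
      rw [← smul_eq_mul, ← map_smul, ha, hyd]
    rw [hyy] at this
    have ha0 : a = 0 := by
      rcases mul_eq_zero.1 this with h0 | h0
      · exact h0
      · linarith
    rw [ha0, zero_smul] at ha
    exact hd0 ha.symm
  -- `v` is a multiple of `d`
  obtain ⟨c, hc⟩ : ∃ c : ℝ, v = c • d := by
    have hspan := hli.span_eq_top_of_card_eq_finrank (by simp)
    have hvm : v ∈ Submodule.span ℝ (range ![y, d]) := hspan ▸ Submodule.mem_top
    rw [Matrix.range_cons_cons_empty, Submodule.mem_span_pair] at hvm
    obtain ⟨a, c, hac⟩ := hvm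
    refine ⟨c, ?_⟩
    have h1 : H y v = 0 := by rw [hyv, hv]
    rw [← hac, map_add, map_smul, map_smul, hyd, smul_zero, add_zero, hyy, smul_eq_mul] at h1
    have ha0 : a = 0 := by
      rcases mul_eq_zero.1 h1 with h0 | h0
      · exact h0
      · linarith
    rw [← hac, ha0, zero_smul, zero_add]
  have h1 := hpolar v v
  have h2 : H (R v) v = L x y * H v v := by
    rw [hyv v, hv, hyy] at h1
    linarith
  have h3 : H d v = 0 := by
    rw [hd, map_sub, map_smul, sub_apply, smul_apply, h2,
      smul_eq_mul, sub_self]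
  rw [hc, map_smul, smul_eq_mul] at h3
  rcases mul_eq_zero.1 h3 with h0 | h0
  · apply hne
    rw [hc, h0, zero_smul, map_zero, smul_zero]
  · exact (h.convex x hx y d hy hd0).ne' h0

end IsFinslerSq

end Lagrangian

end Finsler

end

noncomputable section

namespace Finsler

/-! ### Variations of curves in the plane -/

namespace IsFinslerSq

variable {U : Set Plane} {L : Plane → Plane → ℝ}

section Curve

variable {x y V W : ℝ → Plane} {t : ℝ}

/-- The first variation of the energy. -/
theorem hasDerivAt_dy (h : IsFinslerSq U L) {a w : Plane} (hx : x t ∈ U) (hy : y t ≠ 0)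
    (hdx : HasDerivAt x (y t) t) (hdy : HasDerivAt y a t) (hdV : HasDerivAt V w t) :
    HasDerivAt (fun t => dy L (x t) (y t) (V t))
      (dx L (x t) (y t) (V t) + dy L (x t) (y t) w
        + dy (dy L) (x t) (y t) (a + (2 : ℝ) • sprayOf L (x t) (y t)) (V t)) t := by
  have h1 := hasDerivAt_comp₂ (differentiableAt_uncurry h.isOpen_phase
    (contDiffOn_dy h.isOpen_phase h.contDiffOn) (mem_phase hx hy)) hdx hdy
  convert! h1.clm_apply hdV using 1
  have h2 := h.hess_spray hx hy (V t)
  simp only [map_add, map_smul, add_apply, smul_apply, smul_eq_mul]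
  linarith

theorem hasDerivAt_sq (h : IsFinslerSq U L) {v w : Plane} (hx : x t ∈ U) (hy : y t ≠ 0)
    (hdx : HasDerivAt x v t) (hdy : HasDerivAt y w t) :
    HasDerivAt (fun t => L (x t) (y t)) (dx L (x t) (y t) v + dy L (x t) (y t) w) t :=
  hasDerivAt_comp₂ (differentiableAt_uncurry h.isOpen_phase h.contDiffOn (mem_phase hx hy)) hdx hdy

/-- The energy is constant along geodesics. -/
theorem hasDerivAt_sq_geodesic (h : IsFinslerSq U L) (hx : x t ∈ U) (hy : y t ≠ 0)
    (hdx : ∀ᶠ s in 𝓝 t, HasDerivAt x (y s) s)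
    (hdy : HasDerivAt y (-((2 : ℝ) • sprayOf L (x t) (y t))) t) :
    HasDerivAt (fun t => L (x t) (y t)) 0 t := by
  have h1 := h.hasDerivAt_dy hx hy hdx.self_of_nhds hdy hdy
  have h2 := h.hasDerivAt_sq hx hy hdx.self_of_nhds hdy
  rw [neg_add_cancel, map_zero, zero_apply, add_zero] at h1
  have hxc : ∀ᶠ s in 𝓝 t, x s ∈ U := hdx.self_of_nhds.continuousAt.eventually (h.isOpen.mem_nhds hx)
  have hyc : ∀ᶠ s in 𝓝 t, y s ≠ 0 := hdy.continuousAt.eventually_ne hy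
  have h3 : (fun t => dy L (x t) (y t) (y t)) =ᶠ[𝓝 t] fun t => 2 * L (x t) (y t) := by
    filter_upwards [hxc, hyc] with s hs1 hs2 using h.dy_self hs1 hs2
  -- By Euler, `dy L x y y` equals `2 * L x y`; by the first variation along a geodesic its
  -- derivative equals that of `L`. Thus `2 L' = L'`.
  have h4 := (h1.congr_of_eventuallyEq h3.symm).unique (h2.const_mul 2)
  convert! h2 using 1
  linarith

/-- The product rule for the covariant derivative `V' + N V` along a geodesic; the terms left over
by ordinary differentiation are those of `compat`. -/
theorem hasDerivAt_hess (h : IsFinslerSq U L) {a b : Plane} (hx : x t ∈ U) (hy : y t ≠ 0)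
    (hdx : HasDerivAt x (y t) t) (hdy : HasDerivAt y (-((2 : ℝ) • sprayOf L (x t) (y t))) t)
    (hdV : HasDerivAt V a t) (hdW : HasDerivAt W b t) :
    HasDerivAt (fun t => dy (dy L) (x t) (y t) (V t) (W t))
      (dy (dy L) (x t) (y t) (a + dy (sprayOf L) (x t) (y t) (V t)) (W t)
        + dy (dy L) (x t) (y t) (V t) (b + dy (sprayOf L) (x t) (y t) (W t))) t := by
  have h1 := hasDerivAt_comp₂ (differentiableAt_uncurry h.isOpen_phase
    h.contDiffOn_hess (mem_phase hx hy)) hdx hdy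
  convert! (h1.clm_apply hdV).clm_apply hdW using 1
  have h2 := h.compat hx hy (V t) (W t)
  simp only [map_add, map_neg, map_smul, add_apply, neg_apply, smul_apply, smul_eq_mul]
  linarith

/-- The second covariant derivative of a solution of the linearised geodesic equation. -/
theorem hasDerivAt_covariant (h : IsFinslerSq U L) (hx : x t ∈ U) (hy : y t ≠ 0)
    (hdx : HasDerivAt x (y t) t) (hdy : HasDerivAt y (-((2 : ℝ) • sprayOf L (x t) (y t))) t)
    (hdV : HasDerivAt V (W t) t)
    (hdW : HasDerivAt W (-((2 : ℝ) • (dx (sprayOf L) (x t) (y t) (V t)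
      + dy (sprayOf L) (x t) (y t) (W t)))) t) :
    HasDerivAt (fun t => W t + dy (sprayOf L) (x t) (y t) (V t))
      (-riemannOf (sprayOf L) (x t) (y t) (V t)
        - dy (sprayOf L) (x t) (y t) (W t + dy (sprayOf L) (x t) (y t) (V t))) t := by
  have h1 := hasDerivAt_comp₂ (differentiableAt_uncurry h.isOpen_phase
    h.contDiffOn_connection (mem_phase hx hy)) hdx hdy
  convert! hdW.add (h1.clm_apply hdV) using 1
  rw [h.riemann_eq hx hy]
  simp only [map_add, map_neg, map_smul, add_apply, neg_apply, smul_apply, smul_add]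
  module

/-- The Jacobi equation for a normal field in curvature one, in terms of its squared length. -/
theorem jacobi (h : IsFinslerSq U L)
    (hK : ∀ x ∈ U, ∀ y v : Plane, LinearIndependent ℝ ![y, v] →
      tensorOf L x y (riemannOf (sprayOf L) x y v) v /
        (tensorOf L x y y y * tensorOf L x y v v - tensorOf L x y y v ^ 2) = 1)
    (hev : ∀ᶠ t in 𝓝 t, x t ∈ U ∧ y t ≠ 0 ∧ HasDerivAt x (y t) t ∧
      HasDerivAt y (-((2 : ℝ) • sprayOf L (x t) (y t))) t ∧ HasDerivAt V (W t) t ∧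
      HasDerivAt W (-((2 : ℝ) • (dx (sprayOf L) (x t) (y t) (V t)
        + dy (sprayOf L) (x t) (y t) (W t)))) t ∧
      L (x t) (y t) = 1 ∧ dy L (x t) (y t) (V t) = 0) :
    ∃ q₁ q₂ : ℝ → ℝ, (∀ᶠ t in 𝓝 t,
      HasDerivAt (fun t => dy (dy L) (x t) (y t) (V t) (V t)) (q₁ t) t ∧ HasDerivAt q₁ (q₂ t) t ∧
      HasDerivAt q₂ (-4 * q₁ t) t) ∧
      (V t = 0 → q₁ t = 0 ∧ q₂ t = 2 * dy (dy L) (x t) (y t) (W t) (W t)) := by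
  set H := fun t => dy (dy L) (x t) (y t)
  set D := fun t => W t + dy (sprayOf L) (x t) (y t) (V t)
  -- With `D` the covariant derivative of `V`, curvature one makes the covariant derivative of `D`
  -- equal to `-V`. Following the scalar `H(V, V)` instead of `V` itself removes the need for a
  -- parallel frame, at the price of a third order equation.
  refine ⟨fun t => 2 * H t (V t) (D t), fun t => 2 * H t (D t) (D t) - 2 * H t (V t) (V t), ?_, ?_⟩
  · filter_upwards [hev] with t ⟨hx, hy, hdx, hdy, hdV, hdW, hL, hg⟩
    have hR : riemannOf (sprayOf L) (x t) (y t) (V t) = V t := by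
      have := h.riemann_of_flagCurvature_eq_one hx hy (hK _ hx _) hg
      rwa [hL, one_smul] at this
    have hD : HasDerivAt D (-V t - dy (sprayOf L) (x t) (y t) (D t)) t := by
      have := h.hasDerivAt_covariant hx hy hdx hdy hdV hdW
      rwa [hR] at this
    have hs : ∀ a b, H t a b = H t b a := h.hess_symm hx hy
    have e1 := h.hasDerivAt_hess hx hy hdx hdy hdV hdV
    have e2 := h.hasDerivAt_hess hx hy hdx hdy hdV hD
    have e3 := h.hasDerivAt_hess hx hy hdx hdy hD hD
    change HasDerivAt (fun t => H t (V t) (V t)) (H t (D t) (V t) + H t (V t) (D t)) t at e1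
    rw [sub_add_cancel] at e2 e3
    change HasDerivAt (fun t => H t (V t) (D t)) (H t (D t) (D t) + H t (V t) (-V t)) t at e2
    change HasDerivAt (fun t => H t (D t) (D t)) (H t (-V t) (D t) + H t (D t) (-V t)) t at e3
    refine ⟨?_, ?_, ?_⟩
    · convert! e1 using 1
      rw [hs (D t) (V t)]
      ring
    · convert! e2.const_mul 2 using 1
      rw [map_neg]
      ring
    · convert! (e3.const_mul 2).sub (e1.const_mul 2) using 1
      rw [hs (D t) (V t), hs (D t) (-V t), map_neg, neg_apply]
      ring
  · intro hV
    simp [H, D, hV]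

end Curve

/-! ### The geodesic vector field -/

/-- The geodesic vector field on the phase space. -/
def field (L : Plane → Plane → ℝ) (z : Plane × Plane) : Plane × Plane :=
  (z.2, -((2 : ℝ) • sprayOf L z.1 z.2))

theorem contDiffOn_field (h : IsFinslerSq U L) : ContDiffOn ℝ ∞ (field L) (U ×ˢ {0}ᶜ) :=
  contDiffOn_snd.prodMk (h.contDiffOn_spray.const_smul (2 : ℝ)).neg

theorem sq_zero (h : IsFinslerSq U L) {x : Plane} (hx : x ∈ U) : L x 0 = 0 := by
  have := h.smul x hx 0 2 two_pos
  rw [smul_zero] at this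
  linarith

theorem spray_zero (h : IsFinslerSq U L) {x : Plane} (hx : x ∈ U) : sprayOf L x 0 = 0 := by
  have h1 : dx L x 0 = 0 := by
    have : (fun x' => L x' 0) =ᶠ[𝓝 x] fun _ => 0 := by
      filter_upwards [h.isOpen.mem_nhds hx] with x' hx' using h.sq_zero hx'
    rw [dx, this.fderiv_eq]
    simp
  simp [sprayOf, sprayCovectorOf, h1]

/-- Local bound for a function that is homogeneous in the second variable. -/
theorem exists_norm_le_of_homogeneous (hU : IsOpen U) {V : Type*} [NormedAddCommGroup V]
    [NormedSpace ℝ V]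
    {T : Plane → Plane → V} (hT : ContinuousOn (uncurry T) (U ×ˢ {0}ᶜ)) {k : ℕ}
    (hh : ∀ x ∈ U, ∀ y : Plane, y ≠ 0 → ∀ r : ℝ, 0 < r → T x (r • y) = r ^ k • T x y)
    {x₀ : Plane} (hx₀ : x₀ ∈ U) :
    ∃ C : ℝ, 0 < C ∧ ∀ᶠ x in 𝓝 x₀, ∀ y, y ≠ 0 → ‖T x y‖ ≤ C * ‖y‖ ^ k := by
  obtain ⟨ρ, hρ, hρU⟩ := Metric.nhds_basis_closedBall.mem_iff.1 (hU.mem_nhds hx₀)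
  have hc : IsCompact (Metric.closedBall x₀ ρ ×ˢ Metric.sphere (0 : Plane) 1) :=
    (isCompact_closedBall _ _).prod (isCompact_sphere _ _)
  have hsub : Metric.closedBall x₀ ρ ×ˢ Metric.sphere (0 : Plane) 1 ⊆ U ×ˢ {0}ᶜ := by
    rintro ⟨x, y⟩ ⟨hx, hy⟩
    refine ⟨hρU hx, fun h0 => ?_⟩
    simp only [mem_singleton_iff] at h0
    simp [h0] at hy
  obtain ⟨C, hC⟩ := hc.exists_bound_of_continuousOn (hT.mono hsub)
  refine ⟨max C 1, by positivity, ?_⟩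
  filter_upwards [Metric.closedBall_mem_nhds x₀ hρ] with x hx y hy
  have hn : 0 < ‖y‖ := norm_pos_iff.2 hy
  have h1 : T x y = ‖y‖ ^ k • T x (‖y‖⁻¹ • y) := by
    rw [← hh x (hρU hx) _ (smul_ne_zero (inv_ne_zero hn.ne') hy) _ hn, smul_smul,
      mul_inv_cancel₀ hn.ne', one_smul]
  have h2 : ‖T x (‖y‖⁻¹ • y)‖ ≤ C := hC (x, ‖y‖⁻¹ • y) ⟨hx, by
    simp [norm_smul, inv_mul_cancel₀ hn.ne']⟩
  rw [h1, norm_smul, norm_pow, norm_norm, mul_comm]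
  gcongr
  exact h2.trans (le_max_left _ _)

/-- Homogeneity of degree two bounds `G` by `C|y|²`, its `x`-derivative by `C|y|²` and its
`y`-derivative by `C|y|`, locally uniformly in `x`. So `G` extends across the zero section with zero
derivative there. This is what makes `exp_p` differentiable at the origin. -/
theorem contDiffOn_one_spray (h : IsFinslerSq U L) :
    ContDiffOn ℝ 1 (uncurry (sprayOf L)) (U ×ˢ univ) := by
  have hW := h.isOpen_phase
  have hS := h.contDiffOn_spray
  rintro ⟨x₀, y₀⟩ ⟨hx₀, -⟩
  refine ContDiffAt.contDiffWithinAt ?_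
  by_cases hy₀ : y₀ = 0
  swap
  · exact (hS.contDiffAt (hW.mem_nhds (mem_phase hx₀ hy₀))).of_le (by norm_cast)
  subst hy₀
  have hdx : ∀ x ∈ U, ∀ y : Plane, y ≠ 0 → ∀ r : ℝ, 0 < r →
      dx (sprayOf L) x (r • y) = r ^ 2 • dx (sprayOf L) x y := by
    intro x hx y hy r hr
    have : (fun x' => sprayOf L x' (r • y)) =ᶠ[𝓝 x] fun x' => r ^ 2 • sprayOf L x' y := by
      filter_upwards [h.isOpen.mem_nhds hx] with x' hx' using h.spray_smul hx' hy hr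
    rw [dx, this.fderiv_eq]
    exact congrFun (fderiv_const_smul_field (𝕜 := ℝ) (f := fun x' => sprayOf L x' y) (r ^ 2)) x
  obtain ⟨C₀, hC₀, hb₀⟩ := exists_norm_le_of_homogeneous h.isOpen hS.continuousOn
    (fun x hx y hy r hr => h.spray_smul hx hy hr) hx₀
  obtain ⟨C₁, hC₁, hb₁⟩ := exists_norm_le_of_homogeneous h.isOpen
    (contDiffOn_dx hW hS).continuousOn hdx hx₀
  obtain ⟨C₂, hC₂, hb₂⟩ := exists_norm_le_of_homogeneous h.isOpen
    (contDiffOn_dy hW hS).continuousOn (fun x hx y hy r hr => h.connection_smul hx hy hr) hx₀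
  have hev : ∀ᶠ x in 𝓝 x₀, x ∈ U ∧ (∀ y, y ≠ 0 → ‖sprayOf L x y‖ ≤ C₀ * ‖y‖ ^ 2) ∧
      (∀ y, y ≠ 0 → ‖dx (sprayOf L) x y‖ ≤ C₁ * ‖y‖ ^ 2) ∧
      (∀ y, y ≠ 0 → ‖dy (sprayOf L) x y‖ ≤ C₂ * ‖y‖ ^ 1) := by
    filter_upwards [h.isOpen.mem_nhds hx₀, hb₀, hb₁, hb₂] with x a b c d using ⟨a, b, c, d⟩
  obtain ⟨N, hN, hNo, hxN⟩ := eventually_nhds_iff.1 hev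
  have hNU : N ×ˢ ({0}ᶜ : Set Plane) ⊆ U ×ˢ {0}ᶜ := prod_mono (fun x hx => (hN x hx).1) le_rfl
  classical
  let D : Plane × Plane → (Plane × Plane →L[ℝ] Plane) := fun z =>
    if z.2 = 0 then 0 else fderiv ℝ (uncurry (sprayOf L)) z
  have hDle : ∀ z : Plane × Plane, z.1 ∈ N → ‖D z‖ ≤ C₁ * ‖z.2‖ ^ 2 + C₂ * ‖z.2‖ := by
    rintro ⟨x, y⟩ hz
    by_cases hy : y = 0
    · simp [D, hy]
    simp only [D, hy, if_false]
    refine ContinuousLinearMap.opNorm_le_bound _ (by positivity) fun w => ?_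
    have hd := differentiableAt_uncurry hW hS (mem_phase (hN x hz).1 hy)
    have : fderiv ℝ (uncurry (sprayOf L)) (x, y) w
        = dx (sprayOf L) x y w.1 + dy (sprayOf L) x y w.2 := by
      rw [dx_eq hd, dy_eq hd]
      simp [← map_add]
    rw [this]
    have h1 := (dx (sprayOf L) x y).le_of_opNorm_le ((hN x hz).2.2.1 y hy) w.1
    have h2 := (dy (sprayOf L) x y).le_of_opNorm_le ((hN x hz).2.2.2 y hy) w.2
    calc _ ≤ _ := norm_add_le_of_le h1 h2
      _ ≤ C₁ * ‖y‖ ^ 2 * ‖w‖ + C₂ * ‖y‖ ^ 1 * ‖w‖ := by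
        gcongr
        · exact norm_fst_le w
        · exact norm_snd_le w
      _ = _ := by ring
  have hzero : ∀ z : Plane × Plane, z.1 ∈ N → z.2 = 0 →
      HasFDerivAt (uncurry (sprayOf L)) (0 : Plane × Plane →L[ℝ] Plane) z := by
    rintro ⟨x, y⟩ hx hy
    simp only at hx hy
    subst hy
    rw [hasFDerivAt_iff_isLittleO, Asymptotics.isLittleO_iff]
    intro c hc
    filter_upwards [(hNo.prod isOpen_univ).mem_nhds (mk_mem_prod hx (mem_univ (0 : Plane))),
      Metric.ball_mem_nhds (x, (0 : Plane)) (show 0 < c / C₀ by positivity)] with w hw hwb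
    simp only [uncurry, h.spray_zero (hN x hx).1, sub_zero, zero_apply]
    by_cases hw0 : w.2 = 0
    · rw [hw0, h.spray_zero (hN _ hw.1).1]
      simp only [norm_zero]
      positivity
    have h1 : ‖w.2‖ ≤ ‖w - (x, 0)‖ := by simpa using norm_snd_le (w - (x, (0 : Plane)))
    have h2 : ‖w - (x, 0)‖ < c / C₀ := by simpa [dist_eq_norm] using hwb
    rw [lt_div_iff₀ hC₀] at h2
    calc _ ≤ C₀ * ‖w.2‖ ^ 2 := (hN _ hw.1).2.1 _ hw0
      _ ≤ C₀ * ‖w - (x, 0)‖ ^ 2 := by gcongr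
      _ ≤ _ := by nlinarith [norm_nonneg (w - (x, (0 : Plane)))]
  refine contDiffAt_one_iff.2 ⟨D, N ×ˢ univ, (hNo.prod isOpen_univ).mem_nhds ⟨hxN, mem_univ _⟩, ?_, ?_⟩
  · rintro ⟨x, y⟩ ⟨hx, -⟩
    refine ContinuousAt.continuousWithinAt ?_
    by_cases hy : y = 0
    · subst hy
      have : D (x, 0) = 0 := by simp [D]
      rw [ContinuousAt, this]
      refine squeeze_zero_norm' (a := fun z : Plane × Plane => C₁ * ‖z.2‖ ^ 2 + C₂ * ‖z.2‖) ?_ ?_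
      · filter_upwards [(hNo.prod isOpen_univ).mem_nhds (mk_mem_prod hx (mem_univ (0 : Plane)))]
          with z hz using hDle z hz.1
      · have : Continuous fun z : Plane × Plane => C₁ * ‖z.2‖ ^ 2 + C₂ * ‖z.2‖ := by fun_prop
        simpa using this.tendsto (x, 0)
    · have hz := hW.mem_nhds (mem_phase (hN x hx).1 hy)
      have h1 : ContinuousAt (fderiv ℝ (uncurry (sprayOf L))) (x, y) :=
        ((hS.contDiffAt hz).fderiv_right (m := 0) (by norm_cast)).continuousAt
      refine h1.congr ?_
      filter_upwards [hz] with w hw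
      have : w.2 ≠ 0 := hw.2
      simp [D, this]
  · rintro ⟨x, y⟩ ⟨hx, -⟩
    by_cases hy : y = 0
    · have : D (x, y) = 0 := by simp [D, hy]
      rw [this]
      exact hzero _ hx hy
    · have : D (x, y) = fderiv ℝ (uncurry (sprayOf L)) (x, y) := by simp [D, hy]
      rw [this]
      exact (differentiableAt_uncurry hW hS (mem_phase (hN x hx).1 hy)).hasFDerivAt

theorem contDiffOn_one_field (h : IsFinslerSq U L) : ContDiffOn ℝ 1 (field L) (U ×ˢ univ) :=
  contDiffOn_snd.prodMk (h.contDiffOn_one_spray.const_smul (2 : ℝ)).neg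

end IsFinslerSq

end Finsler

end

/-! ### Charts of the tangent bundle, and `F²` read in a chart. -/

noncomputable section
namespace Finsler
variable {M : Type*} [TopologicalSpace M] [ChartedSpace Plane M] [IsManifold (𝓡 2) ∞ M]

/-- The chart of the tangent bundle induced by the chart at `c`. -/
abbrev tchart (c : M) : PartialEquiv (TangentBundle (𝓡 2) M) (Plane × Plane) :=
  extChartAt (𝓡 2).tangent (⟨c, 0⟩ : TangentBundle (𝓡 2) M)

theorem tchart_source (c : M) :
    (tchart c).source = {u : TangentBundle (𝓡 2) M | u.1 ∈ (extChartAt (𝓡 2) c).source} := by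
  ext u
  rw [extChartAt_source, mem_ofPred_eq, extChartAt_source]
  exact TangentBundle.mem_chart_source_iff ..

theorem tchart_target (c : M) :
    (tchart c).target = (extChartAt (𝓡 2) c).target ×ˢ univ := by
  have h := FiberBundle.extChartAt_target (IB := 𝓡 2) (⟨c, 0⟩ : TangentBundle (𝓡 2) M)
  refine h.trans ?_
  congr 1
  refine inter_eq_left.2 fun x hx => ?_
  have := (extChartAt (𝓡 2) c).map_target hx
  rw [extChartAt_source] at this
  exact this

/-- Links the coordinates used in the definitions to the bundle chart of the tangent bundle, whose
smoothness is known. -/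
theorem chartVector_eq {c : M} {x : Plane} (hx : x ∈ (extChartAt (𝓡 2) c).target) (y : Plane) :
    chartVector c x y = (tchart c).symm (x, y) := by
  have h0 := (extChartAt (𝓡 2) c).map_target hx
  rw [extChartAt_source] at h0
  have h1 := TangentBundle.symmL_trivializationAt (I := 𝓡 2) h0
  rw [(extChartAt (𝓡 2) c).right_inv hx, ModelWithCorners.range_eq_univ, mfderivWithin_univ] at h1
  have h2 : (tchart c).symm (x, y) =
      (trivializationAt Plane (TangentSpace (𝓡 2)) c).toPartialEquiv.symm
        ((extChartAt (𝓡 2) c).symm x, y) := by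
    have := FiberBundle.extChartAt (IB := 𝓡 2) (⟨c, 0⟩ : TangentBundle (𝓡 2) M)
    exact congrArg (fun e : PartialEquiv _ _ => e.symm (x, y)) this
  have h3 := Bundle.Trivialization.mk_symm (trivializationAt Plane (TangentSpace (𝓡 2)) c) h0 y
  refine Eq.trans ?_ (h3.trans h2.symm)
  refine congrArg (fun T : Plane →L[ℝ] TangentSpace (𝓡 2) ((extChartAt (𝓡 2) c).symm x) =>
    (⟨_, T y⟩ : TangentBundle (𝓡 2) M)) h1.symm |>.trans ?_
  rw [Bundle.Trivialization.symmL_apply]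
  exact h0

theorem tchart_fst (c : M) (u : TangentBundle (𝓡 2) M) :
    (tchart c u).1 = extChartAt (𝓡 2) c u.1 := by
  rfl

theorem tchart_chartVector {c : M} {x : Plane} (hx : x ∈ (extChartAt (𝓡 2) c).target) (y : Plane) :
    tchart c (chartVector c x y) = (x, y) := by
  rw [chartVector_eq hx]
  exact (tchart c).right_inv (by rw [tchart_target]; exact ⟨hx, mem_univ _⟩)

theorem chartVector_tchart {c : M} {u : TangentBundle (𝓡 2) M}
    (hu : u.1 ∈ (extChartAt (𝓡 2) c).source) :
    chartVector c (tchart c u).1 (tchart c u).2 = u := by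
  rw [chartVector_eq]
  · exact (tchart c).left_inv (by rw [tchart_source]; exact hu)
  · rw [tchart_fst]
    exact (extChartAt (𝓡 2) c).map_source hu

theorem contMDiffOn_chartVector (c : M) :
    ContMDiffOn 𝓘(ℝ, Plane × Plane) (𝓡 2).tangent ∞ (fun z : Plane × Plane => chartVector c z.1 z.2)
      ((extChartAt (𝓡 2) c).target ×ˢ univ) := by
  have := contMDiffOn_extChartAt_symm (I := (𝓡 2).tangent) (n := ∞) (⟨c, 0⟩ : TangentBundle (𝓡 2) M)
  rw [tchart_target] at this
  exact this.congr fun z hz => chartVector_eq hz.1 z.2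

theorem contMDiffOn_tchart (c : M) :
    ContMDiffOn (𝓡 2).tangent 𝓘(ℝ, Plane × Plane) ∞ (tchart c)
      {u : TangentBundle (𝓡 2) M | u.1 ∈ (extChartAt (𝓡 2) c).source} := by
  have := contMDiffOn_extChartAt (I := (𝓡 2).tangent) (n := ∞) (x := (⟨c, 0⟩ : TangentBundle (𝓡 2) M))
  rw [← extChartAt_source (I := (𝓡 2).tangent), tchart_source] at this
  exact this

theorem isOpen_target (c : M) : IsOpen (extChartAt (𝓡 2) c).target := isOpen_extChartAt_target c

theorem isOpen_tsource (c : M) :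
    IsOpen {u : TangentBundle (𝓡 2) M | u.1 ∈ (extChartAt (𝓡 2) c).source} :=
  (isOpen_extChartAt_source c).preimage (FiberBundle.continuous_proj _ _)

/-- The differential of the inverse chart. -/
abbrev frame (c : M) (x : Plane) : Plane →L[ℝ] TangentSpace (𝓡 2) ((extChartAt (𝓡 2) c).symm x) :=
  mfderiv 𝓘(ℝ, Plane) (𝓡 2) (extChartAt (𝓡 2) c).symm x

theorem frame_injective {c : M} {x : Plane} (hx : x ∈ (extChartAt (𝓡 2) c).target) :
    Injective (frame c x) := by
  intro a b hab
  have h1 : chartVector c x a = chartVector c x b :=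
    congrArg (fun w => (⟨_, w⟩ : TangentBundle (𝓡 2) M)) hab
  have h2 := congrArg (tchart c) h1
  rw [tchart_chartVector hx, tchart_chartVector hx] at h2
  exact (Prod.ext_iff.1 h2).2

theorem frame_eq_zero {c : M} {x : Plane} (hx : x ∈ (extChartAt (𝓡 2) c).target) {y : Plane} :
    frame c x y = 0 ↔ y = 0 :=
  map_eq_zero_iff _ (frame_injective hx)

variable (F : Metric M)

theorem sq_eq (c : M) (x y : Plane) : F.sq c x y = F.norm ⟨_, frame c x y⟩ ^ 2 := rfl

theorem hasDerivAt_two {f : ℝ → ℝ} : iteratedDeriv 2 f = deriv (deriv f) := by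
  rw [iteratedDeriv_succ, iteratedDeriv_one]

/-- Second derivative along a line. -/
theorem iteratedDeriv_two_line {f : Plane → ℝ} {y v : Plane} (hf : ContDiffAt ℝ 2 f y) :
    iteratedDeriv 2 (fun s : ℝ => f (y + s • v)) 0 = fderiv ℝ (fderiv ℝ f) y v v := by
  have hline : ∀ s : ℝ, HasDerivAt (fun s : ℝ => y + s • v) v s := fun s => by
    simpa using ((hasDerivAt_id s).smul_const v).const_add y
  have hev : ∀ᶠ s : ℝ in 𝓝 0, DifferentiableAt ℝ f (y + s • v) := by
    have h1 : ∀ᶠ z in 𝓝 y, ContDiffAt ℝ 2 f z := hf.eventually (by simp)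
    have h2 : Filter.Tendsto (fun s : ℝ => y + s • v) (𝓝 0) (𝓝 y) := by
      simpa using (hline 0).continuousAt.tendsto
    exact (h2.eventually h1).mono fun s hs => hs.differentiableAt (by norm_num)
  rw [hasDerivAt_two]
  have h3 : deriv (fun s : ℝ => f (y + s • v)) =ᶠ[𝓝 0] fun s => fderiv ℝ f (y + s • v) v := by
    filter_upwards [hev] with s hs
    exact (hs.hasFDerivAt.comp_hasDerivAt s (hline s)).deriv
  rw [h3.deriv_eq]
  have h4 : DifferentiableAt ℝ (fderiv ℝ f) y :=
    (hf.fderiv_right (m := 1) (by norm_num)).differentiableAt one_ne_zero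
  have h5 : HasDerivAt (fun s : ℝ => fderiv ℝ f (y + s • v)) (fderiv ℝ (fderiv ℝ f) y v) 0 := by
    refine HasFDerivAt.comp_hasDerivAt (0 : ℝ) ?_ (hline 0)
    simpa using h4.hasFDerivAt
  simpa using (h5.clm_apply (hasDerivAt_const (0 : ℝ) v)).deriv

/-- The bridge from the manifold to the plane: all the spray calculus above becomes available in
each chart. Injectivity of `frame` carries positivity and strong convexity over. -/
theorem isFinslerSq (c : M) : IsFinslerSq (extChartAt (𝓡 2) c).target (F.sq c) := by
  have hsm : ContDiffOn ℝ ∞ (uncurry (F.sq c)) ((extChartAt (𝓡 2) c).target ×ˢ {0}ᶜ) := by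
    rw [← contMDiffOn_iff_contDiffOn]
    have h1 : ContMDiffOn 𝓘(ℝ, Plane × Plane) 𝓘(ℝ, ℝ) ∞
        (fun z : Plane × Plane => F.norm (chartVector c z.1 z.2))
        ((extChartAt (𝓡 2) c).target ×ˢ {0}ᶜ) := by
      refine F.contMDiffOn_norm.comp ((contMDiffOn_chartVector c).mono
        (prod_mono le_rfl (subset_univ _))) ?_
      rintro ⟨x, y⟩ ⟨hx, hy⟩
      exact fun h0 => hy ((frame_eq_zero hx).1 h0)
    have h2 := h1.contDiffOn
    exact (h2.pow 2).contMDiffOn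
  have hpos : ∀ x ∈ (extChartAt (𝓡 2) c).target, ∀ y : Plane, y ≠ 0 → 0 < F.sq c x y := by
    intro x hx y hy
    exact pow_pos (F.norm_pos _ _ fun h0 => hy ((frame_eq_zero hx).1 h0)) 2
  refine ⟨isOpen_target c, hsm, ?_, hpos, ?_⟩
  · intro x hx y r hr
    rw [sq_eq, sq_eq, map_smul, F.norm_smul _ _ _ hr.le, mul_pow]
  · intro x hx y v hy hv
    have h1 := F.strongly_convex _ (frame c x y) (frame c x v)
      (fun h0 => hy ((frame_eq_zero hx).1 h0)) (fun h0 => hv ((frame_eq_zero hx).1 h0))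
    have h2 : (fun s : ℝ => F.norm ⟨_, frame c x y + s • frame c x v⟩ ^ 2)
        = fun s : ℝ => F.sq c x (y + s • v) := by
      funext s
      rw [sq_eq, map_add, map_smul]
    rw [h2, iteratedDeriv_two_line (f := F.sq c x)] at h1
    · exact h1
    · have h3 := hsm.contDiffAt ((((isOpen_target c).prod isOpen_compl_singleton)).mem_nhds
        (show (x, y) ∈ _ from ⟨hx, hy⟩))
      exact (h3.comp y (contDiffAt_const.prodMk contDiffAt_id)).of_le (by norm_cast)

/-! ### Curves in a chart -/

theorem lift_eq_chartVector {γ : ℝ → M} {t : ℝ} {c : M} (hγ : MDifferentiableAt 𝓘(ℝ, ℝ) (𝓡 2) γ t)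
    (hc : γ t ∈ (extChartAt (𝓡 2) c).source) :
    lift γ t = chartVector c (extChartAt (𝓡 2) c (γ t))
      (deriv (fun τ => extChartAt (𝓡 2) c (γ τ)) t) := by
  have hx : extChartAt (𝓡 2) c (γ t) ∈ (extChartAt (𝓡 2) c).target :=
    (extChartAt (𝓡 2) c).map_source hc
  have hd : DifferentiableAt ℝ (fun τ => extChartAt (𝓡 2) c (γ τ)) t := by
    rw [← mdifferentiableAt_iff_differentiableAt]
    exact (mdifferentiableAt_extChartAt (by rwa [extChartAt_source] at hc)).comp t hγ
  have h1 : MDifferentiableAt 𝓘(ℝ, Plane) (𝓡 2) (extChartAt (𝓡 2) c).symm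
      (extChartAt (𝓡 2) c (γ t)) :=
    (contMDiffOn_extChartAt_symm (n := ∞) c).contMDiffAt ((isOpen_target c).mem_nhds hx)
      |>.mdifferentiableAt (by norm_num)
  have h2 : γ =ᶠ[𝓝 t] fun τ => (extChartAt (𝓡 2) c).symm (extChartAt (𝓡 2) c (γ τ)) := by
    filter_upwards [hγ.continuousAt.eventually ((isOpen_extChartAt_source c).mem_nhds hc)] with τ hτ
    exact ((extChartAt (𝓡 2) c).left_inv hτ).symm
  have h3 : mfderiv 𝓘(ℝ, ℝ) (𝓡 2) γ t = (frame c (extChartAt (𝓡 2) c (γ t))).comp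
      (fderiv ℝ (fun τ => extChartAt (𝓡 2) c (γ τ)) t) := by
    rw [h2.mfderiv_eq]
    have := mfderiv_comp t h1 hd.mdifferentiableAt
    rw [mfderiv_eq_fderiv] at this
    exact this
  have h4 : γ t = (extChartAt (𝓡 2) c).symm (extChartAt (𝓡 2) c (γ t)) := h2.self_of_nhds
  unfold lift chartVector
  refine Bundle.TotalSpace.ext h4 ?_
  rw [h3]
  exact heq_of_eq rfl

end Finsler

end

noncomputable section

namespace Finsler

variable {M : Type*} [TopologicalSpace M] [ChartedSpace Plane M] [IsManifold (𝓡 2) ∞ M]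

/-! ### Intrinsic derivatives of `F²` along a fibre -/

/-- The derivative of `F²` at `u` in the direction of `w`, a vector with the same base point. -/
def Metric.vertical (F : Metric M) (u w : TangentBundle (𝓡 2) M) : ℝ :=
  deriv (fun r : ℝ => F.norm ⟨u.1, u.2 + r • (show TangentSpace (𝓡 2) u.1 from w.2)⟩ ^ 2) 0

/-- The second derivative of `F²` at `u` in the direction of `w`. -/
def Metric.verticalHess (F : Metric M) (u w : TangentBundle (𝓡 2) M) : ℝ :=
  iteratedDeriv 2
    (fun r : ℝ => F.norm ⟨u.1, u.2 + r • (show TangentSpace (𝓡 2) u.1 from w.2)⟩ ^ 2) 0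

variable (F : Metric M)

theorem line_chartVector (c : M) (x y v : Plane) :
    (fun r : ℝ => F.norm ⟨(chartVector c x y).1, (chartVector c x y).2
      + r • (show TangentSpace (𝓡 2) (chartVector c x y).1 from (chartVector c x v).2)⟩ ^ 2)
      = fun r : ℝ => F.sq c x (y + r • v) := by
  funext r
  rw [sq_eq, map_add, map_smul]
  rfl

theorem contDiffAt_sq {c : M} {x y : Plane} (hx : x ∈ (extChartAt (𝓡 2) c).target) (hy : y ≠ 0) :
    ContDiffAt ℝ ∞ (F.sq c x) y := by
  have h3 := (isFinslerSq F c).contDiffOn.contDiffAt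
    ((isFinslerSq F c).isOpen_phase.mem_nhds (IsFinslerSq.mem_phase hx hy))
  exact h3.comp y (contDiffAt_const.prodMk contDiffAt_id)

theorem vertical_chartVector {c : M} {x y : Plane} (hx : x ∈ (extChartAt (𝓡 2) c).target)
    (hy : y ≠ 0) (v : Plane) :
    F.vertical (chartVector c x y) (chartVector c x v) = dy (F.sq c) x y v := by
  unfold Metric.vertical
  rw [line_chartVector]
  have h1 : HasDerivAt (fun s : ℝ => y + s • v) v 0 := by
    simpa using ((hasDerivAt_id (0 : ℝ)).smul_const v).const_add y
  have h2 := ((contDiffAt_sq F hx hy).differentiableAt (by norm_num)).hasFDerivAt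
  have h3 : HasFDerivAt (F.sq c x) (fderiv ℝ (F.sq c x) y) (y + (0 : ℝ) • v) := by simpa using h2
  exact (h3.comp_hasDerivAt (0 : ℝ) h1).deriv

theorem verticalHess_chartVector {c : M} {x y : Plane} (hx : x ∈ (extChartAt (𝓡 2) c).target)
    (hy : y ≠ 0) (v : Plane) :
    F.verticalHess (chartVector c x y) (chartVector c x v) = dy (dy (F.sq c)) x y v v := by
  unfold Metric.verticalHess
  rw [line_chartVector]
  exact iteratedDeriv_two_line ((contDiffAt_sq F hx hy).of_le (by norm_cast))

/-! ### Two-parameter maps in a chart -/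

section Variation

variable {Φ : ℝ → ℝ → M} {W : Set (ℝ × ℝ)} {c : M}

/-- The domain of a two-parameter map read in the chart at `c`. -/
def chartDomain (Φ : ℝ → ℝ → M) (W : Set (ℝ × ℝ)) (c : M) : Set (ℝ × ℝ) :=
  W ∩ uncurry Φ ⁻¹' (extChartAt (𝓡 2) c).source

/-- A two-parameter map read in the chart at `c`. -/
def chartMap (Φ : ℝ → ℝ → M) (c : M) (s t : ℝ) : Plane := extChartAt (𝓡 2) c (Φ s t)

theorem isOpen_chartDomain (hW : IsOpen W)
    (hΦ : ContMDiffOn 𝓘(ℝ, ℝ × ℝ) (𝓡 2) ∞ (uncurry Φ) W) : IsOpen (chartDomain Φ W c) :=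
  hΦ.continuousOn.isOpen_inter_preimage hW (isOpen_extChartAt_source c)

theorem contDiffOn_chartMap 
    (hΦ : ContMDiffOn 𝓘(ℝ, ℝ × ℝ) (𝓡 2) ∞ (uncurry Φ) W) :
    ContDiffOn ℝ ∞ (uncurry (chartMap Φ c)) (chartDomain Φ W c) := by
  rw [← contMDiffOn_iff_contDiffOn]
  have := contMDiffOn_extChartAt (I := 𝓡 2) (n := ∞) (x := c)
  rw [← extChartAt_source (I := 𝓡 2)] at this
  exact this.comp (hΦ.mono inter_subset_left) fun z hz => hz.2

theorem mem_chartTarget {s t : ℝ} (h : (s, t) ∈ chartDomain Φ W c) :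
    chartMap Φ c s t ∈ (extChartAt (𝓡 2) c).target := (extChartAt (𝓡 2) c).map_source h.2

theorem mdifferentiableAt_slice_snd (hW : IsOpen W)
    (hΦ : ContMDiffOn 𝓘(ℝ, ℝ × ℝ) (𝓡 2) ∞ (uncurry Φ) W) {s t : ℝ} (h : (s, t) ∈ W) :
    MDifferentiableAt 𝓘(ℝ, ℝ) (𝓡 2) (Φ s) t := by
  have h1 : MDifferentiableAt 𝓘(ℝ, ℝ × ℝ) (𝓡 2) (uncurry Φ) (s, t) :=
    (hΦ.contMDiffAt (hW.mem_nhds h)).mdifferentiableAt (by norm_num)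
  have h2 : MDifferentiableAt 𝓘(ℝ, ℝ) 𝓘(ℝ, ℝ × ℝ) (fun τ => (s, τ)) t :=
    ((hasFDerivAt_prodMk_right s t).differentiableAt).mdifferentiableAt
  exact MDifferentiableAt.comp (g := uncurry Φ) t h1 h2

theorem mdifferentiableAt_slice_fst (hW : IsOpen W)
    (hΦ : ContMDiffOn 𝓘(ℝ, ℝ × ℝ) (𝓡 2) ∞ (uncurry Φ) W) {s t : ℝ} (h : (s, t) ∈ W) :
    MDifferentiableAt 𝓘(ℝ, ℝ) (𝓡 2) (fun σ => Φ σ t) s := by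
  have h1 : MDifferentiableAt 𝓘(ℝ, ℝ × ℝ) (𝓡 2) (uncurry Φ) (s, t) :=
    (hΦ.contMDiffAt (hW.mem_nhds h)).mdifferentiableAt (by norm_num)
  have h2 : MDifferentiableAt 𝓘(ℝ, ℝ) 𝓘(ℝ, ℝ × ℝ) (fun σ => (σ, t)) s :=
    ((hasFDerivAt_prodMk_left s t).differentiableAt).mdifferentiableAt
  exact MDifferentiableAt.comp (g := uncurry Φ) s h1 h2

theorem lift_snd_chart (hW : IsOpen W) (hΦ : ContMDiffOn 𝓘(ℝ, ℝ × ℝ) (𝓡 2) ∞ (uncurry Φ) W)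
    {s t : ℝ} (h : (s, t) ∈ chartDomain Φ W c) :
    lift (Φ s) t = chartVector c (chartMap Φ c s t) (dy (chartMap Φ c) s t 1) := by
  rw [lift_eq_chartVector (mdifferentiableAt_slice_snd hW hΦ h.1) h.2]
  rfl

theorem lift_fst_chart (hW : IsOpen W) (hΦ : ContMDiffOn 𝓘(ℝ, ℝ × ℝ) (𝓡 2) ∞ (uncurry Φ) W)
    {s t : ℝ} (h : (s, t) ∈ chartDomain Φ W c) :
    lift (fun σ => Φ σ t) s = chartVector c (chartMap Φ c s t) (dx (chartMap Φ c) s t 1) := by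
  rw [lift_eq_chartVector (mdifferentiableAt_slice_fst hW hΦ h.1) h.2]
  rfl

/-- Derivatives of a smooth two-parameter map. -/
theorem hasDerivAt_chart {X : ℝ → ℝ → Plane} {W : Set (ℝ × ℝ)} (hW : IsOpen W)
    (hX : ContDiffOn ℝ ∞ (uncurry X) W) {s t : ℝ} (h : (s, t) ∈ W) :
    HasDerivAt (fun τ => X s τ) (dy X s t 1) t ∧
    HasDerivAt (fun τ => dy X s τ 1) (dy (dy X) s t 1 1) t ∧
    HasDerivAt (fun τ => dx X s τ 1) (dx (dy X) s t 1 1) t ∧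
    HasDerivAt (fun σ => X σ t) (dx X s t 1) s ∧
    HasDerivAt (fun σ => dy X σ t 1) (dx (dy X) s t 1 1) s := by
  have h1 := contDiffOn_dy hW hX
  have h2 := contDiffOn_dx hW hX
  refine ⟨(differentiableAt_snd hW hX h).hasFDerivAt.hasDerivAt, ?_, ?_,
    (differentiableAt_fst hW hX h).hasFDerivAt.hasDerivAt, ?_⟩
  · have := (differentiableAt_snd hW h1 h).hasFDerivAt.hasDerivAt.clm_apply (hasDerivAt_const t (1 : ℝ))
    simpa using this
  · have := (differentiableAt_snd hW h2 h).hasFDerivAt.hasDerivAt.clm_apply (hasDerivAt_const t (1 : ℝ))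
    rw [dx_dy_comm hW hX h]
    simpa using this
  · have := (differentiableAt_fst hW h1 h).hasFDerivAt.hasDerivAt.clm_apply (hasDerivAt_const s (1 : ℝ))
    simpa using this

/-- The first variation formula. -/
theorem firstVariation (hW : IsOpen W) (hΦ : ContMDiffOn 𝓘(ℝ, ℝ × ℝ) (𝓡 2) ∞ (uncurry Φ) W)
    {s t : ℝ} (h : (s, t) ∈ chartDomain Φ W c) (hne : dy (chartMap Φ c) s t 1 ≠ 0) :
    HasDerivAt (fun τ => F.vertical (lift (Φ s) τ) (lift (fun σ => Φ σ τ) s))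
      (deriv (fun σ => F.norm (lift (Φ σ) t) ^ 2) s
        + dy (dy (F.sq c)) (chartMap Φ c s t) (dy (chartMap Φ c) s t 1)
          (dy (dy (chartMap Φ c)) s t 1 1
            + (2 : ℝ) • sprayOf (F.sq c) (chartMap Φ c s t) (dy (chartMap Φ c) s t 1))
          (dx (chartMap Φ c) s t 1)) t := by
  have hF := isFinslerSq F c
  set X := chartMap Φ c
  have hD : IsOpen (chartDomain Φ W c) := isOpen_chartDomain hW hΦ
  have hX : ContDiffOn ℝ ∞ (uncurry X) (chartDomain Φ W c) := contDiffOn_chartMap hΦ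
  obtain ⟨d1, d2, d3, d4, d5⟩ := hasDerivAt_chart hD hX h
  have hx : X s t ∈ (extChartAt (𝓡 2) c).target := mem_chartTarget h
  have e1 := hF.hasDerivAt_dy hx hne d1 d2 d3
  have e2 := hF.hasDerivAt_sq (x := fun σ => X σ t) (y := fun σ => dy X σ t 1) hx hne d4 d5
  have e3 : deriv (fun σ => F.norm (lift (Φ σ) t) ^ 2) s = dx (F.sq c) (X s t) (dy X s t 1) (dx X s t 1)
      + dy (F.sq c) (X s t) (dy X s t 1) (dx (dy X) s t 1 1) := by
    rw [← e2.deriv]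
    refine Filter.EventuallyEq.deriv_eq ?_
    have : ∀ᶠ σ in 𝓝 s, (σ, t) ∈ chartDomain Φ W c :=
      ((Continuous.prodMk_left t).tendsto s).eventually (hD.mem_nhds h)
    filter_upwards [this] with σ hσ
    rw [lift_snd_chart hW hΦ hσ]
    rfl
  rw [e3]
  refine e1.congr_of_eventuallyEq ?_
  have h1 : ∀ᶠ τ in 𝓝 t, (s, τ) ∈ chartDomain Φ W c :=
    ((Continuous.prodMk_right s).tendsto t).eventually (hD.mem_nhds h)
  have h2 : ∀ᶠ τ in 𝓝 t, dy X s τ 1 ≠ 0 := d2.continuousAt.eventually_ne hne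
  filter_upwards [h1, h2] with τ hτ hτ2
  rw [lift_snd_chart hW hΦ hτ, lift_fst_chart hW hΦ hτ,
    vertical_chartVector F (mem_chartTarget hτ) hτ2]

end Variation

/-! ### The geodesic equation in different charts -/

/-- The geodesic equation at time `t` in the chart at `c`. -/
def Metric.EquationAt (F : Metric M) (γ : ℝ → M) (c : M) (t : ℝ) : Prop :=
  deriv (deriv fun τ => extChartAt (𝓡 2) c (γ τ)) t
      + (2 : ℝ) • F.spray c (extChartAt (𝓡 2) c (γ t))
          (deriv (fun τ => extChartAt (𝓡 2) c (γ τ)) t) = 0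

theorem dy_chartMap {Φ : ℝ → ℝ → M} {c : M} {s t : ℝ} :
    dy (chartMap Φ c) s t 1 = deriv (fun τ => extChartAt (𝓡 2) c (Φ s τ)) t := rfl

theorem dy_dy_chartMap {Φ : ℝ → ℝ → M} {c : M} {s t : ℝ} {W : Set (ℝ × ℝ)} (hW : IsOpen W)
    (hX : ContDiffOn ℝ ∞ (uncurry (chartMap Φ c)) W) (h : (s, t) ∈ W) :
    dy (dy (chartMap Φ c)) s t 1 1 = deriv (deriv fun τ => extChartAt (𝓡 2) c (Φ s τ)) t :=
  ((hasDerivAt_chart hW hX h).2.1.deriv).symm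

theorem deriv_ne_zero_of_lift {γ : ℝ → M} {t : ℝ} {c : M}
    (hγ : MDifferentiableAt 𝓘(ℝ, ℝ) (𝓡 2) γ t) (hc : γ t ∈ (extChartAt (𝓡 2) c).source)
    (hne : (lift γ t).2 ≠ 0) : deriv (fun τ => extChartAt (𝓡 2) c (γ τ)) t ≠ 0 := by
  intro h0
  have h1 := lift_eq_chartVector hγ hc
  rw [h0] at h1
  have h2 : (chartVector c (extChartAt (𝓡 2) c (γ t)) 0).2 = 0 := map_zero (frame c _)
  rw [h1] at hne
  exact hne h2

/-- The geodesic equation does not depend on the chart. -/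
theorem Metric.EquationAt.change {γ : ℝ → M} {S : Set ℝ} (hS : IsOpen S)
    (hγ : ContMDiffOn 𝓘(ℝ, ℝ) (𝓡 2) ∞ γ S) {t : ℝ} (ht : t ∈ S) (hne : (lift γ t).2 ≠ 0)
    {c d : M} (hc : γ t ∈ (extChartAt (𝓡 2) c).source) (hd : γ t ∈ (extChartAt (𝓡 2) d).source)
    (h : F.EquationAt γ c t) : F.EquationAt γ d t := by
  have hγt : MDifferentiableAt 𝓘(ℝ, ℝ) (𝓡 2) γ t :=
    (hγ.contMDiffAt (hS.mem_nhds ht)).mdifferentiableAt (by norm_num)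
  have hFd := isFinslerSq F d
  set z : Plane := deriv (deriv fun τ => extChartAt (𝓡 2) d (γ τ)) t
      + (2 : ℝ) • F.spray d (extChartAt (𝓡 2) d (γ t))
          (deriv (fun τ => extChartAt (𝓡 2) d (γ τ)) t) with hz
  change z = 0
  set xd := fun τ => extChartAt (𝓡 2) d (γ τ) with hxd
  set S' : Set ℝ := S ∩ γ ⁻¹' (extChartAt (𝓡 2) d).source
  have hS' : IsOpen S' := hγ.continuousOn.isOpen_inter_preimage hS (isOpen_extChartAt_source d)
  have hxs : ContDiffOn ℝ ∞ xd S' := by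
    rw [← contMDiffOn_iff_contDiffOn]
    have := contMDiffOn_extChartAt (I := 𝓡 2) (n := ∞) (x := d)
    rw [← extChartAt_source (I := 𝓡 2)] at this
    exact this.comp (hγ.mono inter_subset_left) fun z hz => hz.2
  -- The curve is pushed in the direction `z`, its own geodesic defect in the chart at `d`. In the
  -- first variation formula everything but the Euler–Lagrange term is chart free, and that term
  -- vanishes in the chart at `c`; so `z` has zero square in the chart at `d`, and convexity gives
  -- `z = 0`.
  let Ψ : ℝ → ℝ → Plane := fun s τ => xd τ + s • z
  let Φ : ℝ → ℝ → M := fun s τ => (extChartAt (𝓡 2) d).symm (Ψ s τ)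
  have hΨ : ContDiffOn ℝ ∞ (uncurry Ψ) (univ ×ˢ S') :=
    (hxs.comp contDiffOn_snd fun p hp => hp.2).add (contDiffOn_fst.smul contDiffOn_const)
  set W : Set (ℝ × ℝ) := (univ ×ˢ S') ∩ uncurry Ψ ⁻¹' (extChartAt (𝓡 2) d).target with hWdef
  have hW : IsOpen W := hΨ.continuousOn.isOpen_inter_preimage (isOpen_univ.prod hS') (isOpen_target d)
  have hΦ : ContMDiffOn 𝓘(ℝ, ℝ × ℝ) (𝓡 2) ∞ (uncurry Φ) W :=
    (contMDiffOn_extChartAt_symm (n := ∞) d).comp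
      ((hΨ.mono inter_subset_left).contMDiffOn) fun p hp => hp.2
  have htW : ((0 : ℝ), t) ∈ W := by
    refine ⟨⟨mem_univ _, ht, hd⟩, ?_⟩
    simp only [mem_preimage, uncurry, Ψ, zero_smul, add_zero]
    exact (extChartAt (𝓡 2) d).map_source hd
  have hΦ0 : ∀ τ ∈ S', Φ 0 τ = γ τ := by
    intro τ hτ
    simp only [Φ, Ψ, zero_smul, add_zero]
    exact (extChartAt (𝓡 2) d).left_inv hτ.2
  have hΦ0ev : Φ 0 =ᶠ[𝓝 t] γ := by
    filter_upwards [hS'.mem_nhds ⟨ht, hd⟩] with τ hτ using hΦ0 τ hτ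
  have hΦt : Φ 0 t = γ t := hΦ0ev.self_of_nhds
  have key : ∀ e : M, γ t ∈ (extChartAt (𝓡 2) e).source → 
      ((0 : ℝ), t) ∈ chartDomain Φ W e ∧ chartMap Φ e 0 t = extChartAt (𝓡 2) e (γ t) ∧
      dy (chartMap Φ e) 0 t 1 = deriv (fun τ => extChartAt (𝓡 2) e (γ τ)) t ∧
      dy (dy (chartMap Φ e)) 0 t 1 1 = deriv (deriv fun τ => extChartAt (𝓡 2) e (γ τ)) t := by
    intro e he
    have hmem : ((0 : ℝ), t) ∈ chartDomain Φ W e := ⟨htW, by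
      simp only [mem_preimage, uncurry]
      rwa [hΦt]⟩
    have hev : (fun τ => extChartAt (𝓡 2) e (Φ 0 τ)) =ᶠ[𝓝 t] fun τ => extChartAt (𝓡 2) e (γ τ) := by
      filter_upwards [hΦ0ev] with τ hτ
      rw [hτ]
    refine ⟨hmem, by simp only [chartMap, hΦt], ?_, ?_⟩
    · rw [dy_chartMap]
      exact hev.deriv_eq
    · rw [dy_dy_chartMap (isOpen_chartDomain hW hΦ) (contDiffOn_chartMap hΦ) hmem]
      exact hev.deriv.deriv_eq
  obtain ⟨c1, c2, c3, c4⟩ := key c hc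
  obtain ⟨d1, d2, d3, d4⟩ := key d hd
  have hc0 := deriv_ne_zero_of_lift hγt hc hne
  have hd0 := deriv_ne_zero_of_lift hγt hd hne
  have v1 := firstVariation F hW hΦ c1 (by rwa [c3])
  have v2 := firstVariation F hW hΦ d1 (by rwa [d3])
  have v3 := v1.unique v2
  have hz0 : dx (chartMap Φ d) 0 t 1 = z := by
    have h1 : HasDerivAt (fun s => Ψ s t) z 0 := by
      simpa [Ψ] using ((hasDerivAt_id (0 : ℝ)).smul_const z).const_add (xd t)
    have h2 : (fun s => chartMap Φ d s t) =ᶠ[𝓝 0] fun s => Ψ s t := by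
      have : ∀ᶠ s in 𝓝 (0 : ℝ), (s, t) ∈ W :=
        ((Continuous.prodMk_left t).tendsto (0 : ℝ)).eventually (hW.mem_nhds htW)
      filter_upwards [this] with s hs
      exact (extChartAt (𝓡 2) d).right_inv hs.2
    exact (h1.congr_of_eventuallyEq h2).deriv
  rw [c2, c3, c4, d2, d3, d4, hz0] at v3
  have h' : deriv (deriv fun τ => extChartAt (𝓡 2) c (γ τ)) t
      + (2 : ℝ) • sprayOf (F.sq c) (extChartAt (𝓡 2) c (γ t))
          (deriv (fun τ => extChartAt (𝓡 2) c (γ τ)) t) = 0 := h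
  rw [h', map_zero, zero_apply, add_zero, left_eq_add] at v3
  by_contra hz1
  exact (hFd.convex _ ((extChartAt (𝓡 2) d).map_source hd) _ z hd0 hz1).ne' v3

end Finsler

end

/-! ### Geodesics as integral curves: uniqueness, locality and time shifts. -/

noncomputable section

namespace Finsler

/-- A solution of an autonomous equation with smooth right hand side is smooth. -/
theorem contDiffOn_of_hasDerivAt {E : Type*} [NormedAddCommGroup E] [NormedSpace ℝ E] {f : E → E}
    {U : Set E} (hf : ContDiffOn ℝ ∞ f U) {z : ℝ → E} {S : Set ℝ} (hS : IsOpen S)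
    (hz : ∀ t ∈ S, z t ∈ U ∧ HasDerivAt z (f (z t)) t) : ContDiffOn ℝ ∞ z S := by
  rw [contDiffOn_infty]
  intro n
  induction n with
  | zero =>
    exact contDiffOn_zero.2 fun t ht => (hz t ht).2.continuousAt.continuousWithinAt
  | succ n ih =>
    push_cast
    rw [contDiffOn_succ_iff_deriv_of_isOpen hS]
    refine ⟨fun t ht => (hz t ht).2.differentiableAt.differentiableWithinAt, by simp, ?_⟩
    have h1 : ContDiffOn ℝ n (fun t => f (z t)) S :=
      (hf.of_le (by exact_mod_cast le_top)).comp ih fun t ht => (hz t ht).1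
    exact h1.congr fun t ht => (hz t ht).2.deriv

variable {M : Type*} [TopologicalSpace M] [ChartedSpace Plane M] [IsManifold (𝓡 2) ∞ M]

variable (F : Metric M)

theorem unit_snd_ne_zero {u : TangentBundle (𝓡 2) M} (hu : F.norm u = 1) : u.2 ≠ 0 := by
  intro h0
  have h1 := F.norm_smul u.1 0 0 le_rfl
  rw [smul_zero, zero_mul] at h1
  have h2 : u = ⟨u.1, 0⟩ := Bundle.TotalSpace.ext rfl (heq_of_eq h0)
  rw [h2, h1] at hu
  exact zero_ne_one hu

section Curves

variable {F} {γ γ₁ γ₂ : ℝ → M} {S : Set ℝ} {t : ℝ} {c : M}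

theorem lift_congr (h : γ₁ =ᶠ[𝓝 t] γ₂) : lift γ₁ t = lift γ₂ t := by
  refine Bundle.TotalSpace.ext h.self_of_nhds ?_
  simp only [lift]
  rw [h.mfderiv_eq]
  exact heq_of_eq rfl

namespace Metric.IsGeodesicOn

theorem mdifferentiableAt (h : F.IsGeodesicOn γ S) (hS : IsOpen S) (ht : t ∈ S) :
    MDifferentiableAt 𝓘(ℝ, ℝ) (𝓡 2) γ t :=
  (h.contMDiffOn.contMDiffAt (hS.mem_nhds ht)).mdifferentiableAt (by norm_num)

theorem contDiffOn_chart (h : F.IsGeodesicOn γ S) :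
    ContDiffOn ℝ ∞ (fun τ => extChartAt (𝓡 2) c (γ τ)) (S ∩ γ ⁻¹' (extChartAt (𝓡 2) c).source) := by
  rw [← contMDiffOn_iff_contDiffOn]
  have := contMDiffOn_extChartAt (I := 𝓡 2) (n := ∞) (x := c)
  rw [← extChartAt_source (I := 𝓡 2)] at this
  exact this.comp (h.contMDiffOn.mono inter_subset_left) fun z hz => hz.2

theorem isOpen_chart (h : F.IsGeodesicOn γ S) (hS : IsOpen S) :
    IsOpen (S ∩ γ ⁻¹' (extChartAt (𝓡 2) c).source) :=
  h.contMDiffOn.continuousOn.isOpen_inter_preimage hS (isOpen_extChartAt_source c)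

theorem tchart_lift (h : F.IsGeodesicOn γ S) (hS : IsOpen S) (ht : t ∈ S)
    (hc : γ t ∈ (extChartAt (𝓡 2) c).source) :
    tchart c (lift γ t) = (extChartAt (𝓡 2) c (γ t), deriv (fun τ => extChartAt (𝓡 2) c (γ τ)) t) := by
  rw [lift_eq_chartVector (h.mdifferentiableAt hS ht) hc,
    tchart_chartVector ((extChartAt (𝓡 2) c).map_source hc)]

theorem snd_ne_zero (h : F.IsGeodesicOn γ S) (hS : IsOpen S) (ht : t ∈ S)
    (hc : γ t ∈ (extChartAt (𝓡 2) c).source) : (tchart c (lift γ t)).2 ≠ 0 := by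
  rw [h.tchart_lift hS ht hc]
  exact deriv_ne_zero_of_lift (h.mdifferentiableAt hS ht) hc (unit_snd_ne_zero F (h.unit_speed t ht))

/-- A geodesic read in the phase space of a chart is an integral curve. -/
theorem hasDerivAt_tchart (h : F.IsGeodesicOn γ S) (hS : IsOpen S) (ht : t ∈ S)
    (hc : γ t ∈ (extChartAt (𝓡 2) c).source) :
    HasDerivAt (fun τ => tchart c (lift γ τ))
      (IsFinslerSq.field (F.sq c) (tchart c (lift γ t))) t := by
  have hS' := h.isOpen_chart (c := c) hS
  have hx := h.contDiffOn_chart (c := c)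
  set x := fun τ => extChartAt (𝓡 2) c (γ τ)
  have hx' : ContDiffOn ℝ ∞ (deriv x) (S ∩ γ ⁻¹' (extChartAt (𝓡 2) c).source) :=
    hx.deriv_of_isOpen hS' (by norm_num)
  have hmem : S ∩ γ ⁻¹' (extChartAt (𝓡 2) c).source ∈ 𝓝 t := hS'.mem_nhds ⟨ht, hc⟩
  have d1 : HasDerivAt x (deriv x t) t :=
    ((hx.contDiffAt hmem).differentiableAt (by norm_num)).hasDerivAt
  have d2 : HasDerivAt (deriv x) (deriv (deriv x) t) t :=
    ((hx'.contDiffAt hmem).differentiableAt (by norm_num)).hasDerivAt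
  rw [h.tchart_lift hS ht hc]
  have heq : deriv (deriv x) t = -((2 : ℝ) • sprayOf (F.sq c) (x t) (deriv x t)) :=
    eq_neg_of_add_eq_zero_left (h.equation t ht c hc)
  have d3 := d1.prodMk d2
  rw [heq] at d3
  refine d3.congr_of_eventuallyEq ?_
  filter_upwards [hmem] with τ hτ
  exact h.tchart_lift hS hτ.1 hτ.2

theorem continuousAt_tchart (h : F.IsGeodesicOn γ S) (hS : IsOpen S) (ht : t ∈ S)
    (hc : γ t ∈ (extChartAt (𝓡 2) c).source) : ContinuousAt (fun τ => tchart c (lift γ τ)) t :=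
  (h.hasDerivAt_tchart hS ht hc).continuousAt

theorem eventually_source (h : F.IsGeodesicOn γ S) (hS : IsOpen S) (ht : t ∈ S)
    (hc : γ t ∈ (extChartAt (𝓡 2) c).source) :
    ∀ᶠ τ in 𝓝 t, τ ∈ S ∧ γ τ ∈ (extChartAt (𝓡 2) c).source :=
  (h.isOpen_chart hS).mem_nhds ⟨ht, hc⟩

theorem eventually_lift_eq (h₁ : F.IsGeodesicOn γ₁ S) (h₂ : F.IsGeodesicOn γ₂ S) (hS : IsOpen S)
    (ht : t ∈ S) (heq : lift γ₁ t = lift γ₂ t) : ∀ᶠ τ in 𝓝 t, lift γ₁ τ = lift γ₂ τ := by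
  set c := γ₁ t
  have hbase : γ₂ t = γ₁ t := (congrArg Bundle.TotalSpace.proj heq).symm
  have hc₁ : γ₁ t ∈ (extChartAt (𝓡 2) c).source := mem_extChartAt_source _
  have hc₂ : γ₂ t ∈ (extChartAt (𝓡 2) c).source := by rw [hbase]; exact hc₁
  have hF := isFinslerSq F c
  set z := tchart c (lift γ₁ t) with hz
  have hzU : z ∈ (extChartAt (𝓡 2) c).target ×ˢ ({0}ᶜ : Set Plane) :=
    ⟨by rw [hz, tchart_fst]; exact (extChartAt (𝓡 2) c).map_source hc₁, h₁.snd_ne_zero hS ht hc₁⟩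
  have hf : ContDiffAt ℝ 1 (IsFinslerSq.field (F.sq c)) z :=
    (hF.contDiffOn_field.contDiffAt (hF.isOpen_phase.mem_nhds hzU)).of_le (by norm_cast)
  obtain ⟨K, N, hN, hL⟩ := hf.exists_lipschitzOnWith
  have e1 := h₁.eventually_source hS ht hc₁
  have e2 := h₂.eventually_source hS ht hc₂
  have n1 := (h₁.continuousAt_tchart hS ht hc₁).eventually hN
  have n2 := (h₂.continuousAt_tchart hS ht hc₂).eventually (show N ∈ 𝓝 (tchart c (lift γ₂ t)) by
    rw [← heq]; exact hN)
  have hu := ODE_solution_unique_of_eventually (v := fun _ => IsFinslerSq.field (F.sq c))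
    (s := fun _ => N) (K := K) (f := fun τ => tchart c (lift γ₁ τ))
    (g := fun τ => tchart c (lift γ₂ τ)) (t₀ := t)
    (Filter.Eventually.of_forall fun _ => hL)
    (by filter_upwards [e1, n1] with τ a b using ⟨h₁.hasDerivAt_tchart hS a.1 a.2, b⟩)
    (by filter_upwards [e2, n2] with τ a b using ⟨h₂.hasDerivAt_tchart hS a.1 a.2, b⟩)
    (by rw [heq])
  filter_upwards [hu, e1, e2] with τ a b b'
  rw [← chartVector_tchart (c := c) (u := lift γ₁ τ) b.2,
    ← chartVector_tchart (c := c) (u := lift γ₂ τ) b'.2]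
  rw [a]

/-- Geodesics are determined by their initial vector. -/
theorem lift_eqOn [T2Space M] (h₁ : F.IsGeodesicOn γ₁ S) (h₂ : F.IsGeodesicOn γ₂ S) (hS : IsOpen S)
    (hS' : S.OrdConnected) (ht : t ∈ S) (heq : lift γ₁ t = lift γ₂ t) :
    ∀ τ ∈ S, lift γ₁ τ = lift γ₂ τ := by
  set A : Set ℝ := {τ | τ ∈ S ∧ lift γ₁ τ = lift γ₂ τ}
  have hA : IsOpen A := by
    rw [isOpen_iff_mem_nhds]
    rintro τ ⟨hτ, he⟩
    filter_upwards [hS.mem_nhds hτ, h₁.eventually_lift_eq h₂ hS hτ he] with σ a b using ⟨a, b⟩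
  have := IsPreconnected.subset_of_closure_inter_subset hS'.isPreconnected hA ⟨t, ht, ht, heq⟩ ?_
  · exact fun τ hτ => (this hτ).2
  rintro τ ⟨hτA, hτ⟩
  refine ⟨hτ, ?_⟩
  have hfreq : ∃ᶠ σ in 𝓝 τ, σ ∈ A := mem_closure_iff_frequently.1 hτA
  -- Closedness of the agreement set is checked in two stages, base points in the Hausdorff space
  -- `M` and then velocities in a chart, so no separation property of the tangent bundle is needed.
  have hb : γ₁ τ = γ₂ τ := by
    by_contra hne
    obtain ⟨V₁, V₂, o1, o2, m1, m2, hd⟩ := t2_separation hne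
    have c1 := (h₁.mdifferentiableAt hS hτ).continuousAt.eventually (o1.mem_nhds m1)
    have c2 := (h₂.mdifferentiableAt hS hτ).continuousAt.eventually (o2.mem_nhds m2)
    obtain ⟨σ, hσ, a, b⟩ := (hfreq.and_eventually (c1.and c2)).exists
    have : γ₁ σ = γ₂ σ := congrArg Bundle.TotalSpace.proj hσ.2
    exact disjoint_left.1 hd a (by rw [this]; exact b)
  set c := γ₁ τ
  have hc₁ : γ₁ τ ∈ (extChartAt (𝓡 2) c).source := mem_extChartAt_source _
  have hc₂ : γ₂ τ ∈ (extChartAt (𝓡 2) c).source := by rw [← hb]; exact hc₁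
  have hz : tchart c (lift γ₁ τ) = tchart c (lift γ₂ τ) := by
    by_contra hne
    obtain ⟨V₁, V₂, o1, o2, m1, m2, hd⟩ := t2_separation hne
    have c1 := (h₁.continuousAt_tchart hS hτ hc₁).eventually (o1.mem_nhds m1)
    have c2 := (h₂.continuousAt_tchart hS hτ hc₂).eventually (o2.mem_nhds m2)
    obtain ⟨σ, hσ, a, b⟩ := (hfreq.and_eventually (c1.and c2)).exists
    rw [hσ.2] at a
    exact disjoint_left.1 hd a b
  rw [← chartVector_tchart (c := c) (u := lift γ₁ τ) hc₁, hz, chartVector_tchart hc₂]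

theorem eqOn [T2Space M] (h₁ : F.IsGeodesicOn γ₁ S) (h₂ : F.IsGeodesicOn γ₂ S) (hS : IsOpen S)
    (hS' : S.OrdConnected) (ht : t ∈ S) (heq : lift γ₁ t = lift γ₂ t) : EqOn γ₁ γ₂ S :=
  fun τ hτ => congrArg Bundle.TotalSpace.proj (h₁.lift_eqOn h₂ hS hS' ht heq τ hτ)

theorem mono {S' : Set ℝ} (h : F.IsGeodesicOn γ S) (hS : S' ⊆ S) : F.IsGeodesicOn γ S' :=
  ⟨h.contMDiffOn.mono hS, fun t ht => h.unit_speed t (hS ht), fun t ht => h.equation t (hS ht)⟩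

end Metric.IsGeodesicOn

theorem Metric.EquationAt.congr (h : γ₁ =ᶠ[𝓝 t] γ₂) (h₁ : F.EquationAt γ₁ c t) :
    F.EquationAt γ₂ c t := by
  have h2 : (fun τ => extChartAt (𝓡 2) c (γ₁ τ)) =ᶠ[𝓝 t] fun τ => extChartAt (𝓡 2) c (γ₂ τ) := by
    filter_upwards [h] with τ hτ
    rw [hτ]
  unfold Metric.EquationAt at h₁ ⊢
  rw [← h2.deriv.deriv_eq, ← h2.deriv_eq, ← h.self_of_nhds]
  exact h₁

/-- Being a geodesic is a local property. -/
theorem isGeodesicOn_of_locally (hS : IsOpen S)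
    (h : ∀ t ∈ S, ∃ γ' : ℝ → M, ∃ S' : Set ℝ, IsOpen S' ∧ t ∈ S' ∧ F.IsGeodesicOn γ' S' ∧
      γ' =ᶠ[𝓝 t] γ) : F.IsGeodesicOn γ S := by
  refine ⟨fun t ht => ?_, fun t ht => ?_, fun t ht c hc => ?_⟩
  · obtain ⟨γ', S', o, m, g, e⟩ := h t ht
    exact ((g.contMDiffOn.contMDiffAt (o.mem_nhds m)).congr_of_eventuallyEq e.symm).contMDiffWithinAt
  · obtain ⟨γ', S', o, m, g, e⟩ := h t ht
    rw [← lift_congr e]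
    exact g.unit_speed t m
  · obtain ⟨γ', S', o, m, g, e⟩ := h t ht
    exact Metric.EquationAt.congr e (g.equation t m c (by rw [e.self_of_nhds]; exact hc))

theorem lift_comp_add (γ : ℝ → M) (a t : ℝ) : lift (fun s => γ (s + a)) t = lift γ (t + a) := by
  have h2 : mfderiv 𝓘(ℝ, ℝ) (𝓡 2) (fun s => γ (s + a)) t = mfderiv 𝓘(ℝ, ℝ) (𝓡 2) γ (t + a) := by
    have hsh : ∀ b x : ℝ, HasMFDerivAt 𝓘(ℝ, ℝ) 𝓘(ℝ, ℝ) (fun s => s + b) x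
        (ContinuousLinearMap.id ℝ ℝ) := fun b x =>
      ((hasFDerivAt_id x).add_const b).hasMFDerivAt
    by_cases hd : MDifferentiableAt 𝓘(ℝ, ℝ) (𝓡 2) γ (t + a)
    · exact (HasMFDerivAt.comp t hd.hasMFDerivAt (hsh a t)).mfderiv
    -- Without differentiability both sides take the default derivative `0`, so the identity holds
    -- for arbitrary curves.
    · rw [mfderiv_zero_of_not_mdifferentiableAt hd]
      refine mfderiv_zero_of_not_mdifferentiableAt fun hd' => hd ?_
      have h3 : MDifferentiableAt 𝓘(ℝ, ℝ) (𝓡 2) (fun s => γ (s + a)) (t + a + -a) := by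
        rwa [add_neg_cancel_right]
      have := MDifferentiableAt.comp (t + a) h3 (hsh (-a) (t + a)).mdifferentiableAt
      refine this.congr_of_eventuallyEq (Filter.Eventually.of_forall fun s => ?_)
      simp
  refine Bundle.TotalSpace.ext rfl ?_
  simp only [lift]
  rw [h2]
  exact heq_of_eq rfl

theorem Metric.IsGeodesicOn.comp_add (h : F.IsGeodesicOn γ S) (a : ℝ) :
    F.IsGeodesicOn (fun s => γ (s + a)) ((fun s => s + a) ⁻¹' S) := by
  refine ⟨?_, fun t ht => ?_, fun t ht c hc => ?_⟩
  · refine h.contMDiffOn.comp (t := S) (f := fun s : ℝ => s + a) ?_ fun s hs => hs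
    exact (contDiff_id.add contDiff_const).contMDiff.contMDiffOn
  · rw [lift_comp_add]
    exact h.unit_speed _ ht
  · have e1 : deriv (fun τ => extChartAt (𝓡 2) c (γ (τ + a)))
        = fun t => deriv (fun τ => extChartAt (𝓡 2) c (γ τ)) (t + a) := by
      funext t
      exact deriv_comp_add_const (f := fun τ => extChartAt (𝓡 2) c (γ τ)) a t
    rw [e1, deriv_comp_add_const (f := deriv fun τ => extChartAt (𝓡 2) c (γ τ))]
    exact h.equation _ ht c hc

/-- A solution of the geodesic equation in a chart is a geodesic. -/
theorem isGeodesicOn_of_chart {z : ℝ → Plane × Plane} (hS : IsOpen S) (hS' : S.OrdConnected)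
    (hz : ∀ t ∈ S, z t ∈ (extChartAt (𝓡 2) c).target ×ˢ ({0}ᶜ : Set Plane) ∧
      HasDerivAt z (IsFinslerSq.field (F.sq c) (z t)) t)
    (ht : t ∈ S) (h1 : F.sq c (z t).1 (z t).2 = 1) :
    F.IsGeodesicOn (fun t => (extChartAt (𝓡 2) c).symm (z t).1) S ∧
      ∀ t ∈ S, lift (fun t => (extChartAt (𝓡 2) c).symm (z t).1) t = chartVector c (z t).1 (z t).2 := by
  have hF := isFinslerSq F c
  have hsm := contDiffOn_of_hasDerivAt hF.contDiffOn_field hS hz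
  set γ := fun t => (extChartAt (𝓡 2) c).symm (z t).1 with hγ
  have hγs : ContMDiffOn 𝓘(ℝ, ℝ) (𝓡 2) ∞ γ S :=
    (contMDiffOn_extChartAt_symm (n := ∞) c).comp (contDiff_fst.comp_contDiffOn hsm).contMDiffOn
      fun t ht => (hz t ht).1.1
  have hd : ∀ t ∈ S, HasDerivAt (fun t => (z t).1) (z t).2 t ∧
      HasDerivAt (fun t => (z t).2) (-((2 : ℝ) • sprayOf (F.sq c) (z t).1 (z t).2)) t := fun t ht =>
    ⟨(hz t ht).2.fst, (hz t ht).2.snd⟩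
  have hsrc : ∀ t ∈ S, γ t ∈ (extChartAt (𝓡 2) c).source := fun t ht =>
    (extChartAt (𝓡 2) c).map_target (hz t ht).1.1
  have hx : ∀ t ∈ S, extChartAt (𝓡 2) c (γ t) = (z t).1 := fun t ht =>
    (extChartAt (𝓡 2) c).right_inv (hz t ht).1.1
  have hxev : ∀ t ∈ S, (fun t => extChartAt (𝓡 2) c (γ t)) =ᶠ[𝓝 t] fun t => (z t).1 := fun t ht => by
    filter_upwards [hS.mem_nhds ht] with s hs using hx s hs
  have hy : ∀ t ∈ S, deriv (fun t => extChartAt (𝓡 2) c (γ t)) t = (z t).2 := fun t ht => by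
    rw [(hxev t ht).deriv_eq]
    exact (hd t ht).1.deriv
  have hyev : ∀ t ∈ S, deriv (fun t => extChartAt (𝓡 2) c (γ t)) =ᶠ[𝓝 t] fun t => (z t).2 :=
    fun t ht => by filter_upwards [hS.mem_nhds ht] with s hs using hy s hs
  have hlift : ∀ t ∈ S, lift γ t = chartVector c (z t).1 (z t).2 := fun t ht => by
    rw [lift_eq_chartVector ((hγs.contMDiffAt (hS.mem_nhds ht)).mdifferentiableAt (by norm_num))
      (hsrc t ht), hx t ht, hy t ht]
  -- Conservation of energy spreads the unit speed condition from the single time `t` to all of `S`.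
  have hconst : ∀ s ∈ S, HasDerivAt (fun t => F.sq c (z t).1 (z t).2) 0 s := fun s hs => by
    refine hF.hasDerivAt_sq_geodesic (x := fun t => (z t).1) (y := fun t => (z t).2) (hz s hs).1.1
      (hz s hs).1.2 ?_ (hd s hs).2
    filter_upwards [hS.mem_nhds hs] with r hr using (hd r hr).1
  have hone : ∀ s ∈ S, F.sq c (z s).1 (z s).2 = 1 := fun s hs => by
    rw [← h1]
    exact hS.is_const_of_deriv_eq_zero hS'.isPreconnected
      (fun r hr => (hconst r hr).differentiableAt.differentiableWithinAt)
      (fun r hr => (hconst r hr).deriv) hs ht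
  have hunit : ∀ s ∈ S, lift γ s ∈ F.unitBundle := fun s hs => by
    have h2 := hone s hs
    have h3 : 0 < F.norm (chartVector c (z s).1 (z s).2) :=
      F.norm_pos _ _ fun h0 => (hz s hs).1.2 ((frame_eq_zero (hz s hs).1.1).1 h0)
    rw [hlift s hs]
    change F.norm (chartVector c (z s).1 (z s).2) ^ 2 = 1 at h2
    exact (pow_eq_one_iff_of_nonneg h3.le two_ne_zero).1 h2
  refine ⟨⟨hγs, hunit, fun t ht d hdt => ?_⟩, hlift⟩
  refine Metric.EquationAt.change F hS hγs ht (unit_snd_ne_zero F (hunit t ht)) (hsrc t ht) hdt ?_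
  change deriv (deriv fun t => extChartAt (𝓡 2) c (γ t)) t
      + (2 : ℝ) • sprayOf (F.sq c) (extChartAt (𝓡 2) c (γ t))
          (deriv (fun τ => extChartAt (𝓡 2) c (γ τ)) t) = 0
  rw [(hyev t ht).deriv_eq, hx t ht, hy t ht, (hd t ht).2.deriv, neg_add_cancel]

end Curves

end Finsler

end

noncomputable section

namespace Finsler

variable {M : Type*} [TopologicalSpace M] [ChartedSpace Plane M] [IsManifold (𝓡 2) ∞ M]

variable (F : Metric M)

/-! ### The unit bundle -/

/-- The unit vector in the direction of `u`. -/
def Metric.unit (u : TangentBundle (𝓡 2) M) : TangentBundle (𝓡 2) M := ⟨u.1, (F.norm u)⁻¹ • u.2⟩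

theorem norm_eq_zero_of_snd {u : TangentBundle (𝓡 2) M} (hu : u.2 = 0) : F.norm u = 0 := by
  have h1 := F.norm_smul u.1 0 0 le_rfl
  rw [smul_zero, zero_mul] at h1
  have h2 : u = ⟨u.1, 0⟩ := Bundle.TotalSpace.ext rfl (heq_of_eq hu)
  rw [h2, h1]

theorem norm_pos_of_snd {u : TangentBundle (𝓡 2) M} (hu : u.2 ≠ 0) : 0 < F.norm u :=
  F.norm_pos u.1 u.2 hu

theorem norm_unit {u : TangentBundle (𝓡 2) M} (hu : u.2 ≠ 0) : F.norm (F.unit u) = 1 := by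
  have h := norm_pos_of_snd F hu
  unfold Metric.unit
  rw [F.norm_smul _ _ _ (inv_nonneg.2 h.le)]
  exact inv_mul_cancel₀ h.ne'

theorem unit_of_norm_eq_one {u : TangentBundle (𝓡 2) M} (hu : F.norm u = 1) : F.unit u = u := by
  unfold Metric.unit
  rw [hu, inv_one, one_smul]

theorem isOpen_ne_zero (F : Metric M) : IsOpen {u : TangentBundle (𝓡 2) M | u.2 ≠ 0} := by
  have : {u : TangentBundle (𝓡 2) M | u.2 ≠ 0} = F.norm ⁻¹' {0}ᶜ := by
    ext u
    exact ⟨fun h => (norm_pos_of_snd F h).ne', fun h h0 => h (norm_eq_zero_of_snd F h0)⟩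
  rw [this]
  exact isOpen_compl_singleton.preimage F.continuous_norm

theorem chartVector_smul (c : M) (x y : Plane) (r : ℝ) :
    chartVector c x (r • y) = ⟨(chartVector c x y).1, r • (chartVector c x y).2⟩ :=
  Bundle.TotalSpace.ext rfl (heq_of_eq (map_smul (frame c x) r y))

theorem contMDiffAt_norm {u : TangentBundle (𝓡 2) M} (hu : u.2 ≠ 0) :
    ContMDiffAt (𝓡 2).tangent 𝓘(ℝ, ℝ) ∞ F.norm u :=
  F.contMDiffOn_norm.contMDiffAt ((isOpen_ne_zero F).mem_nhds hu)

theorem snd_tchart_ne_zero {u : TangentBundle (𝓡 2) M} {c : M}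
    (hu : u.1 ∈ (extChartAt (𝓡 2) c).source) (h0 : u.2 ≠ 0) : (tchart c u).2 ≠ 0 := by
  intro h
  have h1 := chartVector_tchart hu
  rw [h] at h1
  have h2 : (chartVector c (tchart c u).1 0).2 = 0 := map_zero (frame c _)
  rw [← h1] at h0
  exact h0 h2

/-- Over a closed coordinate ball the unit vectors lie in the continuous image of ball times
Euclidean circle under normalisation; finitely many such pieces cover the closed set `Σ`. -/
theorem isCompact_unitBundle [CompactSpace M] : IsCompact F.unitBundle := by
  have hcl : IsClosed F.unitBundle := isClosed_singleton.preimage F.continuous_norm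
  have hloc : ∀ p : M, ∃ N ∈ 𝓝 p, ∃ K : Set (TangentBundle (𝓡 2) M), IsCompact K ∧
      ∀ u ∈ F.unitBundle, u.1 ∈ N → u ∈ K := by
    intro p
    have hp := mem_extChartAt_target (I := 𝓡 2) p
    obtain ⟨ρ, hρ, hsub⟩ := Metric.nhds_basis_closedBall.mem_iff.1 ((isOpen_target p).mem_nhds hp)
    set B := Metric.closedBall (extChartAt (𝓡 2) p p) ρ
    let f : Plane × Plane → TangentBundle (𝓡 2) M := fun z => F.unit (chartVector p z.1 z.2)
    have hf : ContinuousOn f (B ×ˢ Metric.sphere 0 1) := by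
      have h1 : ContinuousOn (fun z : Plane × Plane => chartVector p z.1
          ((F.norm (chartVector p z.1 z.2))⁻¹ • z.2)) (B ×ˢ Metric.sphere 0 1) := by
        refine (contMDiffOn_chartVector p).continuousOn.comp
          (f := fun z : Plane × Plane => (z.1, (F.norm (chartVector p z.1 z.2))⁻¹ • z.2)) ?_
          fun z hz => ⟨hsub hz.1, mem_univ _⟩
        have h2 : ContinuousOn (fun z : Plane × Plane => F.norm (chartVector p z.1 z.2))
            (B ×ˢ Metric.sphere 0 1) :=
          F.continuous_norm.comp_continuousOn ((contMDiffOn_chartVector p).continuousOn.mono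
            (prod_mono hsub (subset_univ _)))
        refine continuousOn_fst.prodMk ((h2.inv₀ fun z hz => ?_).smul continuousOn_snd)
        refine (norm_pos_of_snd F fun h0 => ?_).ne'
        have := (frame_eq_zero (hsub hz.1)).1 h0
        have h3 := hz.2
        rw [this] at h3
        simp at h3
      refine h1.congr fun z hz => ?_
      simp only [f, Metric.unit]
      exact (chartVector_smul ..).symm
    refine ⟨(extChartAt (𝓡 2) p).source ∩ extChartAt (𝓡 2) p ⁻¹' B, ?_, f '' (B ×ˢ Metric.sphere 0 1),
      ((isCompact_closedBall _ _).prod (isCompact_sphere _ _)).image_of_continuousOn hf, ?_⟩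
    · exact Filter.inter_mem (extChartAt_source_mem_nhds p)
        ((continuousAt_extChartAt p).preimage_mem_nhds (Metric.closedBall_mem_nhds _ hρ))
    · intro u hu hN
      have h0 : u.2 ≠ 0 := unit_snd_ne_zero F hu
      have hy := snd_tchart_ne_zero hN.1 h0
      have hn : 0 < ‖(tchart p u).2‖ := norm_pos_iff.2 hy
      refine ⟨((tchart p u).1, ‖(tchart p u).2‖⁻¹ • (tchart p u).2), ⟨hN.2, ?_⟩, ?_⟩
      · exact mem_sphere_zero_iff_norm.2 (by rw [norm_smul, norm_inv, norm_norm, inv_mul_cancel₀ hn.ne'])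
      · simp only [f]
        rw [chartVector_smul, chartVector_tchart hN.1]
        unfold Metric.unit
        rw [F.norm_smul _ _ _ (inv_nonneg.2 hn.le)]
        have hu1 : F.norm ⟨u.1, u.2⟩ = 1 := hu
        rw [hu1, mul_one, inv_inv, smul_smul, mul_inv_cancel₀ hn.ne', one_smul]
  choose N hN K hK hsub using hloc
  obtain ⟨t, ht⟩ := isCompact_univ.elim_nhds_subcover N fun p _ => hN p
  refine (t.isCompact_biUnion fun p _ => hK p).of_isClosed_subset hcl fun u hu => ?_
  obtain ⟨p, hp, hup⟩ := mem_iUnion₂.1 (ht.2 (mem_univ u.1))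
  exact mem_iUnion₂.2 ⟨p, hp, hsub p u hu hup⟩

/-! ### The local geodesic flow -/

/-- `Θ` is a local geodesic flow near `u` for times less than `ε`. -/
def Metric.HasLocalFlow (n : ℕ) (ε : ℝ) (u : TangentBundle (𝓡 2) M) : Prop :=
  ∃ Θ : TangentBundle (𝓡 2) M × ℝ → TangentBundle (𝓡 2) M, ∃ N ∈ 𝓝 u, ∀ v ∈ N,
    (∀ s ∈ Ioo (-ε) ε, ContMDiffAt ((𝓡 2).tangent.prod 𝓘(ℝ, ℝ)) (𝓡 2).tangent n Θ (v, s)) ∧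
    F.IsGeodesicOn (fun s => (Θ (v, s)).1) (Ioo (-ε) ε) ∧
    (∀ s ∈ Ioo (-ε) ε, lift (fun s => (Θ (v, s)).1) s = Θ (v, s)) ∧ Θ (v, 0) = F.unit v

/-- Vectors are first rescaled to `F`-norm one, so `Θ` is smooth on an open subset of `TM` and no
manifold structure on `Σ` has to be constructed. -/
theorem exists_hasLocalFlow {n : ℕ} (hn : 1 ≤ n) {u : TangentBundle (𝓡 2) M}
    (hu : F.norm u = 1) : ∃ ε > 0, F.HasLocalFlow n ε u := by
  set c := u.1
  have hF := isFinslerSq F c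
  have hc : u.1 ∈ (extChartAt (𝓡 2) c).source := mem_extChartAt_source _
  have hu0 := unit_snd_ne_zero F hu
  set U := (extChartAt (𝓡 2) c).target ×ˢ ({0}ᶜ : Set Plane)
  have hz0 : tchart c u ∈ U := ⟨by rw [tchart_fst]; exact (extChartAt (𝓡 2) c).map_source hc,
    snd_tchart_ne_zero hc hu0⟩
  obtain ⟨φ, hφ, hφ'⟩ := exists_contDiffAt_flow_of_contDiffOn (n := n) (by exact_mod_cast hn)
    hF.isOpen_phase (hF.contDiffOn_field.of_le (by exact_mod_cast le_top)) hz0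
  have hφn : ∀ᶠ p in 𝓝 (tchart c u, (0 : ℝ)), ContDiffAt ℝ n φ p := hφ.eventually (by simp)
  obtain ⟨A, hA, B, hB, hAB⟩ := mem_nhds_prod_iff.1 (hφn.and hφ')
  obtain ⟨ε, hε, hεB⟩ := Metric.mem_nhds_iff.1 hB
  rw [Real.ball_eq_Ioo, zero_sub, zero_add] at hεB
  have hAB' : ∀ z ∈ A, ∀ s ∈ Ioo (-ε) ε, ContDiffAt ℝ n φ (z, s) ∧ φ (z, s) ∈ U ∧
      φ (z, 0) = z ∧ HasDerivAt (fun s => φ (z, s)) (IsFinslerSq.field (F.sq c) (φ (z, s))) s :=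
    fun z hz s hs => hAB (mk_mem_prod hz (hεB hs))
  let nz : TangentBundle (𝓡 2) M → Plane × Plane := fun v =>
    ((tchart c v).1, (F.norm v)⁻¹ • (tchart c v).2)
  set O := {v : TangentBundle (𝓡 2) M | v.1 ∈ (extChartAt (𝓡 2) c).source} ∩ {v | v.2 ≠ 0}
  have hO : IsOpen O := (isOpen_tsource c).inter (isOpen_ne_zero F)
  have hnz : ∀ v ∈ O, ContMDiffAt (𝓡 2).tangent 𝓘(ℝ, Plane × Plane) n nz v := by
    intro v hv
    have h1 : ContMDiffAt (𝓡 2).tangent 𝓘(ℝ, Plane × Plane) ∞ (tchart c) v :=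
      (contMDiffOn_tchart c).contMDiffAt ((isOpen_tsource c).mem_nhds hv.1)
    have h2 := contMDiffAt_norm F hv.2
    have h3 : ContMDiffAt (𝓡 2).tangent 𝓘(ℝ, ℝ) ∞ (fun v => (F.norm v)⁻¹) v :=
      (contDiffAt_inv ℝ (norm_pos_of_snd F hv.2).ne').contMDiffAt.comp v h2
    have h4 : ContMDiffAt (𝓡 2).tangent 𝓘(ℝ, Plane × Plane) ∞ nz v := by
      have h5 : ContMDiffAt (𝓡 2).tangent 𝓘(ℝ, Plane) ∞ (fun v => (tchart c v).1) v :=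
        contDiff_fst.contMDiff.contMDiffAt.comp v h1
      have h6 : ContMDiffAt (𝓡 2).tangent 𝓘(ℝ, Plane) ∞ (fun v => (tchart c v).2) v :=
        contDiff_snd.contMDiff.contMDiffAt.comp v h1
      exact h5.prodMk_space (h3.smul h6)
    exact h4.of_le (by exact_mod_cast le_top)
  have huO : u ∈ O := ⟨hc, hu0⟩
  have hnzu : nz u = tchart c u := by simp only [nz, hu, inv_one, one_smul]
  have hNnz : nz ⁻¹' A ∈ 𝓝 u := (hnz u huO).continuousAt.preimage_mem_nhds (by rwa [hnzu])
  refine ⟨ε, hε, fun p => chartVector c (φ (nz p.1, p.2)).1 (φ (nz p.1, p.2)).2, O ∩ nz ⁻¹' A,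
    Filter.inter_mem (hO.mem_nhds huO) hNnz, ?_⟩
  rintro v ⟨hvO, hvA⟩
  have hε0 : (0 : ℝ) ∈ Ioo (-ε) ε := ⟨by linarith, hε⟩
  have hcv : chartVector c (nz v).1 (nz v).2 = F.unit v := by
    simp only [nz, Metric.unit]
    rw [chartVector_smul, chartVector_tchart hvO.1]
  have h0 : φ (nz v, 0) = nz v := (hAB' _ hvA 0 hε0).2.2.1
  have hg := isGeodesicOn_of_chart (F := F) (c := c) (z := fun s => φ (nz v, s)) isOpen_Ioo
    ordConnected_Ioo (fun s hs => ⟨(hAB' _ hvA s hs).2.1, (hAB' _ hvA s hs).2.2.2⟩) hε0 (by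
      rw [h0]
      change F.norm (chartVector c (nz v).1 (nz v).2) ^ 2 = 1
      rw [hcv, norm_unit F hvO.2, one_pow])
  refine ⟨fun s hs => ?_, hg.1, hg.2, ?_⟩
  · have h1 := (hAB' _ hvA s hs).1
    have h2 : ContMDiffAt ((𝓡 2).tangent.prod 𝓘(ℝ, ℝ)) 𝓘(ℝ, (Plane × Plane) × ℝ) n
        (fun p : TangentBundle (𝓡 2) M × ℝ => (nz p.1, p.2)) (v, s) :=
      ((hnz v hvO).comp (v, s) contMDiffAt_fst).prodMk_space contMDiffAt_snd
    have h3 : ContMDiffAt ((𝓡 2).tangent.prod 𝓘(ℝ, ℝ)) 𝓘(ℝ, Plane × Plane) n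
        (fun p : TangentBundle (𝓡 2) M × ℝ => φ (nz p.1, p.2)) (v, s) :=
      h1.contMDiffAt.comp (v, s) h2
    have h4 : ContMDiffAt 𝓘(ℝ, Plane × Plane) (𝓡 2).tangent n
        (fun z : Plane × Plane => chartVector c z.1 z.2) (φ (nz v, s)) :=
      ((contMDiffOn_chartVector c).contMDiffAt (((isOpen_target c).prod isOpen_univ).mem_nhds
        ⟨(hAB' _ hvA s hs).2.1.1, mem_univ _⟩)).of_le (by exact_mod_cast le_top)
    exact h4.comp (v, s) h3
  · simp only
    rw [h0, hcv]

theorem Metric.HasLocalFlow.mono {n : ℕ} {ε δ : ℝ} (h : δ ≤ ε) {u : TangentBundle (𝓡 2) M}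
    (hu : F.HasLocalFlow n ε u) : F.HasLocalFlow n δ u := by
  obtain ⟨Θ, N, hN, H⟩ := hu
  have hsub : Ioo (-δ) δ ⊆ Ioo (-ε) ε := Ioo_subset_Ioo (neg_le_neg h) h
  exact ⟨Θ, N, hN, fun v hv => ⟨fun s hs => (H v hv).1 s (hsub hs), (H v hv).2.1.mono hsub,
    fun s hs => (H v hv).2.2.1 s (hsub hs), (H v hv).2.2.2⟩⟩

/-- Compactness of `Σ` yields one time for all unit vectors. This time may depend on the order of
differentiability `n`, which is why `n` is finite here. -/
theorem exists_uniform_localFlow [CompactSpace M] {n : ℕ} (hn : 1 ≤ n) :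
    ∃ ε > 0, ∀ u ∈ F.unitBundle, F.HasLocalFlow n ε u := by
  refine IsCompact.induction_on (p := fun s => ∃ ε > 0, ∀ u ∈ s ∩ F.unitBundle, F.HasLocalFlow n ε u)
    (isCompact_unitBundle F) ⟨1, one_pos, by simp⟩ ?_ ?_ ?_ |>.imp fun ε h => ⟨h.1, fun u hu =>
      h.2 u ⟨hu, hu⟩⟩
  · rintro s t hst ⟨ε, hε, h⟩
    exact ⟨ε, hε, fun u hu => h u ⟨hst hu.1, hu.2⟩⟩
  · rintro s t ⟨ε, hε, h⟩ ⟨δ, hδ, h'⟩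
    refine ⟨min ε δ, lt_min hε hδ, ?_⟩
    rintro u ⟨hu | hu, hu1⟩
    · exact (h u ⟨hu, hu1⟩).mono F (min_le_left _ _)
    · exact (h' u ⟨hu, hu1⟩).mono F (min_le_right _ _)
  · intro u hu
    obtain ⟨ε, hε, Θ, N, hN, H⟩ := exists_hasLocalFlow F hn hu
    obtain ⟨O, hON, hO, huO⟩ := mem_nhds_iff.1 hN
    exact ⟨O, mem_nhdsWithin_of_mem_nhds (hO.mem_nhds huO), ε, hε, fun v hv =>
      ⟨Θ, N, Filter.mem_of_superset (hO.mem_nhds hv.1) hON, H⟩⟩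

/-! ### Completeness -/

section Complete

variable {F} [T2Space M]

theorem exists_extension {ε T : ℝ} (hε : 0 < ε) (hT : ε / 2 ≤ T)
    (hloc : ∀ u ∈ F.unitBundle, ∃ γ : ℝ → M, F.IsGeodesicOn γ (Ioo (-ε) ε) ∧ lift γ 0 = u)
    {γ : ℝ → M} (hγ : F.IsGeodesicOn γ (Ioo (-T) T)) :
    ∃ γ' : ℝ → M, F.IsGeodesicOn γ' (Ioo (-(T + ε / 2)) (T + ε / 2)) ∧ EqOn γ' γ (Ioo (-T) T) := by
  -- Geodesics of half-length `ε` are attached at `±t₁`; they reach `T + 3ε/4`, beyond the required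
  -- `T + ε/2`.
  set t₁ := T - ε / 4 with ht₁
  have m1 : t₁ ∈ Ioo (-T) T := ⟨by linarith, by linarith⟩
  have m2 : -t₁ ∈ Ioo (-T) T := ⟨by linarith, by linarith⟩
  obtain ⟨γp, hp, hp0⟩ := hloc _ (hγ.unit_speed t₁ m1)
  obtain ⟨γm, hm, hm0⟩ := hloc _ (hγ.unit_speed (-t₁) m2)
  have hp' := hp.comp_add (-t₁)
  have hm' := hm.comp_add t₁
  have sp : (fun s : ℝ => s + -t₁) ⁻¹' Ioo (-ε) ε = Ioo (t₁ - ε) (t₁ + ε) := by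
    ext s
    simp only [mem_preimage, mem_Ioo]
    constructor <;> rintro ⟨a, b⟩ <;> constructor <;> linarith
  have sm : (fun s : ℝ => s + t₁) ⁻¹' Ioo (-ε) ε = Ioo (-t₁ - ε) (-t₁ + ε) := by
    ext s
    simp only [mem_preimage, mem_Ioo]
    constructor <;> rintro ⟨a, b⟩ <;> constructor <;> linarith
  rw [sp] at hp'
  rw [sm] at hm'
  have ep : EqOn (fun s => γp (s + -t₁)) γ (Ioo (t₁ - ε) (t₁ + ε) ∩ Ioo (-T) T) := by
    refine (hp'.mono inter_subset_left).eqOn (hγ.mono inter_subset_right) (isOpen_Ioo.inter isOpen_Ioo)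
      (ordConnected_Ioo.inter ordConnected_Ioo) (t := t₁) ⟨⟨by linarith, by linarith⟩, m1⟩ ?_
    rw [lift_comp_add, add_neg_cancel, hp0]
  have em : EqOn (fun s => γm (s + t₁)) γ (Ioo (-t₁ - ε) (-t₁ + ε) ∩ Ioo (-T) T) := by
    refine (hm'.mono inter_subset_left).eqOn (hγ.mono inter_subset_right) (isOpen_Ioo.inter isOpen_Ioo)
      (ordConnected_Ioo.inter ordConnected_Ioo) (t := -t₁) ⟨⟨by linarith, by linarith⟩, m2⟩ ?_
    rw [lift_comp_add, neg_add_cancel, hm0]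
  let γ' : ℝ → M := fun t => if t₁ < t then γp (t + -t₁) else if t < -t₁ then γm (t + t₁) else γ t
  have hEq : EqOn γ' γ (Ioo (-T) T) := by
    intro t ht
    simp only [γ']
    split_ifs with h1 h2
    · exact ep ⟨⟨by linarith, by linarith [ht.2]⟩, ht⟩
    · exact em ⟨⟨by linarith [ht.1], by linarith⟩, ht⟩
    · rfl
  refine ⟨γ', isGeodesicOn_of_locally isOpen_Ioo fun t ht => ?_, hEq⟩
  by_cases hin : t ∈ Ioo (-T) T
  · refine ⟨γ, _, isOpen_Ioo, hin, hγ, ?_⟩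
    filter_upwards [isOpen_Ioo.mem_nhds hin] with s hs using (hEq hs).symm
  · rcases le_or_gt T t with h1 | h1
    · have h2 : t₁ < t := by linarith
      refine ⟨_, _, isOpen_Ioo, ⟨by linarith, by linarith [ht.2]⟩, hp', ?_⟩
      filter_upwards [lt_mem_nhds h2] with s hs
      simp only [γ', hs, if_true]
    · have h3 : t ≤ -T := by
        by_contra h4
        exact hin ⟨by linarith, h1⟩
      have h2 : t < -t₁ := by linarith
      refine ⟨_, _, isOpen_Ioo, ⟨by linarith [ht.1], by linarith⟩, hm', ?_⟩
      filter_upwards [gt_mem_nhds h2] with s hs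
      have : ¬ t₁ < s := by linarith
      simp only [γ', this, hs, if_true, if_false]

/-- Completeness: as `ε` is uniform, every extension gains `ε / 2` at both ends, and by uniqueness
the geodesics on the growing intervals `(-R n, R n)` glue. -/
theorem exists_geodesic [CompactSpace M] {u : TangentBundle (𝓡 2) M} (hu : F.norm u = 1) :
    ∃ γ : ℝ → M, F.IsGeodesicOn γ univ ∧ lift γ 0 = u := by
  obtain ⟨ε, hε, hfl⟩ := exists_uniform_localFlow F le_rfl
  have hloc : ∀ u ∈ F.unitBundle, ∃ γ : ℝ → M, F.IsGeodesicOn γ (Ioo (-ε) ε) ∧ lift γ 0 = u := by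
    intro u hu
    obtain ⟨Θ, N, hN, H⟩ := hfl u hu
    have h := H u (mem_of_mem_nhds hN)
    refine ⟨_, h.2.1, ?_⟩
    rw [h.2.2.1 0 ⟨by linarith, hε⟩, h.2.2.2, unit_of_norm_eq_one F hu]
  let R : ℕ → ℝ := fun n => ε / 2 * (n + 1)
  have hR : ∀ n, ε / 2 ≤ R n := fun n => by
    have : (0 : ℝ) ≤ n := n.cast_nonneg
    simp only [R]
    nlinarith
  have hRmono : ∀ {m n : ℕ}, m ≤ n → R m ≤ R n := fun {m n} h => by
    have : (m : ℝ) ≤ n := by exact_mod_cast h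
    simp only [R]
    nlinarith
  have hex : ∀ n, ∃ γ : ℝ → M, F.IsGeodesicOn γ (Ioo (-R n) (R n)) ∧ lift γ 0 = u := by
    intro n
    induction n with
    | zero =>
      obtain ⟨γ, h1, h2⟩ := hloc u hu
      refine ⟨γ, h1.mono (Ioo_subset_Ioo ?_ ?_), h2⟩ <;> simp [R] <;> linarith
    | succ n ih =>
      obtain ⟨γ, h1, h2⟩ := ih
      obtain ⟨γ', h3, h4⟩ := exists_extension hε (hR n) hloc h1
      have h0 : (0 : ℝ) ∈ Ioo (-R n) (R n) := ⟨by linarith [hR n], by linarith [hR n]⟩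
      refine ⟨γ', ?_, ?_⟩
      · convert! h3 using 2 <;> simp only [R] <;> push_cast <;> ring
      · rw [← h2]
        refine lift_congr ?_
        filter_upwards [isOpen_Ioo.mem_nhds h0] with s hs using h4 hs
  choose γ hγ hγ0 using hex
  have hcomp : ∀ {m n : ℕ} {t : ℝ}, t ∈ Ioo (-R m) (R m) → t ∈ Ioo (-R n) (R n) → γ m t = γ n t := by
    have aux : ∀ {m n : ℕ} {t : ℝ}, m ≤ n → t ∈ Ioo (-R m) (R m) → γ m t = γ n t := by
      intro m n t hmn ht
      refine (hγ m).eqOn ((hγ n).mono (Ioo_subset_Ioo (neg_le_neg (hRmono hmn)) (hRmono hmn)))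
        isOpen_Ioo ordConnected_Ioo (t := 0) ⟨by linarith [hR m], by linarith [hR m]⟩ ?_ ht
      rw [hγ0, hγ0]
    intro m n t h1 h2
    rcases le_total m n with h | h
    · exact aux h h1
    · exact (aux h h2).symm
  have hcover : ∀ t : ℝ, ∃ n : ℕ, t ∈ Ioo (-R n) (R n) := by
    intro t
    obtain ⟨n, hn⟩ := exists_nat_gt (|t| / (ε / 2))
    rw [div_lt_iff₀ (by positivity)] at hn
    refine ⟨n, abs_lt.1 ?_⟩
    simp only [R]
    nlinarith
  choose k hk using hcover
  refine ⟨fun t => γ (k t) t, isGeodesicOn_of_locally isOpen_univ fun t _ => ⟨γ (k t), _, isOpen_Ioo,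
    hk t, hγ _, ?_⟩, ?_⟩
  · filter_upwards [isOpen_Ioo.mem_nhds (hk t)] with s hs using hcomp hs (hk s)
  · rw [← hγ0 (k 0)]
    refine lift_congr ?_
    filter_upwards [isOpen_Ioo.mem_nhds (hk 0)] with s hs using hcomp (hk s) hs

end Complete

end Finsler

end

noncomputable section

namespace Finsler

variable {M : Type*} [TopologicalSpace M] [ChartedSpace Plane M] [IsManifold (𝓡 2) ∞ M]

/-! ### The geodesic flow -/

/-- The unit speed geodesic with initial direction `u`. -/
def Metric.geo (F : Metric M) (u : TangentBundle (𝓡 2) M) : ℝ → M :=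
  @Classical.epsilon _ ⟨fun _ => u.1⟩ fun γ => F.IsGeodesicOn γ univ ∧ lift γ 0 = F.unit u

/-- The geodesic flow, extended to the complement of the zero section. -/
def Metric.flow (F : Metric M) (u : TangentBundle (𝓡 2) M) (t : ℝ) : TangentBundle (𝓡 2) M :=
  lift (F.geo u) t

variable {F : Metric M} {u : TangentBundle (𝓡 2) M}

theorem chartVector_norm_tchart {c : M} (hu : u.1 ∈ (extChartAt (𝓡 2) c).source) :
    chartVector c (tchart c u).1 ((F.norm u)⁻¹ • (tchart c u).2) = F.unit u := by
  rw [chartVector_smul, chartVector_tchart hu]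
  rfl

theorem contMDiffAt_unit (hu : u.2 ≠ 0) :
    ContMDiffAt (𝓡 2).tangent (𝓡 2).tangent ∞ F.unit u := by
  set c := u.1
  have hc : u.1 ∈ (extChartAt (𝓡 2) c).source := mem_extChartAt_source _
  have h1 : ContMDiffAt (𝓡 2).tangent 𝓘(ℝ, Plane × Plane) ∞ (tchart c) u :=
    (contMDiffOn_tchart c).contMDiffAt ((isOpen_tsource c).mem_nhds hc)
  have h2 := contMDiffAt_norm F hu
  have h3 : ContMDiffAt (𝓡 2).tangent 𝓘(ℝ, ℝ) ∞ (fun v => (F.norm v)⁻¹) u :=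
    (contDiffAt_inv ℝ (norm_pos_of_snd F hu).ne').contMDiffAt.comp u h2
  have h5 : ContMDiffAt (𝓡 2).tangent 𝓘(ℝ, Plane) ∞ (fun v => (tchart c v).1) u :=
    contDiff_fst.contMDiff.contMDiffAt.comp u h1
  have h6 : ContMDiffAt (𝓡 2).tangent 𝓘(ℝ, Plane) ∞ (fun v => (tchart c v).2) u :=
    contDiff_snd.contMDiff.contMDiffAt.comp u h1
  have h4 : ContMDiffAt (𝓡 2).tangent 𝓘(ℝ, Plane × Plane) ∞
      (fun v => ((tchart c v).1, (F.norm v)⁻¹ • (tchart c v).2)) u := h5.prodMk_space (h3.smul h6)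
  have h7 : ContMDiffAt 𝓘(ℝ, Plane × Plane) (𝓡 2).tangent ∞
      (fun z : Plane × Plane => chartVector c z.1 z.2)
      ((tchart c u).1, (F.norm u)⁻¹ • (tchart c u).2) :=
    (contMDiffOn_chartVector c).contMDiffAt (((isOpen_target c).prod isOpen_univ).mem_nhds
      ⟨by rw [tchart_fst]; exact (extChartAt (𝓡 2) c).map_source hc, mem_univ _⟩)
  refine ContMDiffAt.congr_of_eventuallyEq (h7.comp u h4) ?_
  filter_upwards [(isOpen_tsource c).mem_nhds hc] with v hv
  exact (chartVector_norm_tchart hv).symm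

section Flow

variable [T2Space M] [CompactSpace M]

theorem geo_spec (hu : u.2 ≠ 0) : F.IsGeodesicOn (F.geo u) univ ∧ lift (F.geo u) 0 = F.unit u :=
  Classical.epsilon_spec (p := fun γ => F.IsGeodesicOn γ univ ∧ lift γ 0 = F.unit u)
    (exists_geodesic (norm_unit F hu))

theorem isGeodesicOn_geo (hu : u.2 ≠ 0) : F.IsGeodesicOn (F.geo u) univ := (geo_spec hu).1

theorem flow_zero (hu : u.2 ≠ 0) : F.flow u 0 = F.unit u := (geo_spec hu).2

theorem geo_zero (hu : u.2 ≠ 0) : F.geo u 0 = u.1 :=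
  congrArg Bundle.TotalSpace.proj (geo_spec (F := F) hu).2

theorem flow_fst (u : TangentBundle (𝓡 2) M) (t : ℝ) : (F.flow u t).1 = F.geo u t := rfl

theorem norm_flow (hu : u.2 ≠ 0) (t : ℝ) : F.norm (F.flow u t) = 1 :=
  (isGeodesicOn_geo hu).unit_speed t (mem_univ _)

theorem flow_snd_ne_zero (hu : u.2 ≠ 0) (t : ℝ) : (F.flow u t).2 ≠ 0 :=
  unit_snd_ne_zero F (norm_flow hu t)

theorem eq_geo {γ : ℝ → M} (hγ : F.IsGeodesicOn γ univ) (hu : u.2 ≠ 0) (h : lift γ 0 = F.unit u) :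
    γ = F.geo u :=
  funext fun t => hγ.eqOn (isGeodesicOn_geo hu) isOpen_univ ordConnected_univ (mem_univ 0)
    (h.trans (geo_spec hu).2.symm) (mem_univ t)

theorem eqOn_geo {γ : ℝ → M} {S : Set ℝ} (hS : IsOpen S) (hS' : S.OrdConnected)
    (hγ : F.IsGeodesicOn γ S) (h0 : (0 : ℝ) ∈ S) (hu : u.2 ≠ 0) (h : lift γ 0 = F.unit u) :
    ∀ t ∈ S, lift γ t = F.flow u t :=
  hγ.lift_eqOn ((isGeodesicOn_geo hu).mono (subset_univ _)) hS hS' h0 (h.trans (geo_spec hu).2.symm)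

theorem geo_add (hu : u.2 ≠ 0) (s t : ℝ) : F.geo (F.flow u s) t = F.geo u (t + s) := by
  have h1 := (isGeodesicOn_geo (F := F) hu).comp_add s
  rw [preimage_univ] at h1
  refine (congrFun (eq_geo h1 (flow_snd_ne_zero hu s) ?_) t).symm
  rw [lift_comp_add, zero_add, unit_of_norm_eq_one F (norm_flow hu s)]
  rfl

theorem flow_add (hu : u.2 ≠ 0) (s t : ℝ) : F.flow (F.flow u s) t = F.flow u (t + s) := by
  unfold Metric.flow
  rw [← lift_comp_add]
  congr 1
  exact funext fun τ => geo_add hu s τ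

theorem geo_unit (hu : u.2 ≠ 0) : F.geo (F.unit u) = F.geo u := by
  have h : F.geo (F.flow u 0) = F.geo u := funext fun t => by rw [geo_add hu, add_zero]
  rwa [flow_zero hu] at h

theorem unit_snd (hu : u.2 ≠ 0) : (F.unit u).2 ≠ 0 := unit_snd_ne_zero F (norm_unit F hu)

theorem flow_unit (hu : u.2 ≠ 0) : F.flow (F.unit u) = F.flow u := by
  unfold Metric.flow
  rw [geo_unit hu]

theorem contMDiffAt_flow_of_hasLocalFlow {n : ℕ} {ε : ℝ} (hu : u.2 ≠ 0)
    (h : F.HasLocalFlow n ε u) {s : ℝ} (hs : s ∈ Ioo (-ε) ε) :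
    ContMDiffAt ((𝓡 2).tangent.prod 𝓘(ℝ, ℝ)) (𝓡 2).tangent n (uncurry F.flow) (u, s) := by
  obtain ⟨Θ, N, hN, H⟩ := h
  refine ((H u (mem_of_mem_nhds hN)).1 s hs).congr_of_eventuallyEq ?_
  have h0 : (0 : ℝ) ∈ Ioo (-ε) ε := ⟨by linarith [hs.1, hs.2], by linarith [hs.1, hs.2]⟩
  have hmem : (N ∩ {v | v.2 ≠ 0}) ×ˢ Ioo (-ε) ε ∈ 𝓝 (u, s) :=
    prod_mem_nhds (Filter.inter_mem hN ((isOpen_ne_zero F).mem_nhds hu)) (isOpen_Ioo.mem_nhds hs)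
  filter_upwards [hmem] with ⟨v, τ⟩ hv
  obtain ⟨-, h2, h3, h4⟩ := H v hv.1.1
  change F.flow v τ = Θ (v, τ)
  rw [← h3 τ hv.2]
  refine (eqOn_geo isOpen_Ioo ordConnected_Ioo h2 h0 hv.1.2 ?_ τ hv.2).symm
  rw [h3 0 h0, h4]

/-- The group law propagates smoothness from times below `ε` to all times: the flow at time `t` is a
composite of flows for short times, each smooth near every nonzero vector. -/
theorem contMDiffAt_flow_nat {n : ℕ} (hn : 1 ≤ n) (hu : u.2 ≠ 0) (t : ℝ) :
    ContMDiffAt ((𝓡 2).tangent.prod 𝓘(ℝ, ℝ)) (𝓡 2).tangent n (uncurry F.flow) (u, t) := by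
  obtain ⟨ε, hε, hloc⟩ := exists_uniform_localFlow F hn
  have base : ∀ (v : TangentBundle (𝓡 2) M), v.2 ≠ 0 → ∀ s ∈ Ioo (-ε) ε,
      ContMDiffAt ((𝓡 2).tangent.prod 𝓘(ℝ, ℝ)) (𝓡 2).tangent n (uncurry F.flow) (v, s) := by
    intro v hv s hs
    have h1 := contMDiffAt_flow_of_hasLocalFlow (unit_snd (F := F) hv) (hloc _ (norm_unit F hv)) hs
    have h2 : ContMDiffAt ((𝓡 2).tangent.prod 𝓘(ℝ, ℝ)) ((𝓡 2).tangent.prod 𝓘(ℝ, ℝ)) n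
        (fun p : TangentBundle (𝓡 2) M × ℝ => (F.unit p.1, p.2)) (v, s) :=
      (((contMDiffAt_unit hv).of_le (by exact_mod_cast le_top)).comp (v, s) contMDiffAt_fst).prodMk
        contMDiffAt_snd
    refine (ContMDiffAt.comp (v, s) h1 h2).congr_of_eventuallyEq ?_
    have : ∀ᶠ p : TangentBundle (𝓡 2) M × ℝ in 𝓝 (v, s), p.1.2 ≠ 0 :=
      continuous_fst.continuousAt.eventually
        ((isOpen_ne_zero F).mem_nhds (show v ∈ {w : TangentBundle (𝓡 2) M | w.2 ≠ 0} from hv))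
    filter_upwards [this] with p hp
    change F.flow p.1 p.2 = F.flow (F.unit p.1) p.2
    rw [flow_unit hp]
  have key : ∀ k : ℕ, ∀ t : ℝ, |t| ≤ k * (ε / 2) → ∀ v : TangentBundle (𝓡 2) M, v.2 ≠ 0 →
      ContMDiffAt ((𝓡 2).tangent.prod 𝓘(ℝ, ℝ)) (𝓡 2).tangent n (uncurry F.flow) (v, t) := by
    intro k
    induction k with
    | zero =>
      intro t ht v hv
      rw [Nat.cast_zero, zero_mul] at ht
      rw [abs_nonpos_iff.1 ht]
      exact base v hv 0 ⟨by linarith, hε⟩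
    | succ k ih =>
      intro t ht v hv
      have hk : (0 : ℝ) < k + 1 := by positivity
      -- One of `k + 1` equal steps: `|r| ≤ ε / 2` falls under the base case and `|t - r| ≤ k * (ε /
      -- 2)` under the induction hypothesis.
      set r := t / (k + 1)
      have hrt : t = r * (k + 1) := by simp only [r]; field_simp
      have hr : |r| ≤ ε / 2 := by
        rw [hrt, abs_mul, abs_of_pos hk] at ht
        push_cast at ht
        nlinarith
      have ht' : |t - r| ≤ k * (ε / 2) := by
        have : t - r = k * r := by rw [hrt]; ring
        rw [this, abs_mul, Nat.abs_cast]
        exact mul_le_mul_of_nonneg_left hr (Nat.cast_nonneg k)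
      have h1 := ih (t - r) ht' v hv
      have h2 := base (F.flow v (t - r)) (flow_snd_ne_zero hv _) r
        ⟨by linarith [(abs_le.1 hr).1], by linarith [(abs_le.1 hr).2]⟩
      have h3 : ContMDiffAt ((𝓡 2).tangent.prod 𝓘(ℝ, ℝ)) ((𝓡 2).tangent.prod 𝓘(ℝ, ℝ)) n
          (fun p : TangentBundle (𝓡 2) M × ℝ => (p.1, p.2 - r)) (v, t) :=
        contMDiffAt_fst.prodMk
          (((contDiff_id.sub contDiff_const).contMDiff.contMDiffAt).comp (v, t) contMDiffAt_snd)
      have h4 : ContMDiffAt ((𝓡 2).tangent.prod 𝓘(ℝ, ℝ)) ((𝓡 2).tangent.prod 𝓘(ℝ, ℝ)) n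
          (fun p : TangentBundle (𝓡 2) M × ℝ => (F.flow p.1 (p.2 - r), r)) (v, t) :=
        (ContMDiffAt.comp (g := uncurry F.flow) (v, t) h1 h3).prodMk contMDiffAt_const
      refine (ContMDiffAt.comp (g := uncurry F.flow) (v, t) h2 h4).congr_of_eventuallyEq ?_
      have : ∀ᶠ p : TangentBundle (𝓡 2) M × ℝ in 𝓝 (v, t), p.1.2 ≠ 0 :=
        continuous_fst.continuousAt.eventually
        ((isOpen_ne_zero F).mem_nhds (show v ∈ {w : TangentBundle (𝓡 2) M | w.2 ≠ 0} from hv))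
      filter_upwards [this] with p hp
      change F.flow p.1 p.2 = F.flow (F.flow p.1 (p.2 - r)) r
      rw [flow_add hp, add_sub_cancel]
  obtain ⟨k, hk⟩ := exists_nat_gt (|t| / (ε / 2))
  rw [div_lt_iff₀ (by positivity)] at hk
  exact key k t hk.le u hu

/-- The uniform time depends on `n`, but the flow does not, so all finite orders combine. -/
theorem contMDiffAt_flow (hu : u.2 ≠ 0) (t : ℝ) :
    ContMDiffAt ((𝓡 2).tangent.prod 𝓘(ℝ, ℝ)) (𝓡 2).tangent ∞ (uncurry F.flow) (u, t) := by
  refine contMDiffAt_infty.2 fun n => ?_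
  exact (contMDiffAt_flow_nat (n := n + 1) (by omega) hu t).of_le (by exact_mod_cast Nat.le_succ n)

theorem contMDiffAt_geo (hu : u.2 ≠ 0) (t : ℝ) :
    ContMDiffAt ((𝓡 2).tangent.prod 𝓘(ℝ, ℝ)) (𝓡 2) ∞ (uncurry F.geo) (u, t) :=
  (Bundle.contMDiff_proj (TangentSpace (𝓡 2)) (n := ∞)).contMDiffAt.comp (u, t) (contMDiffAt_flow hu t)

end Flow

end Finsler

end

noncomputable section

namespace Finsler

variable {M : Type*} [TopologicalSpace M] [ChartedSpace Plane M] [IsManifold (𝓡 2) ∞ M]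

/-! ### Variations through geodesics -/

section Variation

variable {F : Metric M} {Φ : ℝ → ℝ → M} {S : Set ℝ} {c : M} {s t : ℝ}

theorem sq_eq_one_of_chartDomain (hS : IsOpen S)
    (hΦ : ContMDiffOn 𝓘(ℝ, ℝ × ℝ) (𝓡 2) ∞ (uncurry Φ) (S ×ˢ univ))
    (hg : ∀ s ∈ S, F.IsGeodesicOn (Φ s) univ) (h : (s, t) ∈ chartDomain Φ (S ×ˢ univ) c) :
    F.sq c (chartMap Φ c s t) (dy (chartMap Φ c) s t 1) = 1 := by
  have h1 := (hg s h.1.1).unit_speed t (mem_univ t)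
  rw [lift_snd_chart (hS.prod isOpen_univ) hΦ h] at h1
  have h2 : F.norm (chartVector c (chartMap Φ c s t) (dy (chartMap Φ c) s t 1)) = 1 := h1
  unfold Metric.sq
  rw [h2, one_pow]

theorem dy_chartMap_ne_zero (hS : IsOpen S)
    (hΦ : ContMDiffOn 𝓘(ℝ, ℝ × ℝ) (𝓡 2) ∞ (uncurry Φ) (S ×ˢ univ))
    (hg : ∀ s ∈ S, F.IsGeodesicOn (Φ s) univ) (h : (s, t) ∈ chartDomain Φ (S ×ˢ univ) c) :
    dy (chartMap Φ c) s t 1 ≠ 0 := by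
  intro h0
  have h1 := sq_eq_one_of_chartDomain hS hΦ hg h
  rw [h0, (isFinslerSq F c).sq_zero (mem_chartTarget h)] at h1
  exact zero_ne_one h1

theorem dy_dy_chartMap_geodesic (hS : IsOpen S)
    (hΦ : ContMDiffOn 𝓘(ℝ, ℝ × ℝ) (𝓡 2) ∞ (uncurry Φ) (S ×ˢ univ))
    (hg : ∀ s ∈ S, F.IsGeodesicOn (Φ s) univ) (h : (s, t) ∈ chartDomain Φ (S ×ˢ univ) c) :
    dy (dy (chartMap Φ c)) s t 1 1
      = -((2 : ℝ) • sprayOf (F.sq c) (chartMap Φ c s t) (dy (chartMap Φ c) s t 1)) := by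
  rw [dy_dy_chartMap (isOpen_chartDomain (hS.prod isOpen_univ) hΦ) (contDiffOn_chartMap hΦ) h]
  exact eq_neg_of_add_eq_zero_left ((hg s h.1.1).equation t (mem_univ t) c h.2)

/-- The Gauss lemma. -/
theorem hasDerivAt_vertical (hS : IsOpen S)
    (hΦ : ContMDiffOn 𝓘(ℝ, ℝ × ℝ) (𝓡 2) ∞ (uncurry Φ) (S ×ˢ univ))
    (hg : ∀ s ∈ S, F.IsGeodesicOn (Φ s) univ) (hs : s ∈ S) (t : ℝ) :
    HasDerivAt (fun τ => F.vertical (lift (Φ s) τ) (lift (fun σ => Φ σ τ) s)) 0 t := by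
  have h : (s, t) ∈ chartDomain Φ (S ×ˢ univ) (Φ s t) := ⟨⟨hs, mem_univ t⟩, mem_extChartAt_source _⟩
  have h1 := firstVariation F (hS.prod isOpen_univ) hΦ h (dy_chartMap_ne_zero hS hΦ hg h)
  rw [dy_dy_chartMap_geodesic hS hΦ hg h, neg_add_cancel, map_zero, zero_apply, add_zero] at h1
  have h2 : (fun σ => F.norm (lift (Φ σ) t) ^ 2) =ᶠ[𝓝 s] fun _ => 1 := by
    filter_upwards [hS.mem_nhds hs] with σ hσ
    rw [show F.norm (lift (Φ σ) t) = 1 from (hg σ hσ).unit_speed t (mem_univ t), one_pow]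
  rwa [h2.deriv_eq, deriv_const] at h1

theorem vertical_of_snd_eq_zero {u w : TangentBundle (𝓡 2) M} (hw : w.2 = 0) :
    F.vertical u w = 0 := by
  have h1 : ∀ r : ℝ, u.2 + r • (show TangentSpace (𝓡 2) u.1 from w.2) = u.2 := fun r => by
    have h2 : (show TangentSpace (𝓡 2) u.1 from w.2) = (0 : Plane) := hw
    have h3 : r • (show TangentSpace (𝓡 2) u.1 from w.2) = r • (0 : Plane) := congrArg (r • ·) h2
    exact (congrArg (u.2 + ·) (h3.trans (smul_zero r))).trans (add_zero (u.2 : Plane))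
  unfold Metric.vertical
  simp only [h1, deriv_const]

/-- A Jacobi field that vanishes at time `0` stays normal to the geodesic, since by the Gauss lemma
its product with the velocity is constant. This is the normality demanded by the scalar Jacobi
equation. -/
theorem vertical_eq_zero (hS : IsOpen S)
    (hΦ : ContMDiffOn 𝓘(ℝ, ℝ × ℝ) (𝓡 2) ∞ (uncurry Φ) (S ×ˢ univ))
    (hg : ∀ s ∈ S, F.IsGeodesicOn (Φ s) univ) (hs : s ∈ S)
    (h0 : (lift (fun σ => Φ σ 0) s).2 = 0) (t : ℝ) :
    F.vertical (lift (Φ s) t) (lift (fun σ => Φ σ t) s) = 0 := by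
  have h1 := hasDerivAt_vertical hS hΦ hg hs
  have h2 := is_const_of_deriv_eq_zero (fun t => (h1 t).differentiableAt) (fun t => (h1 t).deriv) t 0
  exact h2.trans (vertical_of_snd_eq_zero h0)

theorem lift_fst_snd_eq_zero_iff (hS : IsOpen S)
    (hΦ : ContMDiffOn 𝓘(ℝ, ℝ × ℝ) (𝓡 2) ∞ (uncurry Φ) (S ×ˢ univ))
    (h : (s, t) ∈ chartDomain Φ (S ×ˢ univ) c) :
    (lift (fun σ => Φ σ t) s).2 = 0 ↔ dx (chartMap Φ c) s t 1 = 0 := by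
  rw [lift_fst_chart (hS.prod isOpen_univ) hΦ h]
  exact frame_eq_zero (mem_chartTarget h)

/-- The Jacobi equation in curvature one, for the square of the length of a normal field. -/
theorem exists_jacobi (hK : F.CurvatureOne) (hS : IsOpen S)
    (hΦ : ContMDiffOn 𝓘(ℝ, ℝ × ℝ) (𝓡 2) ∞ (uncurry Φ) (S ×ˢ univ))
    (hg : ∀ s ∈ S, F.IsGeodesicOn (Φ s) univ)
    (h0 : (lift (fun σ => Φ σ 0) s).2 = 0) (h : (s, t) ∈ chartDomain Φ (S ×ˢ univ) c) :
    ∃ q₁ q₂ : ℝ → ℝ, (∀ᶠ τ in 𝓝 t,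
      HasDerivAt (fun τ => F.verticalHess (lift (Φ s) τ) (lift (fun σ => Φ σ τ) s)) (q₁ τ) τ ∧
      HasDerivAt q₁ (q₂ τ) τ ∧ HasDerivAt q₂ (-4 * q₁ τ) τ) ∧
      ((lift (fun σ => Φ σ t) s).2 = 0 → q₁ t = 0 ∧
        q₂ t = 2 * dy (dy (F.sq c)) (chartMap Φ c s t) (dy (chartMap Φ c) s t 1)
          (dx (fun s t => dy (chartMap Φ c) s t 1) s t 1)
          (dx (fun s t => dy (chartMap Φ c) s t 1) s t 1)) := by
  have hF := isFinslerSq F c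
  have hW : IsOpen (S ×ˢ (univ : Set ℝ)) := hS.prod isOpen_univ
  set X := chartMap Φ c with hXdef
  set D := chartDomain Φ (S ×ˢ univ) c
  have hD : IsOpen D := isOpen_chartDomain hW hΦ
  have hX : ContDiffOn ℝ ∞ (uncurry X) D := contDiffOn_chartMap hΦ
  set Y : ℝ → ℝ → Plane := fun s t => dy X s t 1 with hYdef
  have hY : ContDiffOn ℝ ∞ (uncurry Y) D := (contDiffOn_dy hD hX).clm_apply contDiffOn_const
  have hev : ∀ᶠ τ in 𝓝 t, (s, τ) ∈ D :=
    ((Continuous.prodMk_right s).tendsto t).eventually (hD.mem_nhds h)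
  have hH : ∀ τ, (s, τ) ∈ D → X s τ ∈ (extChartAt (𝓡 2) c).target ∧ Y s τ ≠ 0 ∧
      HasDerivAt (fun τ => X s τ) (Y s τ) τ ∧
      HasDerivAt (fun τ => Y s τ) (-((2 : ℝ) • sprayOf (F.sq c) (X s τ) (Y s τ))) τ ∧
      HasDerivAt (fun τ => dx X s τ 1) (dx Y s τ 1) τ ∧
      HasDerivAt (fun τ => dx Y s τ 1) (-((2 : ℝ) • (dx (sprayOf (F.sq c)) (X s τ) (Y s τ) (dx X s τ 1)
        + dy (sprayOf (F.sq c)) (X s τ) (Y s τ) (dx Y s τ 1)))) τ ∧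
      F.sq c (X s τ) (Y s τ) = 1 ∧ dy (F.sq c) (X s τ) (Y s τ) (dx X s τ 1) = 0 := by
    intro τ hτ
    have hx := mem_chartTarget hτ
    have hy : Y s τ ≠ 0 := dy_chartMap_ne_zero hS hΦ hg hτ
    obtain ⟨d1, d2, d3, d4, d5⟩ := hasDerivAt_chart hD hX hτ
    obtain ⟨e1, e2, e3, e4, e5⟩ := hasDerivAt_chart hD hY hτ
    have f1 : dx (dy X) s τ 1 1 = dx Y s τ 1 := d5.unique e4
    refine ⟨hx, hy, d1, ?_, ?_, ?_, sq_eq_one_of_chartDomain hS hΦ hg hτ, ?_⟩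
    · rw [← dy_dy_chartMap_geodesic hS hΦ hg hτ]
      exact d2
    · rw [← f1]
      exact d3
    · have g1 := hasDerivAt_comp₂ (x := fun σ => X σ τ) (y := fun σ => Y σ τ)
        (differentiableAt_uncurry hF.isOpen_phase hF.contDiffOn_spray
        (IsFinslerSq.mem_phase hx hy)) d4 e4
      have g2 := (g1.const_smul (2 : ℝ)).neg
      have g3 : (fun σ => dy Y σ τ 1) =ᶠ[𝓝 s]
          fun σ => -((2 : ℝ) • sprayOf (F.sq c) (X σ τ) (Y σ τ)) := by
        filter_upwards [((Continuous.prodMk_left τ).tendsto s).eventually (hD.mem_nhds hτ)] with σ hσ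
        rw [← dy_dy_chartMap_geodesic hS hΦ hg hσ]
        exact ((hasDerivAt_chart hD hY hσ).1.unique (hasDerivAt_chart hD hX hσ).2.1)
      rw [← e5.unique (g2.congr_of_eventuallyEq g3)]
      exact e3
    · have := vertical_eq_zero hS hΦ hg hτ.1.1 h0 τ
      rwa [lift_snd_chart hW hΦ hτ, lift_fst_chart hW hΦ hτ, vertical_chartVector F hx hy] at this
  obtain ⟨q₁, q₂, hq, hq0⟩ := hF.jacobi (t := t) (x := fun τ => X s τ) (y := fun τ => Y s τ)
    (V := fun τ => dx X s τ 1) (W := fun τ => dx Y s τ 1)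
    (fun x hx y v hyv => hK c x hx y v hyv) (hev.mono hH)
  refine ⟨q₁, q₂, ?_, fun hz => hq0 ((lift_fst_snd_eq_zero_iff hS hΦ h).1 hz)⟩
  filter_upwards [hq, eventually_eventually_nhds.2 hev] with τ ⟨a, b, c'⟩ hτ
  refine ⟨a.congr_of_eventuallyEq ?_, b, c'⟩
  filter_upwards [hτ] with σ hσ
  rw [lift_snd_chart hW hΦ hσ, lift_fst_chart hW hΦ hσ,
    verticalHess_chartVector F (mem_chartTarget hσ) (dy_chartMap_ne_zero hS hΦ hg hσ)]

/-- A solution of `q''' = -4 q'` vanishing to second order is a multiple of `sin²`. -/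
theorem eq_mul_sin_sq {q : ℝ → ℝ} (h : ∀ t, ∃ q₁ q₂ : ℝ → ℝ, ∀ᶠ τ in 𝓝 t,
      HasDerivAt q (q₁ τ) τ ∧ HasDerivAt q₁ (q₂ τ) τ ∧ HasDerivAt q₂ (-4 * q₁ τ) τ)
    (h0 : q 0 = 0) (h1 : deriv q 0 = 0) {k : ℝ} (h2 : deriv (deriv q) 0 = 2 * k) (t : ℝ) :
    q t = k * Real.sin t ^ 2 := by
  have hd : ∀ t, HasDerivAt q (deriv q t) t ∧ HasDerivAt (deriv q) (deriv (deriv q) t) t ∧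
      HasDerivAt (deriv (deriv q)) (-4 * deriv q t) t := by
    intro t
    obtain ⟨q₁, q₂, hq⟩ := h t
    have e1 : ∀ᶠ τ in 𝓝 t, deriv q τ = q₁ τ := hq.mono fun τ hτ => hτ.1.deriv
    have e2 : ∀ᶠ τ in 𝓝 t, deriv (deriv q) τ = q₂ τ := by
      filter_upwards [hq, eventually_eventually_nhds.2 e1] with τ a b
      exact (Filter.EventuallyEq.deriv_eq b).trans a.2.1.deriv
    obtain ⟨a, b, c⟩ := hq.self_of_nhds
    rw [e2.self_of_nhds, e1.self_of_nhds]
    exact ⟨a, b.congr_of_eventuallyEq e1, c.congr_of_eventuallyEq e2⟩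
  -- A first integral, reducing the third order equation to an oscillator of frequency `2`.
  have hP : ∀ t, deriv (deriv q) t + 4 * q t = 2 * k := by
    intro t
    have := is_const_of_deriv_eq_zero (f := fun t => deriv (deriv q) t + 4 * q t)
      (fun t => ((hd t).2.2.add ((hd t).1.const_mul 4)).differentiableAt)
      (fun t => ((hd t).2.2.add ((hd t).1.const_mul 4)).deriv.trans (by ring)) t 0
    simpa [h0, h2] using this
  -- The energy of the difference between `q` and the candidate, a solution of the homogeneous
  -- oscillator equation. It is conserved and zero initially, so both squares vanish.
  set e := fun t => 4 * (q t - k * Real.sin t ^ 2) ^ 2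
    + (deriv q t - k * (2 * Real.sin t * Real.cos t)) ^ 2 with he
  have hs : ∀ t, HasDerivAt (fun t => k * Real.sin t ^ 2) (k * (2 * Real.sin t * Real.cos t)) t := by
    intro t
    have := ((Real.hasDerivAt_sin t).pow 2).const_mul k
    convert! this using 1
    push_cast
    ring
  have hs' : ∀ t, HasDerivAt (fun t => k * (2 * Real.sin t * Real.cos t))
      (2 * k - 4 * (k * Real.sin t ^ 2)) t := by
    intro t
    have := (((Real.hasDerivAt_sin t).const_mul 2).mul (Real.hasDerivAt_cos t)).const_mul k
    convert! this using 1
    have := Real.sin_sq_add_cos_sq t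
    linear_combination (2 * k) * (-this)
  have hed : ∀ t, HasDerivAt e 0 t := by
    intro t
    have a := (((hd t).1.sub (hs t)).pow 2).const_mul 4
    have b := ((hd t).2.1.sub (hs' t)).pow 2
    convert! a.add b using 1
    have := hP t
    simp only [Pi.sub_apply]
    push_cast
    linear_combination (-2 * (deriv q t - k * (2 * Real.sin t * Real.cos t))) * this
  have := is_const_of_deriv_eq_zero (fun t => (hed t).differentiableAt) (fun t => (hed t).deriv) t 0
  simp only [he, h0, h1, Real.sin_zero] at this
  have h3 : (q t - k * Real.sin t ^ 2) ^ 2 = 0 := by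
    have a1 := sq_nonneg (q t - k * Real.sin t ^ 2)
    have a2 := sq_nonneg (deriv q t - k * (2 * Real.sin t * Real.cos t))
    nlinarith
  exact sub_eq_zero.1 (pow_eq_zero_iff two_ne_zero |>.1 h3)

/-- The constant is half the second derivative of the squared length at time `0`, namely the square
of the initial derivative of the Jacobi field, read in the one chart at `c`. The left side needs no
chart, so the conclusion holds for all times. -/
theorem verticalHess_eq_mul_sin_sq (hK : F.CurvatureOne) (hS : IsOpen S)
    (hΦ : ContMDiffOn 𝓘(ℝ, ℝ × ℝ) (𝓡 2) ∞ (uncurry Φ) (S ×ˢ univ))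
    (hg : ∀ s ∈ S, F.IsGeodesicOn (Φ s) univ) (h0 : (lift (fun σ => Φ σ 0) s).2 = 0)
    (h : (s, 0) ∈ chartDomain Φ (S ×ˢ univ) c) (t : ℝ) :
    F.verticalHess (lift (Φ s) t) (lift (fun σ => Φ σ t) s)
      = dy (dy (F.sq c)) (chartMap Φ c s 0) (dy (chartMap Φ c) s 0 1)
          (dx (fun s t => dy (chartMap Φ c) s t 1) s 0 1)
          (dx (fun s t => dy (chartMap Φ c) s t 1) s 0 1) * Real.sin t ^ 2 := by
  obtain ⟨q₁, q₂, hq, hq0⟩ := exists_jacobi hK hS hΦ hg h0 h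
  obtain ⟨b1, b2⟩ := hq0 h0
  have e1 : ∀ᶠ τ in 𝓝 (0 : ℝ), deriv (fun τ => F.verticalHess (lift (Φ s) τ)
      (lift (fun σ => Φ σ τ) s)) τ = q₁ τ := hq.mono fun τ hτ => hτ.1.deriv
  refine eq_mul_sin_sq (q := fun t => F.verticalHess (lift (Φ s) t) (lift (fun σ => Φ σ t) s))
    (fun t => ?_) ?_ (e1.self_of_nhds.trans b1) ?_ t
  · obtain ⟨q₁, q₂, hq, -⟩ := exists_jacobi hK hS hΦ hg h0 (t := t) (c := Φ s t)
      ⟨⟨h.1.1, mem_univ t⟩, mem_extChartAt_source _⟩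
    exact ⟨q₁, q₂, hq⟩
  · have hW : IsOpen (S ×ˢ (univ : Set ℝ)) := hS.prod isOpen_univ
    change F.verticalHess (lift (Φ s) 0) (lift (fun σ => Φ σ 0) s) = 0
    have := (lift_fst_snd_eq_zero_iff hS hΦ h).1 h0
    rw [lift_snd_chart hW hΦ h, lift_fst_chart hW hΦ h,
      verticalHess_chartVector F (mem_chartTarget h) (dy_chartMap_ne_zero hS hΦ hg h), this,
      map_zero]
  · rw [Filter.EventuallyEq.deriv_eq e1, hq.self_of_nhds.2.1.deriv, b2]

theorem verticalHess_pos {u w : TangentBundle (𝓡 2) M} (h : w.1 = u.1) (hu : u.2 ≠ 0) (hw : w.2 ≠ 0) :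
    0 < F.verticalHess u w := by
  obtain ⟨p, y⟩ := u
  obtain ⟨p', v⟩ := w
  obtain rfl : p' = p := h
  exact F.strongly_convex p' y v hu hw

/-- Along its own ray `F²` is `(1 + r a)²`. Together with the Gauss lemma this makes a normal field
that is parallel to the velocity vanish. -/
theorem vertical_smul_self {u w : TangentBundle (𝓡 2) M} {a : ℝ} (hu : F.norm u = 1)
    (h : w = ⟨u.1, a • u.2⟩) : F.vertical u w = 2 * a := by
  subst h
  unfold Metric.vertical
  have h1 : (fun r : ℝ => F.norm ⟨u.1, u.2 + r • (a • u.2)⟩ ^ 2) =ᶠ[𝓝 0] fun r => (1 + r * a) ^ 2 := by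
    have : ∀ᶠ r : ℝ in 𝓝 0, 0 < 1 + r * a := by
      have hc : Continuous fun r : ℝ => 1 + r * a := by fun_prop
      exact hc.continuousAt.eventually (lt_mem_nhds (by norm_num))
    filter_upwards [this] with r hr
    have e : u.2 + r • (a • u.2) = (1 + r * a) • u.2 := by rw [add_smul, one_smul, smul_smul]
    rw [e, F.norm_smul _ _ _ hr.le, show F.norm ⟨u.1, u.2⟩ = 1 from hu, mul_one]
  refine h1.deriv_eq.trans ?_
  have h2 : HasDerivAt (fun r : ℝ => 1 + r * a) a 0 := by
    simpa using ((hasDerivAt_id (0 : ℝ)).mul_const a).const_add 1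
  have h3 := h2.pow 2
  exact (HasDerivAt.deriv h3).trans (by simp)

end Variation

end Finsler

end

noncomputable section

namespace Finsler

variable {M : Type*} [TopologicalSpace M] [ChartedSpace Plane M] [IsManifold (𝓡 2) ∞ M]

/-! ### The pencil of geodesics through a point -/

/-- The tangent vector at `p` with coordinates `e` in the preferred chart at `p`. -/
def pointVector (p : M) (e : Plane) : TangentBundle (𝓡 2) M :=
  chartVector p (extChartAt (𝓡 2) p p) e

variable {F : Metric M} {p : M} {e : Plane}

theorem pointVector_fst (p : M) (e : Plane) : (pointVector p e).1 = p := extChartAt_to_inv p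

theorem pointVector_snd_ne_zero (he : e ≠ 0) : (pointVector p e).2 ≠ 0 :=
  fun h => he ((frame_eq_zero (mem_extChartAt_target p)).1 h)

theorem tchart_pointVector (p : M) (e : Plane) :
    tchart p (pointVector p e) = (extChartAt (𝓡 2) p p, e) :=
  tchart_chartVector (mem_extChartAt_target p) e

theorem pointVector_tchart (u : TangentBundle (𝓡 2) M) : pointVector u.1 (tchart u.1 u).2 = u :=
  chartVector_tchart (mem_extChartAt_source u.1)

theorem contMDiff_pointVector (p : M) : ContMDiff 𝓘(ℝ, Plane) (𝓡 2).tangent ∞ (pointVector p) :=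
  fun e => ContMDiffAt.comp (g := fun z : Plane × Plane => chartVector p z.1 z.2)
    (f := fun e => (extChartAt (𝓡 2) p p, e)) e ((contMDiffOn_chartVector p).contMDiffAt
    (((isOpen_target p).prod isOpen_univ).mem_nhds ⟨mem_extChartAt_target p, mem_univ _⟩))
    (contDiff_const.prodMk contDiff_id).contMDiff.contMDiffAt

theorem unit_pointVector (F : Metric M) (p : M) (e : Plane) :
    F.unit (pointVector p e) = pointVector p ((F.norm (pointVector p e))⁻¹ • e) :=
  (chartVector_smul ..).symm

theorem contDiffAt_norm_pointVector (he : e ≠ 0) :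
    ContDiffAt ℝ ∞ (fun e => F.norm (pointVector p e)) e :=
  ((contMDiffAt_norm F (pointVector_snd_ne_zero he)).comp e
    (contMDiff_pointVector p e)).contDiffAt

theorem lift_const_snd (q : M) (t : ℝ) : (lift (fun _ => q) t).2 = 0 := by
  simp only [lift]
  rw [mfderiv_const]
  rfl

theorem isOpen_line_ne_zero (e₀ e₁ : Plane) : IsOpen {s : ℝ | e₀ + s • e₁ ≠ 0} :=
  isOpen_compl_singleton.preimage (by fun_prop : Continuous fun s : ℝ => e₀ + s • e₁)

section Pencil

variable [T2Space M] [CompactSpace M] {e₀ e₁ : Plane}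

/-- The geodesics issuing from `p` in the directions of a line. -/
def Metric.pencil (F : Metric M) (p : M) (e₀ e₁ : Plane) (s t : ℝ) : M :=
  F.geo (pointVector p (e₀ + s • e₁)) t

theorem contMDiffOn_pencil : ContMDiffOn 𝓘(ℝ, ℝ × ℝ) (𝓡 2) ∞ (uncurry (F.pencil p e₀ e₁))
    ({s : ℝ | e₀ + s • e₁ ≠ 0} ×ˢ univ) := by
  rintro ⟨s, t⟩ ⟨hs, -⟩
  refine ContMDiffAt.contMDiffWithinAt ?_
  have h1 := contMDiffAt_geo (F := F) (pointVector_snd_ne_zero (p := p) hs) t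
  have h2 : ContMDiffAt 𝓘(ℝ, ℝ × ℝ) ((𝓡 2).tangent.prod 𝓘(ℝ, ℝ)) ∞
      (fun z : ℝ × ℝ => (pointVector p (e₀ + z.1 • e₁), z.2)) (s, t) := by
    refine ContMDiffAt.prodMk ?_ contDiff_snd.contMDiff.contMDiffAt
    exact (contMDiff_pointVector p).contMDiffAt.comp (s, t)
      (contDiff_const.add (contDiff_fst.smul contDiff_const)).contMDiff.contMDiffAt
  exact ContMDiffAt.comp (g := uncurry F.geo) (s, t) h1 h2

theorem isGeodesicOn_pencil : ∀ s ∈ {s : ℝ | e₀ + s • e₁ ≠ 0},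
    F.IsGeodesicOn (F.pencil p e₀ e₁ s) univ :=
  fun _ hs => isGeodesicOn_geo (pointVector_snd_ne_zero hs)

theorem pencil_zero {s : ℝ} (hs : e₀ + s • e₁ ≠ 0) : F.pencil p e₀ e₁ s 0 = p :=
  (geo_zero (pointVector_snd_ne_zero hs)).trans (pointVector_fst ..)

theorem lift_pencil_zero {s : ℝ} (hs : e₀ + s • e₁ ≠ 0) :
    (lift (fun σ => F.pencil p e₀ e₁ σ 0) s).2 = 0 := by
  have h1 : (fun σ => F.pencil p e₀ e₁ σ 0) =ᶠ[𝓝 s] fun _ => p := by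
    filter_upwards [(isOpen_line_ne_zero e₀ e₁).mem_nhds hs] with σ hσ using pencil_zero hσ
  have h2 := lift_congr h1
  have h3 : ∀ {u v : TangentBundle (𝓡 2) M}, u = v → v.2 = 0 → u.2 = 0 := by
    rintro u v rfl h
    exact h
  exact h3 h2 (lift_const_snd p s)

theorem mem_chartDomain_pencil {s : ℝ} (hs : e₀ + s • e₁ ≠ 0) :
    (s, (0 : ℝ)) ∈ chartDomain (F.pencil p e₀ e₁) ({s : ℝ | e₀ + s • e₁ ≠ 0} ×ˢ univ) p :=
  ⟨⟨hs, mem_univ _⟩, by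
    simp only [mem_preimage, uncurry, pencil_zero hs]
    exact mem_extChartAt_source p⟩

theorem dy_pencil {s : ℝ} (hs : e₀ + s • e₁ ≠ 0) :
    dy (chartMap (F.pencil p e₀ e₁) p) s 0 1
      = (F.norm (pointVector p (e₀ + s • e₁)))⁻¹ • (e₀ + s • e₁) := by
  have h1 := (isGeodesicOn_pencil (F := F) (p := p) s hs).tchart_lift (c := p) isOpen_univ (mem_univ 0)
    (mem_chartDomain_pencil hs).2
  have h2 : lift (F.pencil p e₀ e₁ s) 0 = F.unit (pointVector p (e₀ + s • e₁)) :=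
    flow_zero (pointVector_snd_ne_zero hs)
  rw [h2, unit_pointVector, tchart_pointVector] at h1
  exact (congrArg Prod.snd h1).symm

/-- The initial velocity is `(e₀ + s e₁) / F`; differentiating the factor `1 / F` contributes along
`e₀`, and the coefficient of `e₁` is the nonzero number `1 / F(e₀)`. -/
theorem exists_dx_dy_pencil (he : e₀ ≠ 0) : ∃ a b : ℝ, b ≠ 0 ∧
    dx (fun s t => dy (chartMap (F.pencil p e₀ e₁) p) s t 1) 0 0 1 = a • e₀ + b • e₁ := by
  have he' : e₀ + (0 : ℝ) • e₁ ≠ 0 := by rwa [zero_smul, add_zero]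
  have hl : HasDerivAt (fun s : ℝ => e₀ + s • e₁) e₁ 0 := by
    simpa using ((hasDerivAt_id (0 : ℝ)).smul_const e₁).const_add e₀
  have hn : 0 < F.norm (pointVector p (e₀ + (0 : ℝ) • e₁)) :=
    norm_pos_of_snd F (pointVector_snd_ne_zero he')
  have h0 := ((contDiffAt_norm_pointVector (F := F) (p := p) he').differentiableAt
    (by norm_num)).hasFDerivAt.comp_hasDerivAt (0 : ℝ) hl
  obtain ⟨n', h1⟩ : ∃ n', HasDerivAt (fun s : ℝ => F.norm (pointVector p (e₀ + s • e₁))) n' 0 :=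
    ⟨_, h0⟩
  have h2 := (h1.fun_inv hn.ne').fun_smul hl
  have h3 : (fun s => dy (chartMap (F.pencil p e₀ e₁) p) s 0 1) =ᶠ[𝓝 0]
      fun s => (F.norm (pointVector p (e₀ + s • e₁)))⁻¹ • (e₀ + s • e₁) := by
    filter_upwards [(isOpen_line_ne_zero e₀ e₁).mem_nhds he'] with s hs using dy_pencil hs
  refine ⟨-n' / F.norm (pointVector p (e₀ + (0 : ℝ) • e₁)) ^ 2, _, inv_ne_zero hn.ne',
    (h3.deriv_eq.trans h2.deriv).trans ?_⟩
  rw [add_comm, zero_smul, add_zero]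

theorem dx_dy_pencil_ne_zero (he : LinearIndependent ℝ ![e₀, e₁]) :
    dx (fun s t => dy (chartMap (F.pencil p e₀ e₁) p) s t 1) 0 0 1 ≠ 0 := by
  have h0 : e₀ ≠ 0 := he.ne_zero 0
  obtain ⟨a, b, hb, h⟩ := exists_dx_dy_pencil (F := F) (p := p) (e₁ := e₁) h0
  rw [h]
  intro h1
  exact hb (LinearIndependent.pair_iff.1 he a b h1).2

theorem vertical_pencil (he : e₀ ≠ 0) (t : ℝ) :
    F.vertical (lift (F.pencil p e₀ e₁ 0) t) (lift (fun σ => F.pencil p e₀ e₁ σ t) 0) = 0 :=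
  vertical_eq_zero (isOpen_line_ne_zero e₀ e₁) contMDiffOn_pencil isGeodesicOn_pencil
    (show e₀ + (0 : ℝ) • e₁ ≠ 0 by rwa [zero_smul, add_zero])
    (lift_pencil_zero (by rwa [zero_smul, add_zero])) t

theorem verticalHess_pencil (hK : F.CurvatureOne) (he : e₀ ≠ 0) :
    ∃ k : ℝ, (LinearIndependent ℝ ![e₀, e₁] → 0 < k) ∧ ∀ t, F.verticalHess
      (lift (F.pencil p e₀ e₁ 0) t) (lift (fun σ => F.pencil p e₀ e₁ σ t) 0) = k * Real.sin t ^ 2 := by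
  have he' : e₀ + (0 : ℝ) • e₁ ≠ 0 := by rwa [zero_smul, add_zero]
  refine ⟨_, fun hli => ?_, verticalHess_eq_mul_sin_sq hK (isOpen_line_ne_zero e₀ e₁)
    contMDiffOn_pencil isGeodesicOn_pencil (lift_pencil_zero he') (mem_chartDomain_pencil he')⟩
  exact (isFinslerSq F p).convex _ (mem_chartTarget (mem_chartDomain_pencil he')) _ _
    (dy_chartMap_ne_zero (isOpen_line_ne_zero e₀ e₁) contMDiffOn_pencil isGeodesicOn_pencil
      (mem_chartDomain_pencil he')) (dx_dy_pencil_ne_zero hli)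

theorem lift_pencil_snd_ne_zero (he : e₀ ≠ 0) (t : ℝ) : (lift (F.pencil p e₀ e₁ 0) t).2 ≠ 0 :=
  unit_snd_ne_zero F ((isGeodesicOn_pencil (F := F) (p := p) (e₀ := e₀) (e₁ := e₁) 0
    (show e₀ + (0 : ℝ) • e₁ ≠ 0 by rwa [zero_smul, add_zero])).unit_speed t (mem_univ t))

theorem norm_lift_pencil (he : e₀ ≠ 0) (t : ℝ) : F.norm (lift (F.pencil p e₀ e₁ 0) t) = 1 :=
  (isGeodesicOn_pencil (F := F) (p := p) (e₀ := e₀) (e₁ := e₁) 0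
    (show e₀ + (0 : ℝ) • e₁ ≠ 0 by rwa [zero_smul, add_zero])).unit_speed t (mem_univ t)

theorem verticalHess_of_snd_eq_zero {u w : TangentBundle (𝓡 2) M} (hw : w.2 = 0) :
    F.verticalHess u w = 0 := by
  have h1 : ∀ r : ℝ, u.2 + r • (show TangentSpace (𝓡 2) u.1 from w.2) = u.2 := fun r => by
    have h2 : (show TangentSpace (𝓡 2) u.1 from w.2) = (0 : Plane) := hw
    have h3 : r • (show TangentSpace (𝓡 2) u.1 from w.2) = r • (0 : Plane) := congrArg (r • ·) h2
    exact (congrArg (u.2 + ·) (h3.trans (smul_zero r))).trans (add_zero (u.2 : Plane))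
  unfold Metric.verticalHess
  simp only [h1]
  rw [hasDerivAt_two]
  simp

/-- Conjugate points occur at the zeros of the sine. -/
theorem lift_pencil_eq_zero (hK : F.CurvatureOne) (he : e₀ ≠ 0) {t : ℝ} (ht : Real.sin t = 0) :
    (lift (fun σ => F.pencil p e₀ e₁ σ t) 0).2 = 0 := by
  obtain ⟨k, -, hk⟩ := verticalHess_pencil (p := p) (e₁ := e₁) hK he
  by_contra h
  have h1 := verticalHess_pos (F := F) (u := lift (F.pencil p e₀ e₁ 0) t)
    (w := lift (fun σ => F.pencil p e₀ e₁ σ t) 0) rfl (lift_pencil_snd_ne_zero he t) h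
  rw [hk t, ht] at h1
  simp at h1

/-- Away from the conjugate points, the variation field is transverse to the geodesic. -/
theorem lift_pencil_transverse (hK : F.CurvatureOne) (he : LinearIndependent ℝ ![e₀, e₁]) {t : ℝ}
    (ht : Real.sin t ≠ 0) (a : ℝ) :
    lift (fun σ => F.pencil p e₀ e₁ σ t) 0
      ≠ ⟨_, a • (lift (F.pencil p e₀ e₁ 0) t).2⟩ := by
  intro h
  have h0 : e₀ ≠ 0 := he.ne_zero 0
  obtain ⟨k, hk0, hk⟩ := verticalHess_pencil (p := p) (e₁ := e₁) hK h0
  have h1 := vertical_smul_self (norm_lift_pencil (F := F) (p := p) (e₁ := e₁) h0 t) h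
  rw [vertical_pencil h0 t] at h1
  -- A field parallel to the velocity has product `2 a` with it, while the Gauss lemma makes this
  -- product zero. The field would then vanish where `k sin²` is positive.
  have h2 : a = 0 := by linarith
  have h3 : (lift (fun σ => F.pencil p e₀ e₁ σ t) 0).2 = 0 := by
    rw [h, h2]
    exact zero_smul ℝ _
  have h4 := hk t
  rw [verticalHess_of_snd_eq_zero h3] at h4
  exact (mul_pos (hk0 he) (by positivity)).ne h4

/-! ### The conjugate point map -/

/-- The point at time `t` on a geodesic from `p`, independent of the geodesic if `sin t = 0`. -/
def Metric.conj (F : Metric M) (t : ℝ) (p : M) : M :=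
  F.geo (pointVector p (EuclideanSpace.single 0 1)) t

theorem single_ne_zero : (EuclideanSpace.single 0 1 : Plane) ≠ 0 := by simp

theorem contMDiffAt_geo_pointVector (he : e ≠ 0) (t : ℝ) :
    ContMDiffAt 𝓘(ℝ, Plane) (𝓡 2) ∞ (fun e => F.geo (pointVector p e) t) e := by
  have h1 := contMDiffAt_geo (F := F) (pointVector_snd_ne_zero (p := p) he) t
  exact ContMDiffAt.comp (g := uncurry F.geo) e h1
    ((contMDiff_pointVector p e).prodMk contMDiffAt_const)

/-- The derivative of `e ↦ F.geo (pointVector p e) t` in the direction `w` is the variation field of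
the pencil `e + s w`, which is zero when `sin t = 0`. A map with zero derivative on a ball is
constant. -/
theorem eventually_geo_pointVector_eq (hK : F.CurvatureOne) (he : e ≠ 0) {t : ℝ}
    (ht : Real.sin t = 0) :
    ∀ᶠ e' in 𝓝 e, F.geo (pointVector p e') t = F.geo (pointVector p e) t := by
  set g : Plane → M := fun e => F.geo (pointVector p e) t with hg
  set c := g e
  have hO : {e : Plane | e ≠ 0} ∩ g ⁻¹' (extChartAt (𝓡 2) c).source ∈ 𝓝 e :=
    Filter.inter_mem (isOpen_ne.mem_nhds he)
      ((contMDiffAt_geo_pointVector he t).continuousAt.preimage_mem_nhds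
        (extChartAt_source_mem_nhds c))
  obtain ⟨ρ, hρ, hsub⟩ := Metric.mem_nhds_iff.1 hO
  have hd : ∀ e' ∈ Metric.ball e ρ, DifferentiableAt ℝ (fun e => extChartAt (𝓡 2) c (g e)) e' := by
    intro e' he'
    obtain ⟨h1, h2⟩ := hsub he'
    have h3 : ContMDiffAt (𝓡 2) 𝓘(ℝ, Plane) ∞ (extChartAt (𝓡 2) c) (g e') :=
      contMDiffAt_extChartAt' (by rwa [← extChartAt_source (𝓡 2)])
    exact (h3.comp e' (contMDiffAt_geo_pointVector h1 t)).contDiffAt.differentiableAt (by norm_num)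
  have hz : ∀ e' ∈ Metric.ball e ρ, fderiv ℝ (fun e => extChartAt (𝓡 2) c (g e)) e' = 0 := by
    intro e' he'
    obtain ⟨h1, h2⟩ := hsub he'
    ext1 w
    have hl : HasDerivAt (fun s : ℝ => e' + s • w) w 0 := by
      simpa using ((hasDerivAt_id (0 : ℝ)).smul_const w).const_add e'
    have h3 := (hd e' he').hasFDerivAt
    rw [show e' = e' + (0 : ℝ) • w by simp] at h3
    have h4 := h3.comp_hasDerivAt (0 : ℝ) hl
    have h5 := lift_pencil_eq_zero (p := p) (e₁ := w) hK h1 ht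
    have hs : e' + (0 : ℝ) • w ≠ 0 := by rwa [zero_smul, add_zero]
    have hdom : ((0 : ℝ), t) ∈ chartDomain (F.pencil p e' w) ({s : ℝ | e' + s • w ≠ 0} ×ˢ univ) c := by
      refine ⟨⟨hs, mem_univ _⟩, ?_⟩
      simp only [mem_preimage, uncurry, Metric.pencil, zero_smul, add_zero]
      exact h2
    rw [lift_fst_snd_eq_zero_iff (isOpen_line_ne_zero e' w) contMDiffOn_pencil hdom] at h5
    have h6 := h4.deriv
    rw [zero_smul, add_zero] at h6
    rw [← h6, zero_apply, ← h5]
    rfl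
  filter_upwards [Metric.ball_mem_nhds e hρ] with e' he'
  have h1 : extChartAt (𝓡 2) c (g e') = extChartAt (𝓡 2) c (g e) :=
    Metric.isOpen_ball.is_const_of_fderiv_eq_zero (convex_ball e ρ).isPreconnected
      (fun x hx => (hd x hx).differentiableWithinAt) (fun x hx => hz x hx) he'
      (Metric.mem_ball_self hρ)
  exact (extChartAt (𝓡 2) c).injOn (hsub he').2 (hsub (Metric.mem_ball_self hρ)).2 h1

theorem isPreconnected_ne_zero : IsPreconnected ({0}ᶜ : Set Plane) := by
  refine (isConnected_compl_singleton_of_one_lt_rank ?_ (0 : Plane)).isPreconnected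
  rw [← Module.finrank_eq_rank, finrank_euclideanSpace_fin]
  norm_num

/-- The end point is locally constant in the direction, and the punctured plane is connected. -/
theorem geo_eq_conj (hK : F.CurvatureOne) {t : ℝ} (ht : Real.sin t = 0)
    {u : TangentBundle (𝓡 2) M} (hu : u.2 ≠ 0) : F.geo u t = F.conj t u.1 := by
  set g : Plane → M := fun e => F.geo (pointVector u.1 e) t with hg
  have hu' : (tchart u.1 u).2 ≠ 0 := snd_tchart_ne_zero (mem_extChartAt_source _) hu
  have h1 : g (tchart u.1 u).2 = F.geo u t := by simp only [hg, pointVector_tchart]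
  rw [← h1]
  have hloc : ∀ e ∈ ({0}ᶜ : Set Plane), ∀ᶠ e' in 𝓝[{0}ᶜ] e, g e = g e' := fun e he =>
    mem_nhdsWithin_of_mem_nhds ((eventually_geo_pointVector_eq hK he ht).mono fun _ h => h.symm)
  exact isPreconnected_ne_zero.induction₂ (fun a b => g a = g b) hloc
    (fun _ _ _ _ _ _ h h' => h.trans h') (fun _ _ _ _ h => h.symm) hu' single_ne_zero

/-- The definition of `conj` picks a direction from the preferred chart at each point, a choice that
need not vary continuously. Since the direction is irrelevant, a coordinate vector field of one
fixed chart may replace it locally. -/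
theorem contMDiff_conj (hK : F.CurvatureOne) {t : ℝ} (ht : Real.sin t = 0) :
    ContMDiff (𝓡 2) (𝓡 2) ∞ (F.conj t) := by
  intro p
  set e : Plane := EuclideanSpace.single 0 1
  have hx : ∀ {q}, q ∈ (extChartAt (𝓡 2) p).source →
      (chartVector p (extChartAt (𝓡 2) p q) e).2 ≠ 0 := fun hq h =>
    single_ne_zero ((frame_eq_zero ((extChartAt (𝓡 2) p).map_source hq)).1 h)
  have h1 : ContMDiffAt (𝓡 2) (𝓡 2).tangent ∞ (fun q => chartVector p (extChartAt (𝓡 2) p q) e) p := by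
    have h2 : ContMDiffAt (𝓡 2) 𝓘(ℝ, Plane × Plane) ∞ (fun q => (extChartAt (𝓡 2) p q, e)) p :=
      contMDiffAt_extChartAt.prodMk_space contMDiffAt_const
    exact ContMDiffAt.comp (g := fun z : Plane × Plane => chartVector p z.1 z.2) p
      ((contMDiffOn_chartVector p).contMDiffAt (((isOpen_target p).prod isOpen_univ).mem_nhds
        ⟨mem_extChartAt_target p, mem_univ _⟩)) h2
  have h3 := contMDiffAt_geo (F := F) (hx (mem_extChartAt_source p)) t
  refine (ContMDiffAt.comp (g := uncurry F.geo) p h3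
    (h1.prodMk contMDiffAt_const)).congr_of_eventuallyEq ?_
  filter_upwards [extChartAt_source_mem_nhds (I := 𝓡 2) p] with q hq
  change F.conj t q = F.geo (chartVector p (extChartAt (𝓡 2) p q) e) t
  rw [geo_eq_conj hK ht (hx hq)]
  congr 1
  exact ((extChartAt (𝓡 2) p).left_inv hq).symm

theorem conj_geo (hK : F.CurvatureOne) {t : ℝ} (ht : Real.sin t = 0) {u : TangentBundle (𝓡 2) M}
    (hu : u.2 ≠ 0) (s : ℝ) : F.conj t (F.geo u s) = F.geo u (t + s) := by
  rw [← geo_add hu, geo_eq_conj hK ht (flow_snd_ne_zero hu s), flow_fst]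

/-- `conj (-t) p` lies on a geodesic through `p`, at time `-t`, and `conj t` moves it along that
same geodesic back to `p`. Reversibility plays no part here. -/
theorem conj_conj_neg (hK : F.CurvatureOne) {t : ℝ} (ht : Real.sin t = 0) (p : M) :
    F.conj t (F.conj (-t) p) = p := by
  have h0 := pointVector_snd_ne_zero (p := p) single_ne_zero
  unfold Metric.conj
  rw [← Metric.conj]
  rw [conj_geo hK ht h0, add_neg_cancel, geo_zero h0, pointVector_fst]

/-- The conjugate point map as a diffeomorphism. -/
def conjDiffeomorph (hK : F.CurvatureOne) {t : ℝ} (ht : Real.sin t = 0) :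
    Diffeomorph (𝓡 2) (𝓡 2) M M ∞ where
  toFun := F.conj t
  invFun := F.conj (-t)
  left_inv p := by
    have h : Real.sin (-t) = 0 := by rw [Real.sin_neg, ht, neg_zero]
    have := conj_conj_neg hK h p
    rwa [neg_neg] at this
  right_inv p := conj_conj_neg hK ht p
  contMDiff_toFun := contMDiff_conj hK ht
  contMDiff_invFun := contMDiff_conj hK (by rw [Real.sin_neg, ht, neg_zero])

theorem lift_comp {f : M → M} {γ : ℝ → M} {t : ℝ} (hf : MDifferentiableAt (𝓡 2) (𝓡 2) f (γ t))
    (hγ : MDifferentiableAt 𝓘(ℝ, ℝ) (𝓡 2) γ t) :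
    lift (f ∘ γ) t = tangentMap (𝓡 2) (𝓡 2) f (lift γ t) := by
  unfold lift tangentMap
  rw [mfderiv_comp t hf hγ]
  rfl

/-- The map `conj t` shifts the parameter of every geodesic by `t`; differentiating this identity at
time `0` gives the time `t` flow. -/
theorem tangentMap_conj (hK : F.CurvatureOne) {t : ℝ} (ht : Real.sin t = 0)
    {u : TangentBundle (𝓡 2) M} (hu : F.norm u = 1) :
    tangentMap (𝓡 2) (𝓡 2) (F.conj t) u = F.flow u t := by
  have h0 := unit_snd_ne_zero F hu
  have h1 := lift_comp (f := F.conj t) (γ := F.geo u) (t := 0)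
    ((contMDiff_conj hK ht).mdifferentiable (by norm_num) _)
    ((isGeodesicOn_geo h0).mdifferentiableAt isOpen_univ (mem_univ 0))
  rw [show lift (F.geo u) 0 = F.flow u 0 from rfl, flow_zero h0, unit_of_norm_eq_one F hu] at h1
  rw [← h1]
  have h2 : F.conj t ∘ F.geo u = fun s => F.geo u (s + t) :=
    funext fun s => (conj_geo hK ht h0 s).trans (by rw [add_comm])
  rw [h2, lift_comp_add, zero_add]
  rfl

theorem norm_tangentMap_conj (hK : F.CurvatureOne) {t : ℝ} (ht : Real.sin t = 0)
    (u : TangentBundle (𝓡 2) M) : F.norm (tangentMap (𝓡 2) (𝓡 2) (F.conj t) u) = F.norm u := by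
  by_cases hu : u.2 = 0
  · rw [norm_eq_zero_of_snd F hu]
    refine norm_eq_zero_of_snd F ?_
    exact (congrArg (mfderiv (𝓡 2) (𝓡 2) (F.conj t) u.1) hu).trans (map_zero _)
  · have hn := norm_pos_of_snd F hu
    have h1 := tangentMap_conj hK ht (norm_unit F hu)
    have h2 : F.norm (tangentMap (𝓡 2) (𝓡 2) (F.conj t) (F.unit u)) = 1 := by
      rw [h1, norm_flow (unit_snd hu)]
    have h3 : tangentMap (𝓡 2) (𝓡 2) (F.conj t) (F.unit u)
        = ⟨_, (F.norm u)⁻¹ • (tangentMap (𝓡 2) (𝓡 2) (F.conj t) u).2⟩ :=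
      Bundle.TotalSpace.ext rfl
        (heq_of_eq (map_smul (mfderiv (𝓡 2) (𝓡 2) (F.conj t) u.1) (F.norm u)⁻¹ u.2))
    rw [h3, F.norm_smul _ _ _ (inv_nonneg.2 hn.le)] at h2
    rw [inv_mul_eq_one₀ hn.ne'] at h2
    exact h2.symm

end Pencil

end Finsler

end

noncomputable section

namespace Finsler

variable {M : Type*} [TopologicalSpace M] [ChartedSpace Plane M] [IsManifold (𝓡 2) ∞ M]

/-! ### Orientation -/

/-- The determinant of two vectors of the plane. -/
def det₂ (v w : Plane) : ℝ := v 0 * w 1 - v 1 * w 0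

theorem alternating_eq_det₂ (f : Plane [⋀^Fin 2]→ₗ[ℝ] ℝ) (v w : Plane) :
    f ![v, w] = f ![EuclideanSpace.single 0 1, EuclideanSpace.single 1 1] * det₂ v w := by
  have h := f.eq_smul_basis_det (EuclideanSpace.basisFun (Fin 2) ℝ).toBasis
  have h1 := congrArg (fun g : Plane [⋀^Fin 2]→ₗ[ℝ] ℝ => g ![v, w]) h
  simp only [AlternatingMap.smul_apply, smul_eq_mul, Module.Basis.det_apply, Matrix.det_fin_two] at h1
  rw [h1]
  congr 1
  · congr 1
    funext i
    fin_cases i <;> simp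
  · simp [Module.Basis.toMatrix_apply, det₂]
    ring

theorem det₂_ne_zero {v w : Plane} (hv : v ≠ 0) (h : ∀ a : ℝ, w ≠ a • v) : det₂ v w ≠ 0 := by
  intro h0
  unfold det₂ at h0
  by_cases h1 : v 0 = 0
  · have h2 : v 1 ≠ 0 := fun h2 => hv (by ext i; fin_cases i <;> simp [h1, h2])
    refine h (w 1 / v 1) ?_
    rw [h1] at h0
    have h3 : w 0 = 0 := by
      rcases mul_eq_zero.1 (show v 1 * w 0 = 0 by linarith) with h | h
      · exact absurd h h2
      · exact h
    ext i
    fin_cases i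
    · simp [h1, h3]
    · simp [h2]
  · refine h (w 0 / v 0) ?_
    ext i
    fin_cases i
    · simp [h1]
    · simp only [Fin.mk_one, PiLp.smul_apply, smul_eq_mul]
      field_simp
      linarith

theorem continuous_det₂ : Continuous fun z : Plane × Plane => det₂ z.1 z.2 := by
  unfold det₂
  fun_prop

theorem hasDerivAt_det₂ {y v : ℝ → Plane} {a b : Plane} {t : ℝ} (hy : HasDerivAt y a t)
    (hv : HasDerivAt v b t) (h0 : v t = 0) : HasDerivAt (fun t => det₂ (y t) (v t)) (det₂ (y t) b) t := by
  have hc : ∀ {z : ℝ → Plane} {c : Plane} (i : Fin 2), HasDerivAt z c t →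
      HasDerivAt (fun t => z t i) (c i) t := fun i hz =>
    (EuclideanSpace.proj i : Plane →L[ℝ] ℝ).hasFDerivAt.comp_hasDerivAt t hz
  have := ((hc 0 hy).fun_mul (hc 1 hv)).fun_sub ((hc 1 hy).fun_mul (hc 0 hv))
  unfold det₂
  convert! this using 1
  simp [h0]

namespace OrientationForm

variable (o : OrientationForm M)

/-- The orientation form on two tangent vectors with the same base point. -/
def pair (u w : TangentBundle (𝓡 2) M) : ℝ :=
  o.form u.1 ![u.2, (show TangentSpace (𝓡 2) u.1 from w.2)]

/-- The coefficient of the orientation form in the chart at `c`. -/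
def density (c : M) (x : Plane) : ℝ :=
  o.form (chartVector c x (EuclideanSpace.single 0 1)).1
    ![(chartVector c x (EuclideanSpace.single 0 1)).2,
      (chartVector c x (EuclideanSpace.single 1 1)).2]

theorem pair_chartVector (c : M) (x y v : Plane) :
    o.pair (chartVector c x y) (chartVector c x v) = o.density c x * det₂ y v := by
  have h : ∀ a b : Plane, o.form (chartVector c x a).1 ![(chartVector c x a).2, (chartVector c x b).2]
      = ((o.form ((extChartAt (𝓡 2) c).symm x)).compLinearMap (frame c x).toLinearMap) ![a, b] := by
    intro a b
    rw [AlternatingMap.compLinearMap_apply]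
    refine congrArg (o.form ((extChartAt (𝓡 2) c).symm x)) (funext fun i => ?_)
    fin_cases i <;> rfl
  unfold pair density
  refine (h y v).trans ((alternating_eq_det₂ _ y v).trans ?_)
  rw [← h]

theorem density_ne_zero {c : M} {x : Plane} (hx : x ∈ (extChartAt (𝓡 2) c).target) :
    o.density c x ≠ 0 := by
  intro h0
  refine o.form_ne_zero ((extChartAt (𝓡 2) c).symm x) ?_
  have hs : Surjective (frame c x).toLinearMap :=
    LinearMap.injective_iff_surjective (K := ℝ) (V := Plane)
      (f := (frame c x).toLinearMap) |>.1 (frame_injective hx)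
  ext v
  obtain ⟨a, ha⟩ := hs (v 0)
  obtain ⟨b, hb⟩ := hs (v 1)
  have h1 := o.pair_chartVector c x a b
  rw [h0, zero_mul] at h1
  have h2 : v = ![(chartVector c x a).2, (chartVector c x b).2] := by
    funext i
    fin_cases i
    · exact ha.symm
    · exact hb.symm
  rw [h2]
  exact h1

theorem continuousOn_density (c : M) : ContinuousOn (o.density c) (extChartAt (𝓡 2) c).target :=
  o.continuousOn_form c _ _

end OrientationForm

/-- A function with a simple zero changes sign. -/
theorem eventually_mul_neg {f : ℝ → ℝ} {a : ℝ} (hf : HasDerivAt f a 0) (h0 : f 0 = 0) (ha : a ≠ 0) :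
    ∀ᶠ t in 𝓝[>] (0 : ℝ), f t * f (-t) < 0 := by
  have h1 := hasDerivAt_iff_tendsto_slope.1 hf
  have h2 : Filter.Tendsto (fun t : ℝ => -t) (𝓝[>] 0) (𝓝[≠] 0) := by
    refine tendsto_nhdsWithin_iff.2 ⟨?_, ?_⟩
    · have : Filter.Tendsto (fun t : ℝ => -t) (𝓝 0) (𝓝 0) := by simpa using (continuous_neg (G := ℝ)).tendsto 0
      exact this.mono_left nhdsWithin_le_nhds
    · filter_upwards [self_mem_nhdsWithin] with t ht
      have : (0 : ℝ) < t := ht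
      simp [this.ne']
  have h3 : Filter.Tendsto (fun t : ℝ => t) (𝓝[>] 0) (𝓝[≠] (0 : ℝ)) :=
    Filter.tendsto_id.mono_right (nhdsWithin_mono _ fun t ht => (ne_of_gt ht : t ≠ 0))
  have h4 := (h1.comp h3).mul (h1.comp h2)
  have h5 := h4.eventually (lt_mem_nhds (mul_self_pos.2 ha))
  filter_upwards [h5, self_mem_nhdsWithin] with t ht ht0
  have ht0' : (0 : ℝ) < t := ht0
  simp only [comp_apply, slope_def_field, h0, sub_zero] at ht
  have h6 : f t / t * (f (-t) / -t) = -(f t * f (-t)) / t ^ 2 := by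
    field_simp
  rw [h6] at ht
  have := (div_pos_iff_of_pos_right (by positivity : (0 : ℝ) < t ^ 2)).1 ht
  linarith

section Pencil

variable [T2Space M] [CompactSpace M] {F : Metric M} {p : M} {e₀ e₁ : Plane} (o : OrientationForm M)

/-- The oriented area spanned by the velocity and the variation field of a pencil. -/
def area (o : OrientationForm M) (F : Metric M) (p : M) (e₀ e₁ : Plane) (t : ℝ) : ℝ :=
  o.pair (lift (F.pencil p e₀ e₁ 0) t) (lift (fun σ => F.pencil p e₀ e₁ σ t) 0)

theorem area_eq (he : e₀ ≠ 0) {c : M} {t : ℝ} (hc : F.pencil p e₀ e₁ 0 t ∈ (extChartAt (𝓡 2) c).source) :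
    area o F p e₀ e₁ t = o.density c (chartMap (F.pencil p e₀ e₁) c 0 t)
      * det₂ (dy (chartMap (F.pencil p e₀ e₁) c) 0 t 1) (dx (chartMap (F.pencil p e₀ e₁) c) 0 t 1) := by
  have hs : (0 : ℝ) ∈ {s : ℝ | e₀ + s • e₁ ≠ 0} := show e₀ + (0 : ℝ) • e₁ ≠ 0 by
    rwa [zero_smul, add_zero]
  have hW : IsOpen ({s : ℝ | e₀ + s • e₁ ≠ 0} ×ˢ (univ : Set ℝ)) :=
    (isOpen_line_ne_zero e₀ e₁).prod isOpen_univ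
  have hD : ((0 : ℝ), t) ∈ chartDomain (F.pencil p e₀ e₁) ({s : ℝ | e₀ + s • e₁ ≠ 0} ×ˢ univ) c :=
    ⟨⟨hs, mem_univ t⟩, hc⟩
  unfold area
  rw [lift_snd_chart hW contMDiffOn_pencil hD, lift_fst_chart hW contMDiffOn_pencil hD]
  exact o.pair_chartVector ..

theorem hasDerivAt_pencil_chart (he : e₀ ≠ 0) {c : M} {t : ℝ}
    (hc : F.pencil p e₀ e₁ 0 t ∈ (extChartAt (𝓡 2) c).source) :
    HasDerivAt (fun τ => chartMap (F.pencil p e₀ e₁) c 0 τ)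
      (dy (chartMap (F.pencil p e₀ e₁) c) 0 t 1) t ∧
    (∃ a, HasDerivAt (fun τ => dy (chartMap (F.pencil p e₀ e₁) c) 0 τ 1) a t) ∧
    HasDerivAt (fun τ => dx (chartMap (F.pencil p e₀ e₁) c) 0 τ 1)
      (dx (fun s t => dy (chartMap (F.pencil p e₀ e₁) c) s t 1) 0 t 1) t ∧
    ∀ᶠ τ in 𝓝 t, F.pencil p e₀ e₁ 0 τ ∈ (extChartAt (𝓡 2) c).source := by
  have hs : (0 : ℝ) ∈ {s : ℝ | e₀ + s • e₁ ≠ 0} := show e₀ + (0 : ℝ) • e₁ ≠ 0 by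
    rwa [zero_smul, add_zero]
  have hW : IsOpen ({s : ℝ | e₀ + s • e₁ ≠ 0} ×ˢ (univ : Set ℝ)) :=
    (isOpen_line_ne_zero e₀ e₁).prod isOpen_univ
  have hD : ((0 : ℝ), t) ∈ chartDomain (F.pencil p e₀ e₁) ({s : ℝ | e₀ + s • e₁ ≠ 0} ×ˢ univ) c :=
    ⟨⟨hs, mem_univ t⟩, hc⟩
  have hDo := isOpen_chartDomain (c := c) hW (contMDiffOn_pencil (F := F) (p := p) (e₀ := e₀) (e₁ := e₁))
  obtain ⟨d1, d2, d3, d4, d5⟩ := hasDerivAt_chart hDo (contDiffOn_chartMap contMDiffOn_pencil) hD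
  refine ⟨d1, ⟨_, d2⟩, ?_, ?_⟩
  · convert! d3 using 1
    exact d5.deriv
  · filter_upwards [((Continuous.prodMk_right (0 : ℝ)).tendsto t).eventually (hDo.mem_nhds hD)] with τ hτ
    exact hτ.2

theorem continuous_area (he : e₀ ≠ 0) : Continuous (area o F p e₀ e₁) := by
  refine continuous_iff_continuousAt.2 fun t => ?_
  set c := F.pencil p e₀ e₁ 0 t
  have hc : F.pencil p e₀ e₁ 0 t ∈ (extChartAt (𝓡 2) c).source := mem_extChartAt_source _
  obtain ⟨d1, ⟨a, d2⟩, d3, d4⟩ := hasDerivAt_pencil_chart he hc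
  have h1 : ContinuousAt (o.density c) (chartMap (F.pencil p e₀ e₁) c 0 t) :=
    (o.continuousOn_density c).continuousAt ((isOpen_target c).mem_nhds
      ((extChartAt (𝓡 2) c).map_source hc))
  have h2 := (ContinuousAt.comp (f := fun τ => chartMap (F.pencil p e₀ e₁) c 0 τ) h1 d1.continuousAt).mul
    (continuous_det₂.continuousAt.comp (d2.continuousAt.prodMk d3.continuousAt))
  refine h2.congr ?_
  filter_upwards [d4] with τ hτ
  exact (area_eq o he hτ).symm

theorem area_ne_zero (hK : F.CurvatureOne) (he : LinearIndependent ℝ ![e₀, e₁]) {t : ℝ}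
    (ht : Real.sin t ≠ 0) : area o F p e₀ e₁ t ≠ 0 := by
  have h0 : e₀ ≠ 0 := he.ne_zero 0
  have hs : (0 : ℝ) ∈ {s : ℝ | e₀ + s • e₁ ≠ 0} := show e₀ + (0 : ℝ) • e₁ ≠ 0 by
    rwa [zero_smul, add_zero]
  set c := F.pencil p e₀ e₁ 0 t
  have hc : F.pencil p e₀ e₁ 0 t ∈ (extChartAt (𝓡 2) c).source := mem_extChartAt_source _
  have hW : IsOpen ({s : ℝ | e₀ + s • e₁ ≠ 0} ×ˢ (univ : Set ℝ)) :=
    (isOpen_line_ne_zero e₀ e₁).prod isOpen_univ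
  have hD : ((0 : ℝ), t) ∈ chartDomain (F.pencil p e₀ e₁) ({s : ℝ | e₀ + s • e₁ ≠ 0} ×ˢ univ) c :=
    ⟨⟨hs, mem_univ t⟩, hc⟩
  rw [area_eq o h0 hc]
  refine mul_ne_zero (o.density_ne_zero (mem_chartTarget hD)) (det₂_ne_zero
    (dy_chartMap_ne_zero (isOpen_line_ne_zero e₀ e₁) contMDiffOn_pencil isGeodesicOn_pencil hD)
    fun a ha => lift_pencil_transverse (p := p) hK he ht a ?_)
  rw [lift_snd_chart hW contMDiffOn_pencil hD, lift_fst_chart hW contMDiffOn_pencil hD, ha,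
    chartVector_smul]

/-- The area changes sign at its simple zero `t = 0` and has no zero in `(-π, 0)` or `(0, π)`. The
orientation form is only continuous, so the derivative test is applied to the determinant factor
alone, the density keeping its sign near `p`. -/
theorem area_mul_neg (hK : F.CurvatureOne) (he : LinearIndependent ℝ ![e₀, e₁]) :
    area o F p e₀ e₁ (Real.pi / 2) * area o F p e₀ e₁ (-(Real.pi / 2)) < 0 := by
  have h0 : e₀ ≠ 0 := he.ne_zero 0
  have he' : e₀ + (0 : ℝ) • e₁ ≠ 0 := by rwa [zero_smul, add_zero]
  have hD := mem_chartDomain_pencil (F := F) (p := p) he'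
  have hc : F.pencil p e₀ e₁ 0 0 ∈ (extChartAt (𝓡 2) p).source := hD.2
  obtain ⟨d1, ⟨a, d2⟩, d3, d4⟩ := hasDerivAt_pencil_chart h0 hc
  have hx := mem_chartTarget hD
  have hz : dx (chartMap (F.pencil p e₀ e₁) p) 0 0 1 = 0 :=
    (lift_fst_snd_eq_zero_iff (isOpen_line_ne_zero e₀ e₁) contMDiffOn_pencil hD).1
      (lift_pencil_zero he')
  have h1 := hasDerivAt_det₂ d2 d3 hz
  have h2 : det₂ (dy (chartMap (F.pencil p e₀ e₁) p) 0 0 1)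
      (dx (fun s t => dy (chartMap (F.pencil p e₀ e₁) p) s t 1) 0 0 1) ≠ 0 := by
    obtain ⟨α, β, hβ, hW⟩ := exists_dx_dy_pencil (F := F) (p := p) (e₁ := e₁) h0
    rw [dy_pencil he', hW, zero_smul, add_zero]
    have hn : (F.norm (pointVector p e₀))⁻¹ ≠ 0 :=
      inv_ne_zero (norm_pos_of_snd F (pointVector_snd_ne_zero h0)).ne'
    refine det₂_ne_zero (smul_ne_zero hn h0) fun b hb => hβ ?_
    refine (LinearIndependent.pair_iff.1 he (α - b * (F.norm (pointVector p e₀))⁻¹) β ?_).2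
    rw [sub_smul, mul_smul, ← hb]
    abel
  have h3 := eventually_mul_neg h1 (by rw [hz]; simp [det₂]) h2
  have h4 : ContinuousAt (fun τ => o.density p (chartMap (F.pencil p e₀ e₁) p 0 τ)) 0 :=
    ContinuousAt.comp (f := fun τ => chartMap (F.pencil p e₀ e₁) p 0 τ)
      ((o.continuousOn_density p).continuousAt ((isOpen_target p).mem_nhds hx)) d1.continuousAt
  have hneg : Filter.Tendsto (fun t : ℝ => -t) (𝓝 0) (𝓝 0) := by
    simpa using (continuous_neg (G := ℝ)).tendsto 0
  have h5 : ∀ᶠ τ in 𝓝 (0 : ℝ), 0 < o.density p (chartMap (F.pencil p e₀ e₁) p 0 τ)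
      * o.density p (chartMap (F.pencil p e₀ e₁) p 0 (-τ)) :=
    (Filter.Tendsto.mul h4 (Filter.Tendsto.comp h4 hneg)).eventually
      (lt_mem_nhds (mul_self_pos.2 (o.density_ne_zero hx)))
  obtain ⟨τ, ⟨⟨⟨hτ3, hτ5⟩, hτ4⟩, hτ4'⟩, hτ0, hτπ⟩ := (((h3.and (nhdsWithin_le_nhds h5)).and
    (nhdsWithin_le_nhds d4)).and (nhdsWithin_le_nhds (hneg.eventually d4))).and
    (Ioo_mem_nhdsGT Real.pi_pos) |>.exists
  have h6 : area o F p e₀ e₁ τ * area o F p e₀ e₁ (-τ) < 0 := by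
    rw [area_eq o h0 hτ4, area_eq o h0 hτ4']
    nlinarith [mul_neg_of_pos_of_neg hτ5 hτ3]
  have hcont := continuous_area (F := F) (p := p) (e₁ := e₁) o h0
  -- Intermediate values: the area has constant sign on an interval where the sine does not vanish.
  -- This moves the sign change at `±τ` out to `±π/2`.
  have hsame : ∀ S : Set ℝ, S.OrdConnected → (∀ t ∈ S, Real.sin t ≠ 0) → ∀ a ∈ S, ∀ b ∈ S,
      0 < area o F p e₀ e₁ a * area o F p e₀ e₁ b := by
    intro S hS hS0 a ha b hb
    by_contra hab
    have hne := mul_ne_zero (area_ne_zero o (F := F) (p := p) hK he (hS0 a ha))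
      (area_ne_zero o (F := F) (p := p) hK he (hS0 b hb))
    have hlt := lt_of_le_of_ne (not_lt.1 hab) hne
    have hmem : (0 : ℝ) ∈ area o F p e₀ e₁ '' S := by
      have hconv := (hS.isPreconnected.image _ hcont.continuousOn).ordConnected
      rcases mul_neg_iff.1 hlt with ⟨x, y⟩ | ⟨x, y⟩
      · exact hconv.out (mem_image_of_mem _ hb) (mem_image_of_mem _ ha) ⟨y.le, x.le⟩
      · exact hconv.out (mem_image_of_mem _ ha) (mem_image_of_mem _ hb) ⟨x.le, y.le⟩
    obtain ⟨t, ht, ht0⟩ := hmem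
    exact area_ne_zero o hK he (hS0 t ht) ht0
  have hp := Real.pi_pos
  have s1 := hsame (Ioo 0 Real.pi) ordConnected_Ioo (fun t ht => (Real.sin_pos_of_mem_Ioo ht).ne')
    (Real.pi / 2) ⟨by linarith, by linarith⟩ τ ⟨hτ0, hτπ⟩
  have s2 := hsame (Ioo (-Real.pi) 0) ordConnected_Ioo
    (fun t ht => (Real.sin_neg_of_neg_of_neg_pi_lt ht.2 ht.1).ne)
    (-(Real.pi / 2)) ⟨by linarith, by linarith⟩ (-τ) ⟨by linarith, by linarith [show (0 : ℝ) < τ from hτ0]⟩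
  have s3 := mul_pos s1 s2
  nlinarith [s3, h6]

/-- The map commutes with every geodesic up to a shift by `π`, so it carries the frame of velocity
and Jacobi field at `-π/2` to the frame at `π/2`, and these have opposite orientations. -/
theorem reverses_conj (hK : F.CurvatureOne) : o.IsReversedBy (F.conj Real.pi) := by
  intro q v w hvw
  set α := F.conj Real.pi
  have hα : ContMDiff (𝓡 2) (𝓡 2) ∞ α := contMDiff_conj hK Real.sin_pi
  -- the form pulled back by `α`
  let f : Plane [⋀^Fin 2]→ₗ[ℝ] ℝ := o.form q
  let g : Plane [⋀^Fin 2]→ₗ[ℝ] ℝ :=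
    (o.form (α q)).compLinearMap (mfderiv (𝓡 2) (𝓡 2) α q).toLinearMap
  have hg : ∀ a b : TangentSpace (𝓡 2) q,
      o.form (α q) ![mfderiv (𝓡 2) (𝓡 2) α q a, mfderiv (𝓡 2) (𝓡 2) α q b] = g ![a, b] := by
    intro a b
    refine congrArg (o.form (α q)) (funext fun i => ?_)
    fin_cases i <;> rfl
  -- Alternating 2-forms on a plane are proportional, so one test frame decides the sign for all
  -- frames.
  suffices h : ∃ a b : Plane, f ![a, b] * g ![a, b] < 0 by
    obtain ⟨a, b, hab⟩ := h
    refine (hg v w).trans_lt ((alternating_eq_det₂ g v w).trans_lt ?_)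
    have hvw' : 0 < f ![EuclideanSpace.single 0 1, EuclideanSpace.single 1 1] * det₂ v w :=
      hvw.trans_eq (alternating_eq_det₂ f v w)
    rw [alternating_eq_det₂ f, alternating_eq_det₂ g] at hab
    set x := f ![EuclideanSpace.single 0 1, EuclideanSpace.single 1 1]
    set y := g ![EuclideanSpace.single 0 1, EuclideanSpace.single 1 1]
    have hxy : x * y < 0 := by
      by_contra hxy
      nlinarith [mul_nonneg (not_lt.1 hxy) (mul_self_nonneg (det₂ a b))]
    by_contra hc
    have h1 : 0 ≤ (x * det₂ v w) * (y * det₂ v w) := mul_nonneg hvw'.le (not_lt.1 hc)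
    have h2 : det₂ v w ≠ 0 := fun h => by rw [h] at hvw'; simp at hvw'
    nlinarith [mul_neg_of_neg_of_pos hxy (mul_self_pos.2 h2)]
  -- `q` lies on a geodesic, a quarter period before its initial point `p`
  set u₀ := pointVector q (EuclideanSpace.single 0 1)
  have hu₀ : u₀.2 ≠ 0 := pointVector_snd_ne_zero single_ne_zero
  set u := F.flow u₀ (Real.pi / 2)
  have hu : u.2 ≠ 0 := flow_snd_ne_zero hu₀ _
  set p := u.1
  set e₀ := (tchart p u).2
  have he₀ : e₀ ≠ 0 := snd_tchart_ne_zero (mem_extChartAt_source _) hu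
  have hpu : pointVector p e₀ = u := pointVector_tchart u
  obtain ⟨e₁, he₁⟩ : ∃ e₁ : Plane, LinearIndependent ℝ ![e₀, e₁] :=
    exists_linearIndependent_pair_of_one_lt_finrank (by simp) he₀
  have he' : e₀ + (0 : ℝ) • e₁ ≠ 0 := by rwa [zero_smul, add_zero]
  have hS := isOpen_line_ne_zero e₀ e₁
  have hW : IsOpen ({s : ℝ | e₀ + s • e₁ ≠ 0} ×ˢ (univ : Set ℝ)) := hS.prod isOpen_univ
  have hq : F.pencil p e₀ e₁ 0 (-(Real.pi / 2)) = q := by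
    unfold Metric.pencil
    rw [zero_smul, add_zero, hpu, geo_add hu₀, neg_add_cancel, geo_zero hu₀, pointVector_fst]
  have hsh : ∀ {s : ℝ}, e₀ + s • e₁ ≠ 0 → ∀ t,
      F.pencil p e₀ e₁ s (t + Real.pi) = α (F.pencil p e₀ e₁ s t) := by
    intro s hs t
    rw [add_comm]
    exact (conj_geo hK Real.sin_pi (pointVector_snd_ne_zero hs) t).symm
  set t₀ := -(Real.pi / 2) with ht₀
  have ht₁ : t₀ + Real.pi = Real.pi / 2 := by rw [ht₀]; ring
  have hm : ((0 : ℝ), t₀) ∈ {s : ℝ | e₀ + s • e₁ ≠ 0} ×ˢ (univ : Set ℝ) := ⟨he', mem_univ _⟩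
  have hΦ := contMDiffOn_pencil (F := F) (p := p) (e₀ := e₀) (e₁ := e₁)
  have l1 : lift (F.pencil p e₀ e₁ 0) (Real.pi / 2)
      = tangentMap (𝓡 2) (𝓡 2) α (lift (F.pencil p e₀ e₁ 0) t₀) := by
    rw [← lift_comp (hα.mdifferentiable (by norm_num) _) (mdifferentiableAt_slice_snd hW hΦ hm), ← ht₁,
      ← lift_comp_add]
    congr 1
    exact funext fun t => hsh he' t
  have l2 : lift (fun σ => F.pencil p e₀ e₁ σ (Real.pi / 2)) 0
      = tangentMap (𝓡 2) (𝓡 2) α (lift (fun σ => F.pencil p e₀ e₁ σ t₀) 0) := by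
    rw [← lift_comp (γ := fun σ => F.pencil p e₀ e₁ σ t₀) (hα.mdifferentiable (by norm_num) _)
      (mdifferentiableAt_slice_fst hW hΦ hm), ← ht₁]
    refine lift_congr ?_
    filter_upwards [hS.mem_nhds he'] with σ hσ using hsh hσ t₀
  have hneg := area_mul_neg (F := F) (p := p) o hK he₁
  unfold area at hneg
  rw [l1, l2] at hneg
  generalize hA : lift (F.pencil p e₀ e₁ 0) t₀ = A at hneg
  generalize hB : lift (fun σ => F.pencil p e₀ e₁ σ t₀) 0 = B at hneg
  have hA1 : A.1 = q := by rw [← hA]; exact hq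
  have hB1 : B.1 = q := by rw [← hB]; exact hq
  obtain ⟨A1, A2⟩ := A
  obtain ⟨B1, B2⟩ := B
  obtain rfl : A1 = q := hA1
  obtain rfl : B1 = A1 := hB1
  refine ⟨A2, B2, ?_⟩
  rw [mul_comm]
  convert! hneg using 2
  exact (hg A2 B2).symm

theorem isQuasiAntipodal_conj (hK : F.CurvatureOne) :
    F.IsQuasiAntipodal o (conjDiffeomorph hK Real.sin_pi) where
  isometry := norm_tangentMap_conj hK Real.sin_pi
  reverses := reverses_conj o hK
  flow u hu := by
    have h0 := unit_snd_ne_zero F hu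
    refine ⟨F.geo u, isGeodesicOn_geo h0, ?_, (tangentMap_conj hK Real.sin_pi hu).symm⟩
    exact (flow_zero h0).trans (unit_of_norm_eq_one F hu)

/-- The base point of `Ψ_π(u)` is the point at time `π` on the geodesic of `u`; one unit vector at
`p` suffices to determine `α p`. -/
theorem eq_conj_of_isQuasiAntipodal {α : Diffeomorph (𝓡 2) (𝓡 2) M M ∞}
    (h : F.IsQuasiAntipodal o α) (p : M) : α p = F.conj Real.pi p := by
  set e : Plane := EuclideanSpace.single 0 1
  have hu : (pointVector p e).2 ≠ 0 := pointVector_snd_ne_zero single_ne_zero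
  have h1 := norm_unit F hu
  obtain ⟨γ, hγ, hγ0, hγπ⟩ := h.flow _ h1
  have h2 := eq_geo hγ hu hγ0
  have h3 : γ Real.pi = α (F.unit (pointVector p e)).1 := congrArg Bundle.TotalSpace.proj hγπ
  have h4 : (F.unit (pointVector p e)).1 = p := pointVector_fst p e
  rw [h4, h2] at h3
  exact h3.symm

end Pencil

end Finsler

end

noncomputable section

namespace Finsler

variable {M : Type*} [TopologicalSpace M] [ChartedSpace Plane M] [IsManifold (𝓡 2) ∞ M]

/-! ### The exponential map -/

/-- A map into a surface whose expression in a chart has an injective derivative is a local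
homeomorphism. -/
theorem exists_openPartialHomeomorph {f : Plane → M} {c : M} {z : Plane} {f' : Plane →L[ℝ] Plane}
    (h : ContDiffAt ℝ 1 (fun z => extChartAt (𝓡 2) c (f z)) z)
    (hf' : HasFDerivAt (fun z => extChartAt (𝓡 2) c (f z)) f' z) (hinj : Injective f')
    (hc : ∀ᶠ z' in 𝓝 z, f z' ∈ (extChartAt (𝓡 2) c).source) :
    ∃ φ : OpenPartialHomeomorph Plane M, z ∈ φ.source ∧ EqOn f φ φ.source := by
  let A : Plane ≃L[ℝ] Plane :=
    (LinearEquiv.ofInjectiveEndo f'.toLinearMap hinj).toContinuousLinearEquiv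
  have hA : (A : Plane →L[ℝ] Plane) = f' := by
    ext1 v
    rfl
  rw [← hA] at hf'
  obtain ⟨O, hO, hOo, hzO⟩ := eventually_nhds_iff.1 hc
  let ψ := (h.toOpenPartialHomeomorph _ hf' one_ne_zero).restrOpen O hOo
  have hψ : ∀ x, ψ x = extChartAt (𝓡 2) c (f x) := fun x => rfl
  have hψs : ψ.source ⊆ O := by
    intro x hx
    simp only [ψ, OpenPartialHomeomorph.restrOpen_source] at hx
    exact hx.2
  have hzψ : z ∈ ψ.source := by
    simp only [ψ, OpenPartialHomeomorph.restrOpen_source]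
    exact ⟨h.mem_toOpenPartialHomeomorph_source hf' one_ne_zero, hzO⟩
  refine ⟨ψ.trans (chartAt Plane c).symm, ?_, ?_⟩
  · rw [OpenPartialHomeomorph.trans_source]
    refine ⟨hzψ, ?_⟩
    have := (extChartAt (𝓡 2) c).map_source (hO z hzO)
    rw [extChartAt_target] at this
    exact this.1
  · intro x hx
    rw [OpenPartialHomeomorph.trans_source] at hx
    exact ((extChartAt (𝓡 2) c).left_inv (hO x (hψs hx.1))).symm

section Norm

variable {F : Metric M} {p : M} {z : Plane}

theorem norm_pointVector_smul {r : ℝ} (hr : 0 ≤ r) (z : Plane) :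
    F.norm (pointVector p (r • z)) = r * F.norm (pointVector p z) := by
  unfold pointVector
  rw [chartVector_smul, F.norm_smul _ _ _ hr]

theorem norm_pointVector_pos (hz : z ≠ 0) : 0 < F.norm (pointVector p z) :=
  norm_pos_of_snd F (pointVector_snd_ne_zero hz)

theorem norm_pointVector_zero : F.norm (pointVector p 0) = 0 :=
  norm_eq_zero_of_snd F (map_zero (frame p _))

theorem continuous_norm_pointVector : Continuous fun z => F.norm (pointVector p z) :=
  F.continuous_norm.comp (contMDiff_pointVector p).continuous

end Norm

section Exp

variable [T2Space M] [CompactSpace M] {F : Metric M} {p : M} {z : Plane}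

theorem geo_pointVector_smul {r : ℝ} (hr : 0 < r) (hz : z ≠ 0) :
    F.geo (pointVector p (r • z)) = F.geo (pointVector p z) := by
  have h1 : F.unit (pointVector p (r • z)) = F.unit (pointVector p z) := by
    rw [unit_pointVector, unit_pointVector, norm_pointVector_smul hr.le, smul_smul, mul_inv,
      mul_assoc, mul_comm _ r, ← mul_assoc, inv_mul_cancel₀ hr.ne', one_mul]
  rw [← geo_unit (F := F) (pointVector_snd_ne_zero (smul_ne_zero hr.ne' hz)), h1,
    geo_unit (pointVector_snd_ne_zero hz)]

open Classical in
/-- The exponential map at `p`, in the coordinates of the preferred chart at `p`. -/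
def Metric.expMap (F : Metric M) (p : M) (z : Plane) : M :=
  if z = 0 then p else F.geo (pointVector p z) (F.norm (pointVector p z))

theorem expMap_zero : F.expMap p 0 = p := if_pos rfl

theorem expMap_of_ne_zero (hz : z ≠ 0) :
    F.expMap p z = F.geo (pointVector p z) (F.norm (pointVector p z)) := if_neg hz

theorem expMap_smul {t : ℝ} (ht : 0 ≤ t) (hz : F.norm (pointVector p z) = 1) :
    F.expMap p (t • z) = F.geo (pointVector p z) t := by
  have hz0 : z ≠ 0 := by
    rintro rfl
    rw [norm_pointVector_zero] at hz
    exact zero_ne_one hz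
  rcases ht.eq_or_lt with rfl | ht
  · rw [zero_smul, expMap_zero, geo_zero (pointVector_snd_ne_zero hz0), pointVector_fst]
  · rw [expMap_of_ne_zero (smul_ne_zero ht.ne' hz0), geo_pointVector_smul ht hz0,
      norm_pointVector_smul ht.le, hz, mul_one]

theorem contMDiffAt_expMap (hz : z ≠ 0) : ContMDiffAt 𝓘(ℝ, Plane) (𝓡 2) ∞ (F.expMap p) z := by
  have h1 := contMDiffAt_geo (F := F) (pointVector_snd_ne_zero (p := p) hz)
    (F.norm (pointVector p z))
  refine (ContMDiffAt.comp (g := uncurry F.geo) z h1 ((contMDiff_pointVector p z).prodMk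
    (contDiffAt_norm_pointVector hz).contMDiffAt)).congr_of_eventuallyEq ?_
  filter_upwards [isOpen_ne.mem_nhds hz] with y hy using expMap_of_ne_zero hy

/-- The differential on `w` is `J + n' γ'`, where `J` is the variation field of the pencil `z + s w`
and `n'` the derivative of `F` along it. If `w` is independent of `z`, then `J` is transverse to
`γ'` away from conjugate times and the sum is nonzero. If `w = a z`, then `J = 0` and `n' = a t`, so
the kernel is trivial. -/
theorem exists_openPartialHomeomorph_expMap_of_ne_zero (hK : F.CurvatureOne) (hz : z ≠ 0)
    (hs : Real.sin (F.norm (pointVector p z)) ≠ 0) :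
    ∃ φ : OpenPartialHomeomorph Plane M, z ∈ φ.source ∧ EqOn (F.expMap p) φ φ.source := by
  set c := F.expMap p z with hc
  set t := F.norm (pointVector p z) with ht
  have hct : c = F.geo (pointVector p z) t := expMap_of_ne_zero hz
  have hsm := contMDiffAt_expMap (F := F) (p := p) hz
  have hev : ∀ᶠ z' in 𝓝 z, F.expMap p z' ∈ (extChartAt (𝓡 2) c).source :=
    hsm.continuousAt.eventually (extChartAt_source_mem_nhds c)
  have h1 : ContDiffAt ℝ ∞ (fun z => extChartAt (𝓡 2) c (F.expMap p z)) z :=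
    (ContMDiffAt.comp z (contMDiffAt_extChartAt (I := 𝓡 2) (x := c)) hsm).contDiffAt
  have hd := (h1.differentiableAt (by norm_num)).hasFDerivAt
  refine exists_openPartialHomeomorph (h1.of_le (by norm_cast)) hd ?_ hev
  rw [injective_iff_map_eq_zero]
  intro w hw
  have hz' : z + (0 : ℝ) • w ≠ 0 := by rwa [zero_smul, add_zero]
  set S := {s : ℝ | z + s • w ≠ 0}
  have hS : IsOpen S := isOpen_line_ne_zero z w
  have hW : IsOpen (S ×ˢ (univ : Set ℝ)) := hS.prod isOpen_univ
  have hΦ := contMDiffOn_pencil (F := F) (p := p) (e₀ := z) (e₁ := w)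
  have hdom : ((0 : ℝ), t) ∈ chartDomain (F.pencil p z w) (S ×ˢ univ) c := by
    refine ⟨⟨hz', mem_univ _⟩, ?_⟩
    simp only [mem_preimage, uncurry, Metric.pencil, zero_smul, add_zero]
    rw [← hct]
    exact mem_extChartAt_source c
  have hl : HasDerivAt (fun s : ℝ => z + s • w) w 0 := by
    simpa using ((hasDerivAt_id (0 : ℝ)).smul_const w).const_add z
  have hn := (contDiffAt_norm_pointVector (F := F) (p := p) hz).differentiableAt
    (by norm_num) |>.hasFDerivAt
  rw [show z = z + (0 : ℝ) • w by simp] at hn hd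
  have hn1 := hn.comp_hasDerivAt (0 : ℝ) hl
  have hd1 := hd.comp_hasDerivAt (0 : ℝ) hl
  rw [show z + (0 : ℝ) • w = z by simp] at hn1 hd1
  rw [hw] at hd1
  obtain ⟨n', hn2⟩ : ∃ n', HasDerivAt (fun s : ℝ => F.norm (pointVector p (z + s • w))) n' 0 :=
    ⟨_, hn1⟩
  have hX := differentiableAt_uncurry (isOpen_chartDomain hW hΦ) (contDiffOn_chartMap (c := c) hΦ) hdom
  have ht0 : (fun s : ℝ => F.norm (pointVector p (z + s • w))) 0 = t := by simp [ht]
  have h2 := hasDerivAt_comp₂ (G := chartMap (F.pencil p z w) c) (x := fun s : ℝ => s)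
    (y := fun s : ℝ => F.norm (pointVector p (z + s • w))) (t := 0)
    (by simp only [ht0]; exact hX) (hasDerivAt_id (0 : ℝ)) hn2
  simp only [ht0] at h2
  have h3 : (fun s : ℝ => chartMap (F.pencil p z w) c s (F.norm (pointVector p (z + s • w))))
      =ᶠ[𝓝 0] (fun z => extChartAt (𝓡 2) c (F.expMap p z)) ∘ fun s : ℝ => z + s • w := by
    filter_upwards [hS.mem_nhds hz'] with s hs
    simp only [chartMap, Metric.pencil, comp_apply]
    rw [expMap_of_ne_zero hs]
  have h4 := (h2.congr_of_eventuallyEq h3.symm).unique hd1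
  have h5 : dy (chartMap (F.pencil p z w) c) 0 t n' = n' • dy (chartMap (F.pencil p z w) c) 0 t 1 := by
    rw [← map_smul, smul_eq_mul, mul_one]
  rw [h5] at h4
  have h6 := dy_chartMap_ne_zero hS hΦ isGeodesicOn_pencil hdom
  by_cases hli : LinearIndependent ℝ ![z, w]
  · exfalso
    refine lift_pencil_transverse (F := F) (p := p) hK hli hs (-n') ?_
    rw [lift_snd_chart hW hΦ hdom, lift_fst_chart hW hΦ hdom, eq_neg_of_add_eq_zero_left h4,
      ← neg_smul, chartVector_smul]
  · rw [LinearIndependent.pair_iff' hz] at hli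
    push Not at hli
    obtain ⟨a, rfl⟩ := hli
    have hpos : ∀ᶠ s : ℝ in 𝓝 0, 0 < 1 + s * a := by
      have hcont : Continuous fun s : ℝ => 1 + s * a := by fun_prop
      exact hcont.continuousAt.eventually (lt_mem_nhds (by norm_num))
    have hline : ∀ s : ℝ, z + s • a • z = (1 + s * a) • z := fun s => by
      rw [add_smul, one_smul, smul_smul]
    have h7 : dx (chartMap (F.pencil p z (a • z)) c) 0 t 1 = 0 := by
      have : (fun s => chartMap (F.pencil p z (a • z)) c s t) =ᶠ[𝓝 0]
          fun _ => extChartAt (𝓡 2) c (F.geo (pointVector p z) t) := by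
        filter_upwards [hpos] with s hs
        simp only [chartMap, Metric.pencil]
        rw [hline, geo_pointVector_smul hs hz]
      exact this.deriv_eq.trans (deriv_const _ _)
    rw [h7, zero_add, smul_eq_zero, or_iff_left h6] at h4
    have h8 : HasDerivAt (fun s : ℝ => (1 + s * a) * t) (a * t) 0 := by
      simpa using (((hasDerivAt_id (0 : ℝ)).mul_const a).const_add 1).mul_const t
    have h9 : (fun s : ℝ => F.norm (pointVector p (z + s • a • z))) =ᶠ[𝓝 0]
        fun s => (1 + s * a) * t := by
      filter_upwards [hpos] with s hs
      rw [hline, norm_pointVector_smul hs.le]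
    have h10 := (h8.congr_of_eventuallyEq h9).unique hn2
    rw [h4] at h10
    rcases mul_eq_zero.1 h10 with h | h
    · rw [h, zero_smul]
    · exact absurd h (norm_pointVector_pos hz).ne'

end Exp

end Finsler

end

noncomputable section

namespace Finsler

variable {M : Type*} [TopologicalSpace M] [ChartedSpace Plane M] [IsManifold (𝓡 2) ∞ M]

/-! ### The exponential map at the pole -/

section Pole

variable [T2Space M] [CompactSpace M] {F : Metric M} {p : M}

theorem field_zero {c : M} {x : Plane} (hx : x ∈ (extChartAt (𝓡 2) c).target) :
    IsFinslerSq.field (F.sq c) (x, 0) = 0 := by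
  simp [IsFinslerSq.field, (isFinslerSq F c).spray_zero hx]

/-- Near the pole the exponential map is given by the flow of the geodesic field in a chart. -/
theorem exists_flow_expMap (F : Metric M) (p : M) : ∃ φ : (Plane × Plane) × ℝ → Plane × Plane,
    ∃ ε > 0, ∃ A ∈ 𝓝 (0 : Plane),
    (∀ t ∈ Ioo (-ε) ε, ContDiffAt ℝ 1 φ ((extChartAt (𝓡 2) p p, 0), t)) ∧
    ∀ y ∈ A, ∀ t ∈ Ioo (-ε) ε,
      (φ ((extChartAt (𝓡 2) p p, y), t)).1 ∈ (extChartAt (𝓡 2) p).target ∧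
      φ ((extChartAt (𝓡 2) p p, y), 0) = (extChartAt (𝓡 2) p p, y) ∧
      HasDerivAt (fun t => (φ ((extChartAt (𝓡 2) p p, y), t)).1)
        (φ ((extChartAt (𝓡 2) p p, y), t)).2 t ∧
      (0 ≤ t → F.expMap p (t • y)
        = (extChartAt (𝓡 2) p).symm (φ ((extChartAt (𝓡 2) p p, y), t)).1) := by
  have hF := isFinslerSq F p
  set x₀ := extChartAt (𝓡 2) p p
  have hx₀ : x₀ ∈ (extChartAt (𝓡 2) p).target := mem_extChartAt_target p
  set X := IsFinslerSq.field (F.sq p)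
  set U := (extChartAt (𝓡 2) p).target ×ˢ (univ : Set Plane)
  have hU : IsOpen U := (isOpen_target p).prod isOpen_univ
  have hz₀ : (x₀, (0 : Plane)) ∈ U := ⟨hx₀, mem_univ _⟩
  obtain ⟨φ, hφ, hφ'⟩ := exists_contDiffAt_flow_of_contDiffOn (n := 1) le_rfl hU
    hF.contDiffOn_one_field hz₀
  obtain ⟨K, N, hN, hL⟩ := (hF.contDiffOn_one_field.contDiffAt (hU.mem_nhds hz₀)).exists_lipschitzOnWith
  have h0 : φ ((x₀, 0), 0) = (x₀, 0) := hφ'.self_of_nhds.2.1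
  have hNev : ∀ᶠ q in 𝓝 ((x₀, (0 : Plane)), (0 : ℝ)), φ q ∈ N :=
    hφ.continuousAt.eventually (by rw [h0]; exact hN)
  have hφn : ∀ᶠ q in 𝓝 ((x₀, (0 : Plane)), (0 : ℝ)), ContDiffAt ℝ 1 φ q := hφ.eventually (by simp)
  obtain ⟨A, hA, B, hB, hAB⟩ := mem_nhds_prod_iff.1 ((hφn.and hφ').and hNev)
  obtain ⟨ε, hε, hεB⟩ := Metric.mem_nhds_iff.1 hB
  rw [Real.ball_eq_Ioo, zero_sub, zero_add] at hεB
  have H : ∀ z ∈ A, ∀ s ∈ Ioo (-ε) ε, (ContDiffAt ℝ 1 φ (z, s) ∧ φ (z, s) ∈ U ∧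
      φ (z, 0) = z ∧ HasDerivAt (fun s => φ (z, s)) (X (φ (z, s))) s) ∧ φ (z, s) ∈ N :=
    fun z hz s hs => hAB (mk_mem_prod hz (hεB hs))
  have hε0 : (0 : ℝ) ∈ Ioo (-ε) ε := ⟨by linarith, hε⟩
  have hzA : (x₀, (0 : Plane)) ∈ A := mem_of_mem_nhds hA
  -- a solution that meets the zero section is constant
  have hconst : ∀ z ∈ A, ∀ w : Plane × Plane, w ∈ N → w ∈ U → w.2 = 0 → ∀ t₁ ∈ Ioo (-ε) ε,
      φ (z, t₁) = w → ∀ t ∈ Ioo (-ε) ε, φ (z, t) = w := by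
    intro z hz w hwN hwU hw t₁ ht₁ h1 t ht
    have hXw : X w = 0 := by
      obtain ⟨a, b⟩ := w
      obtain rfl : b = 0 := hw
      exact field_zero hwU.1
    exact ODE_solution_unique_of_mem_Ioo (v := fun _ => X) (s := fun _ => N) (K := K)
      (f := fun t => φ (z, t)) (g := fun _ => w) (fun _ _ => hL) ht₁
      (fun s hs => ⟨(H z hz s hs).1.2.2.2, (H z hz s hs).2⟩)
      (fun s _ => ⟨by simpa only [hXw] using hasDerivAt_const s w, hwN⟩) h1 ht
  refine ⟨φ, ε, hε, (fun y => (x₀, y)) ⁻¹' A, (Continuous.prodMk_right x₀).continuousAt.preimage_mem_nhds hA,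
    fun t ht => (H _ hzA t ht).1.1, fun y hy t ht => ⟨(H _ hy t ht).1.2.1.1, (H _ hy t ht).1.2.2.1, ?_, ?_⟩⟩
  · have := (H _ hy t ht).1.2.2.2
    exact (hasFDerivAt_fst (p := φ ((x₀, y), t))).comp_hasDerivAt t this
  intro ht0
  by_cases hy0 : y = 0
  · subst hy0
    rw [smul_zero, expMap_zero, hconst _ hzA (x₀, 0) (mem_of_mem_nhds hN) hz₀ rfl 0 hε0
      (H _ hzA 0 hε0).1.2.2.1 t ht]
    exact (extChartAt_to_inv p).symm
  have hne : ∀ s ∈ Ioo (-ε) ε, (φ ((x₀, y), s)).2 ≠ 0 := by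
    intro s hs hs0
    have h1 := hconst _ hy (φ ((x₀, y), s)) (H _ hy s hs).2 (H _ hy s hs).1.2.1 hs0 s hs rfl 0 hε0
    rw [(H _ hy 0 hε0).1.2.2.1] at h1
    rw [← h1] at hs0
    exact hy0 hs0
  have hu := pointVector_snd_ne_zero (p := p) hy0
  set n := F.norm (pointVector p y) with hn
  have hn0 : 0 < n := norm_pointVector_pos hy0
  have hnt : ∀ {s : ℝ}, s ∈ Ioo (-(n * ε)) (n * ε) → n⁻¹ * s ∈ Ioo (-ε) ε := by
    intro s hs
    have e : n * (n⁻¹ * s) = s := by field_simp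
    constructor
    · by_contra h
      nlinarith [hs.1, mul_le_mul_of_nonneg_left (not_lt.1 h) hn0.le]
    · by_contra h
      nlinarith [hs.2, mul_le_mul_of_nonneg_left (not_lt.1 h) hn0.le]
  have hm0 : (0 : ℝ) ∈ Ioo (-(n * ε)) (n * ε) := ⟨by nlinarith, by positivity⟩
  -- Reparametrisation to unit speed: by homogeneity of the spray, dividing time and velocity by `n`
  -- again gives an integral curve, now with unit initial vector.
  let ζ : ℝ → Plane × Plane := fun s =>
    ((φ ((x₀, y), n⁻¹ * s)).1, n⁻¹ • (φ ((x₀, y), n⁻¹ * s)).2)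
  have hζ0 : ζ 0 = (x₀, n⁻¹ • y) := by
    simp only [ζ, mul_zero]
    rw [(H _ hy 0 hε0).1.2.2.1]
  have hg := isGeodesicOn_of_chart (F := F) (c := p) (z := ζ) isOpen_Ioo ordConnected_Ioo
    (fun s hs => by
      have hs' := hnt hs
      have hx := (H _ hy _ hs').1.2.1.1
      refine ⟨⟨hx, smul_ne_zero (inv_ne_zero hn0.ne') (hne _ hs')⟩, ?_⟩
      have h1 := (H _ hy _ hs').1.2.2.2
      have h2 : HasDerivAt (fun s : ℝ => n⁻¹ * s) n⁻¹ s := by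
        simpa using (hasDerivAt_id s).const_mul n⁻¹
      have h3 : HasDerivAt (fun s => φ ((x₀, y), n⁻¹ * s)) (n⁻¹ • X (φ ((x₀, y), n⁻¹ * s))) s :=
        h1.scomp s h2
      have h4 := (hasFDerivAt_fst (𝕜 := ℝ) (p := φ ((x₀, y), n⁻¹ * s))).comp_hasDerivAt s h3
      have h5 := (hasFDerivAt_snd (𝕜 := ℝ) (p := φ ((x₀, y), n⁻¹ * s))).comp_hasDerivAt s h3
      convert! h4.prodMk (h5.const_smul n⁻¹) using 1
      refine Prod.ext rfl ?_
      simp only [ζ, X, IsFinslerSq.field]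
      rw [hF.spray_smul hx (hne _ hs') (inv_pos.2 hn0)]
      simp only [ContinuousLinearMap.coe_snd', Prod.smul_snd, smul_neg, smul_smul]
      congr 2
      ring) hm0 (by
      rw [hζ0]
      change F.norm (chartVector p x₀ (n⁻¹ • y)) ^ 2 = 1
      have : F.norm (chartVector p x₀ (n⁻¹ • y)) = n⁻¹ * n :=
        norm_pointVector_smul (F := F) (p := p) (inv_nonneg.2 hn0.le) y
      rw [this, inv_mul_cancel₀ hn0.ne', one_pow])
  have hlift : lift (fun t => (extChartAt (𝓡 2) p).symm (ζ t).1) 0 = F.unit (pointVector p y) := by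
    rw [hg.2 0 hm0, hζ0, unit_pointVector]
    rfl
  have hgeo := eqOn_geo isOpen_Ioo ordConnected_Ioo hg.1 hm0 hu hlift
  rcases ht0.eq_or_lt with rfl | ht0
  · rw [zero_smul, expMap_zero, (H _ hy 0 hε0).1.2.2.1]
    exact (extChartAt_to_inv p).symm
  have hmt : n * t ∈ Ioo (-(n * ε)) (n * ε) := ⟨by nlinarith [ht.1], by nlinarith [ht.2]⟩
  have h1 : (extChartAt (𝓡 2) p).symm (ζ (n * t)).1 = F.geo (pointVector p y) (n * t) :=
    congrArg Bundle.TotalSpace.proj (hgeo (n * t) hmt)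
  rw [expMap_of_ne_zero (smul_ne_zero ht0.ne' hy0), geo_pointVector_smul ht0 hy0,
    norm_pointVector_smul ht0.le, mul_comm, ← h1]
  simp only [ζ]
  rw [inv_mul_cancel_left₀ hn0.ne']

/-- Near the origin `exp w` is the `C¹` flow of `w / τ` at the fixed time `τ`, and its differential
at `0` is the identity. -/
theorem exists_openPartialHomeomorph_expMap_zero (F : Metric M) (p : M) :
    ∃ φ : OpenPartialHomeomorph Plane M, 0 ∈ φ.source ∧ EqOn (F.expMap p) φ φ.source := by
  obtain ⟨φ, ε, hε, A, hA, hφ, H⟩ := exists_flow_expMap F p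
  set x₀ := extChartAt (𝓡 2) p p
  set τ := ε / 2
  have hτ : 0 < τ := by positivity
  have hτm : τ ∈ Ioo (-ε) ε := ⟨by linarith, by simp only [τ]; linarith⟩
  have hA' : ∀ᶠ w in 𝓝 (0 : Plane), τ⁻¹ • w ∈ A := by
    have hc : Continuous fun w : Plane => τ⁻¹ • w := by fun_prop
    exact hc.continuousAt.eventually (by simpa using hA)
  have hexp : ∀ w, τ⁻¹ • w ∈ A → F.expMap p w
      = (extChartAt (𝓡 2) p).symm (φ ((x₀, τ⁻¹ • w), τ)).1 := by
    intro w hw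
    rw [← (H _ hw τ hτm).2.2.2 hτ.le, smul_inv_smul₀ hτ.ne']
  have hsrc : ∀ᶠ w in 𝓝 (0 : Plane), F.expMap p w ∈ (extChartAt (𝓡 2) p).source := by
    filter_upwards [hA'] with w hw
    rw [hexp w hw]
    exact (extChartAt (𝓡 2) p).map_target (H _ hw τ hτm).1
  have hG : (fun w => extChartAt (𝓡 2) p (F.expMap p w)) =ᶠ[𝓝 0]
      fun w => (φ ((x₀, τ⁻¹ • w), τ)).1 := by
    filter_upwards [hA'] with w hw
    rw [hexp w hw]
    exact (extChartAt (𝓡 2) p).right_inv (H _ hw τ hτm).1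
  have hGd : ContDiffAt ℝ 1 (fun w : Plane => (φ ((x₀, τ⁻¹ • w), τ)).1) 0 := by
    refine contDiff_fst.contDiffAt.comp (0 : Plane) ?_
    refine ContDiffAt.comp (g := φ) (f := fun w : Plane => ((x₀, τ⁻¹ • w), τ)) (0 : Plane) ?_ (by fun_prop)
    simp only [smul_zero]
    exact hφ τ hτm
  have hC : ContDiffAt ℝ 1 (fun w => extChartAt (𝓡 2) p (F.expMap p w)) 0 :=
    hGd.congr_of_eventuallyEq hG
  have hD := (hC.differentiableAt one_ne_zero).hasFDerivAt
  refine exists_openPartialHomeomorph hC hD ?_ hsrc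
  set D := fderiv ℝ (fun w => extChartAt (𝓡 2) p (F.expMap p w)) 0
  have hDA : ∀ w ∈ A, D w = w := by
    intro w hw
    have hl : HasDerivAt (fun s : ℝ => s • w) w 0 := by
      simpa using (hasDerivAt_id (0 : ℝ)).smul_const w
    rw [show (0 : Plane) = (0 : ℝ) • w by simp] at hD
    -- One-sided derivatives are compared, because `F` need not be symmetric and the flow describes
    -- `exp (s w)` only for `s ≥ 0`.
    have h1 := (hD.comp_hasDerivAt (0 : ℝ) hl).hasDerivWithinAt (s := Ici 0)
    have h0 : (0 : ℝ) ∈ Ioo (-ε) ε := ⟨by linarith, hε⟩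
    have h2 := (H w hw 0 h0).2.2.1.hasDerivWithinAt (s := Ici 0)
    rw [(H w hw 0 h0).2.1] at h2
    refine (uniqueDiffOn_Ici (0 : ℝ) 0 self_mem_Ici).eq_deriv _ h1 (h2.congr_of_eventuallyEq_of_mem ?_
      self_mem_Ici)
    filter_upwards [self_mem_nhdsWithin, mem_nhdsWithin_of_mem_nhds (isOpen_Ioo.mem_nhds h0)] with s hs hs'
    simp only [comp_apply]
    rw [(H w hw s hs').2.2.2 hs]
    exact (extChartAt (𝓡 2) p).right_inv (H w hw s hs').1
  rw [injective_iff_map_eq_zero]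
  intro w hw
  have hsmall : ∀ᶠ r : ℝ in 𝓝[>] 0, r • w ∈ A := by
    have hc : Continuous fun r : ℝ => r • w := by fun_prop
    exact nhdsWithin_le_nhds (hc.continuousAt.eventually (by simpa using hA))
  obtain ⟨r, hr, hr0⟩ := (hsmall.and self_mem_nhdsWithin).exists
  have h1 := hDA _ hr
  rw [map_smul, hw, smul_zero] at h1
  exact (smul_eq_zero.1 h1.symm).resolve_left (ne_of_gt hr0)

theorem continuous_expMap : Continuous (F.expMap p) := by
  refine continuous_iff_continuousAt.2 fun z => ?_
  by_cases hz : z = 0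
  · subst hz
    obtain ⟨φ, h0, hφ⟩ := exists_openPartialHomeomorph_expMap_zero F p
    exact (φ.continuousAt h0).congr (Filter.eventuallyEq_of_mem (φ.open_source.mem_nhds h0) hφ.symm)
  · exact (contMDiffAt_expMap hz).continuousAt

/-- The exponential map is a local homeomorphism on the ball of radius `π`. -/
theorem exists_openPartialHomeomorph_expMap (hK : F.CurvatureOne) {z : Plane}
    (hz : F.norm (pointVector p z) < Real.pi) :
    ∃ φ : OpenPartialHomeomorph Plane M, z ∈ φ.source ∧ EqOn (F.expMap p) φ φ.source := by
  by_cases h : z = 0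
  · subst h
    exact exists_openPartialHomeomorph_expMap_zero F p
  · exact exists_openPartialHomeomorph_expMap_of_ne_zero hK h
      (Real.sin_pos_of_mem_Ioo ⟨norm_pointVector_pos h, hz⟩).ne'

end Pole

end Finsler

end

noncomputable section

namespace Finsler

/-! ### Branched coverings of simply connected spaces -/

/-- A map from a compact space that is a local homeomorphism over the complement of a point is
injective there, if that complement is simply connected and its preimage is connected. -/
theorem injOn_of_isLocalHomeomorphOn {E X : Type*} [TopologicalSpace E] [TopologicalSpace X]
    [T2Space E] [T2Space X] [CompactSpace E] {f : E → X} (hf : Continuous f) {s : Set X}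
    (hl : IsLocalHomeomorphOn f (f ⁻¹' s)) (hc : IsPreconnected (f ⁻¹' s))
    [SimplyConnectedSpace s] [LocallyPathConnectedSpace s] : InjOn f (f ⁻¹' s) := by
  have cov := (IsCoveringMapOn.of_isLocalHomeomorphOn hf hl).isCoveringMap_restrictPreimage
  have : PreconnectedSpace (f ⁻¹' s) := isPreconnected_iff_preconnectedSpace.1 hc
  intro a ha b hb hab
  set P := s.restrictPreimage f
  -- Simple connectedness of the base lifts the identity to a section through `a`. The section
  -- followed after the projection agrees with the identity at `a`, hence on the connected total
  -- space, so the projection is injective.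
  obtain ⟨g, ⟨hg0, hg⟩, -⟩ := cov.existsUnique_continuousMap_lifts (ContinuousMap.id s) (P ⟨a, ha⟩)
    ⟨a, ha⟩ rfl
  have h1 : g ∘ P = id := by
    refine cov.eq_of_comp_eq (g.continuous.comp cov.continuous) continuous_id ?_ ⟨a, ha⟩ hg0
    funext x
    exact congrFun hg (P x)
  have h2 : P ⟨a, ha⟩ = P ⟨b, hb⟩ := Subtype.ext hab
  have h3 := congrFun h1 ⟨a, ha⟩
  have h4 := congrFun h1 ⟨b, hb⟩
  simp only [comp_apply, id] at h3 h4
  rw [h2, h4] at h3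
  exact (congrArg Subtype.val h3).symm

section Sphere

variable {M : Type*} [TopologicalSpace M]

/-- The complement of a point in a sphere is a plane. -/
theorem nonempty_homeomorph_compl_singleton
    (φ : M ≃ₜ Metric.sphere (0 : EuclideanSpace ℝ (Fin 3)) 1) (q : M) :
    Nonempty (({q}ᶜ : Set M) ≃ₜ Plane) := by
  have : Fact (Module.finrank ℝ (EuclideanSpace ℝ (Fin 3)) = 2 + 1) := ⟨by simp⟩
  let ψ := φ.toOpenPartialHomeomorph.trans (stereographic' 2 (φ q))
  have hs : ψ.source = {q}ᶜ := by
    ext x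
    simp [ψ]
  have ht : ψ.target = univ := by
    ext x
    simp [ψ]
  exact ⟨(Homeomorph.setCongr hs.symm).trans (ψ.toHomeomorphSourceTarget.trans
    ((Homeomorph.setCongr ht).trans (Homeomorph.Set.univ _)))⟩

theorem simplyConnectedSpace_compl_singleton
    (φ : M ≃ₜ Metric.sphere (0 : EuclideanSpace ℝ (Fin 3)) 1) (q : M) :
    SimplyConnectedSpace ({q}ᶜ : Set M) ∧ LocallyPathConnectedSpace ({q}ᶜ : Set M) := by
  obtain ⟨e⟩ := nonempty_homeomorph_compl_singleton φ q
  have := e.contractibleSpace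
  exact ⟨inferInstance, e.isOpenEmbedding.locallyPathConnectedSpace⟩

end Sphere

end Finsler

end

noncomputable section

namespace Finsler

variable {M : Type*} [TopologicalSpace M] [ChartedSpace Plane M] [IsManifold (𝓡 2) ∞ M]

/-! ### Injectivity of the exponential map -/

section Ball

variable {F : Metric M} {p : M}

theorem isCompact_normBall (F : Metric M) (p : M) (R : ℝ) :
    IsCompact {z | F.norm (pointVector p z) ≤ R} := by
  have hc := continuous_norm_pointVector (F := F) (p := p)
  obtain ⟨w, hw, hmin⟩ := (isCompact_sphere (0 : Plane) 1).exists_isMinOn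
    (NormedSpace.sphere_nonempty.2 zero_le_one) hc.continuousOn
  have hw0 : w ≠ 0 := by
    rintro rfl
    simp at hw
  set m := F.norm (pointVector p w)
  have hm : 0 < m := norm_pointVector_pos hw0
  refine (isCompact_closedBall (0 : Plane) (R / m)).of_isClosed_subset
    (isClosed_le hc continuous_const) fun z hz => ?_
  rw [mem_closedBall_zero_iff, le_div_iff₀ hm]
  by_cases h : z = 0
  · subst h
    have hz' : F.norm (pointVector p 0) ≤ R := hz
    rw [norm_pointVector_zero] at hz'
    simpa using hz'
  · have hn : 0 < ‖z‖ := norm_pos_iff.2 h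
    have h1 : m ≤ F.norm (pointVector p (‖z‖⁻¹ • z)) := hmin (mem_sphere_zero_iff_norm.2 (by
      rw [norm_smul, norm_inv, norm_norm, inv_mul_cancel₀ hn.ne']))
    rw [norm_pointVector_smul (inv_nonneg.2 hn.le)] at h1
    have h2 := mul_le_mul_of_nonneg_left h1 hn.le
    rw [mul_inv_cancel_left₀ hn.ne'] at h2
    exact h2.trans hz

theorem norm_pointVector_nonneg (z : Plane) : 0 ≤ F.norm (pointVector p z) := by
  by_cases h : z = 0
  · rw [h, norm_pointVector_zero]
  · exact (norm_pointVector_pos h).le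

/-- The plane as an open ball. -/
def ballMap (F : Metric M) (p : M) (R : ℝ) (w : Plane) : Plane :=
  (R / (1 + F.norm (pointVector p w))) • w

theorem norm_ballMap {R : ℝ} (hR : 0 < R) (w : Plane) :
    F.norm (pointVector p (ballMap F p R w))
      = R / (1 + F.norm (pointVector p w)) * F.norm (pointVector p w) :=
  norm_pointVector_smul (div_nonneg hR.le (add_nonneg zero_le_one (norm_pointVector_nonneg w))) w

theorem sub_norm_ballMap {R : ℝ} (hR : 0 < R) (w : Plane) :
    R - F.norm (pointVector p (ballMap F p R w)) = R / (1 + F.norm (pointVector p w)) := by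
  rw [norm_ballMap hR]
  have := norm_pointVector_nonneg (F := F) (p := p) w
  field_simp
  ring

theorem norm_ballMap_lt {R : ℝ} (hR : 0 < R) (w : Plane) :
    F.norm (pointVector p (ballMap F p R w)) < R := by
  have h1 := sub_norm_ballMap (F := F) (p := p) hR w
  have h2 : 0 < R / (1 + F.norm (pointVector p w)) :=
    div_pos hR (by linarith [norm_pointVector_nonneg (F := F) (p := p) w])
  linarith

theorem ballMap_injective {R : ℝ} (hR : 0 < R) : Injective (ballMap F p R) := by
  have h : LeftInverse (fun z => (R - F.norm (pointVector p z))⁻¹ • z) (ballMap F p R) := by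
    intro w
    simp only
    rw [sub_norm_ballMap hR, ballMap, inv_smul_smul₀]
    exact (div_pos hR (by linarith [norm_pointVector_nonneg (F := F) (p := p) w])).ne'
  exact h.injective

theorem exists_ballMap {R : ℝ} (hR : 0 < R) {z : Plane} (hz : F.norm (pointVector p z) < R) :
    ∃ w, ballMap F p R w = z := by
  have h1 : 0 < R - F.norm (pointVector p z) := sub_pos.2 hz
  refine ⟨(R - F.norm (pointVector p z))⁻¹ • z, ?_⟩
  unfold ballMap
  rw [norm_pointVector_smul (inv_nonneg.2 h1.le), smul_smul]
  have h2 : R / (1 + (R - F.norm (pointVector p z))⁻¹ * F.norm (pointVector p z))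
      * (R - F.norm (pointVector p z))⁻¹ = 1 := by
    have h3 : 1 + (R - F.norm (pointVector p z))⁻¹ * F.norm (pointVector p z)
        = R * (R - F.norm (pointVector p z))⁻¹ := by
      field_simp
      ring
    rw [h3]
    field_simp
  rw [h2, one_smul]

theorem continuous_ballMap {R : ℝ} : Continuous (ballMap F p R) := by
  have hc := continuous_norm_pointVector (F := F) (p := p)
  refine (continuous_const.div (continuous_const.add hc) fun w => ?_).smul continuous_id
  exact (add_pos_of_pos_of_nonneg one_pos (norm_pointVector_nonneg (F := F) (p := p) w)).ne'

end Ball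

section Injectivity

variable [T2Space M] [CompactSpace M] {F : Metric M} {p : M}

theorem expMap_eq_conj (hK : F.CurvatureOne) {z : Plane} (hz : F.norm (pointVector p z) = Real.pi) :
    F.expMap p z = F.conj Real.pi p := by
  have h0 : z ≠ 0 := by
    rintro rfl
    rw [norm_pointVector_zero] at hz
    exact Real.pi_pos.ne hz
  rw [expMap_of_ne_zero h0, hz, geo_eq_conj hK Real.sin_pi (pointVector_snd_ne_zero h0),
    pointVector_fst]

/-- The fibre is discrete by local injectivity and lies in a second countable space. Over `α(p)` it
could so far accumulate at the bounding sphere, which maps to the same point; countability is enough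
for what follows. -/
theorem countable_expMap_eq (hK : F.CurvatureOne) (q : M) :
    {z | F.norm (pointVector p z) < Real.pi ∧ F.expMap p z = q}.Countable := by
  set S := {z | F.norm (pointVector p z) < Real.pi ∧ F.expMap p z = q}
  obtain ⟨t, -, ht, hst⟩ := TopologicalSpace.countable_cover_nhdsWithin (f := fun z => {z}) (s := S) (by
    rintro z ⟨hz, hzq⟩
    obtain ⟨φ, hzφ, hφ⟩ := exists_openPartialHomeomorph_expMap hK hz
    filter_upwards [self_mem_nhdsWithin, mem_nhdsWithin_of_mem_nhds (φ.open_source.mem_nhds hzφ)]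
      with y hy hyφ
    refine φ.injOn hyφ hzφ ?_
    rw [← hφ hyφ, ← hφ hzφ, hy.2, hzq])
  exact ht.mono fun z hz => by simpa using hst hz

/-- The complement of a countable set in the plane is path connected; `ballMap` transports this to
the open ball. -/
theorem isPreconnected_expMap_ne (hK : F.CurvatureOne) :
    IsPreconnected {z | F.norm (pointVector p z) < Real.pi ∧ F.expMap p z ≠ F.conj Real.pi p} := by
  set q := F.conj Real.pi p
  have h1 : (ballMap F p Real.pi ⁻¹'
      {z | F.norm (pointVector p z) < Real.pi ∧ F.expMap p z = q}).Countable :=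
    (countable_expMap_eq hK q).preimage_of_injOn (ballMap_injective Real.pi_pos).injOn
  have h2 := (h1.isPathConnected_compl_of_one_lt_rank (by
    rw [← Module.finrank_eq_rank, finrank_euclideanSpace_fin]
    norm_num)).isConnected.isPreconnected
  convert! h2.image _ continuous_ballMap.continuousOn using 1
  ext z
  constructor
  · rintro ⟨hz, hzq⟩
    obtain ⟨w, rfl⟩ := exists_ballMap Real.pi_pos hz
    exact ⟨w, fun h => hzq h.2, rfl⟩
  · rintro ⟨w, hw, rfl⟩
    exact ⟨norm_ballMap_lt Real.pi_pos w, fun h => hw ⟨norm_ballMap_lt Real.pi_pos w, h⟩⟩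

/-- The covering argument is applied to the compact closed ball: its boundary goes to the excluded
point `q`, so only interior points, where `exp_p` is a local homeomorphism, lie over the complement
of `q`. -/
theorem injOn_expMap_of_ne (hK : F.CurvatureOne)
    (φ : M ≃ₜ Metric.sphere (0 : EuclideanSpace ℝ (Fin 3)) 1) :
    InjOn (F.expMap p) {z | F.norm (pointVector p z) < Real.pi ∧ F.expMap p z ≠ F.conj Real.pi p} := by
  set q := F.conj Real.pi p
  obtain ⟨h1, h2⟩ := simplyConnectedSpace_compl_singleton φ q
  set B := {z | F.norm (pointVector p z) ≤ Real.pi}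
  have : CompactSpace B := isCompact_iff_compactSpace.1 (isCompact_normBall F p Real.pi)
  let f : B → M := fun z => F.expMap p z
  have hf : Continuous f := continuous_expMap.comp continuous_subtype_val
  have hlt : ∀ z : B, f z ∈ ({q}ᶜ : Set M) → F.norm (pointVector p z) < Real.pi :=
    fun z hz => lt_of_le_of_ne z.2 fun h => hz (expMap_eq_conj hK h)
  have hsub : {z | F.norm (pointVector p z) < Real.pi} ⊆ B :=
    fun z (hz : F.norm (pointVector p z) < Real.pi) => hz.le
  have hBo : IsOpen {z | F.norm (pointVector p z) < Real.pi} :=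
    isOpen_lt continuous_norm_pointVector continuous_const
  have hl : IsLocalHomeomorphOn f (f ⁻¹' {q}ᶜ) := by
    refine IsLocalHomeomorphOn.mk _ _ fun z hz => ?_
    have hz' := hlt z hz
    obtain ⟨ψ, hzψ, hψ⟩ := exists_openPartialHomeomorph_expMap hK hz'
    set O := {z | F.norm (pointVector p z) < Real.pi}
    have : Nonempty O := ⟨⟨z, hz'⟩⟩
    have hι : Topology.IsOpenEmbedding (inclusion hsub) := by
      refine ⟨Topology.IsEmbedding.inclusion hsub, ?_⟩
      rw [range_inclusion]
      exact hBo.preimage continuous_subtype_val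
    -- The local inverse must live on the closed ball as a subtype; it is obtained by passing from
    -- that subtype to the open ball, then to the plane, then through `ψ`.
    let ι := hι.toOpenPartialHomeomorph
    let j := hBo.isOpenEmbedding_subtypeVal.toOpenPartialHomeomorph
    have hzι : z ∈ ι.target := ⟨⟨z, hz'⟩, mem_univ _, rfl⟩
    have hιz : ∀ y ∈ ι.target, j (ι.symm y) = (y : Plane) := by
      rintro y ⟨x, -, rfl⟩
      have : ι.symm (ι x) = x := ι.left_inv (mem_univ x)
      change j (ι.symm (ι x)) = _
      rw [this]
      rfl
    refine ⟨(ι.symm.trans j).trans ψ, ?_, fun y hy => ?_⟩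
    · rw [OpenPartialHomeomorph.trans_source, OpenPartialHomeomorph.trans_source]
      refine ⟨⟨hzι, mem_univ _⟩, ?_⟩
      change j (ι.symm z) ∈ ψ.source
      rw [hιz z hzι]
      exact hzψ
    · rw [OpenPartialHomeomorph.trans_source, OpenPartialHomeomorph.trans_source] at hy
      obtain ⟨⟨hy1, -⟩, hy2⟩ := hy
      have hy2' : j (ι.symm y) ∈ ψ.source := hy2
      change F.expMap p y = ψ (j (ι.symm y))
      rw [hιz y hy1] at hy2' ⊢
      exact hψ hy2'
  have hc : IsPreconnected (f ⁻¹' {q}ᶜ) := by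
    rw [← Topology.IsInducing.subtypeVal.isPreconnected_image]
    convert! isPreconnected_expMap_ne (p := p) hK using 1
    ext z
    constructor
    · rintro ⟨y, hy, rfl⟩
      exact ⟨hlt y hy, hy⟩
    · rintro ⟨h3, h4⟩
      exact ⟨⟨z, hsub h3⟩, h4, rfl⟩
  have hinj := injOn_of_isLocalHomeomorphOn hf hl hc
  rintro a ⟨ha, ha'⟩ b ⟨hb, hb'⟩ hab
  exact congrArg Subtype.val (@hinj ⟨a, hsub ha⟩ ha' ⟨b, hsub hb⟩ hb' hab)

theorem exists_geo_ne {u : TangentBundle (𝓡 2) M} (hu : u.2 ≠ 0) (q : M) {a b : ℝ} (hab : a < b) :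
    ∃ t ∈ Ioo a b, F.geo u t ≠ q := by
  by_contra! h
  obtain ⟨t, ht⟩ := nonempty_Ioo.2 hab
  have h1 : F.geo u =ᶠ[𝓝 t] fun _ => q := by
    filter_upwards [isOpen_Ioo.mem_nhds ht] with s hs using h s hs
  have h2 : (lift (F.geo u) t).2 ≠ 0 := flow_snd_ne_zero hu t
  rw [lift_congr h1] at h2
  exact h2 (lift_const_snd q t)

/-- An interior preimage `z` of `q` would have a neighbourhood of vectors of norm below some `R < π`
covering a neighbourhood of `q`. A radial geodesic enters that neighbourhood shortly before time
`π`, at a time beyond `R` and at a point other than `q`, which contradicts injectivity away from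
`q`. -/
theorem expMap_ne_conj (hK : F.CurvatureOne)
    (φ : M ≃ₜ Metric.sphere (0 : EuclideanSpace ℝ (Fin 3)) 1) {z : Plane}
    (hz : F.norm (pointVector p z) < Real.pi) : F.expMap p z ≠ F.conj Real.pi p := by
  intro hzq
  set q := F.conj Real.pi p
  obtain ⟨ψ, hzψ, hψ⟩ := exists_openPartialHomeomorph_expMap hK hz
  obtain ⟨R, hR, hRπ⟩ := exists_between hz
  set U := ψ.source ∩ {y | F.norm (pointVector p y) < R}
  have hU : IsOpen U := ψ.open_source.inter (isOpen_lt continuous_norm_pointVector continuous_const)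
  have hV : ψ '' U ∈ 𝓝 q := by
    refine (ψ.isOpen_image_of_subset_source hU inter_subset_left).mem_nhds ⟨z, ⟨hzψ, hR⟩, ?_⟩
    rw [← hψ hzψ, hzq]
  set e : Plane := EuclideanSpace.single 0 1
  have he : e ≠ 0 := single_ne_zero
  set n := F.norm (pointVector p e)
  have hn : 0 < n := norm_pointVector_pos he
  set w := n⁻¹ • e
  have hw : F.norm (pointVector p w) = 1 := by
    simp only [w]
    rw [norm_pointVector_smul (inv_nonneg.2 hn.le), inv_mul_cancel₀ hn.ne']
  have hw0 : w ≠ 0 := smul_ne_zero (inv_ne_zero hn.ne') he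
  have hcont : Continuous fun t : ℝ => F.expMap p (t • w) :=
    continuous_expMap.comp (continuous_id.smul continuous_const)
  have hπ : F.expMap p (Real.pi • w) = q :=
    expMap_eq_conj hK (by rw [norm_pointVector_smul Real.pi_pos.le, hw, mul_one])
  have hev : ∀ᶠ t in 𝓝 Real.pi, F.expMap p (t • w) ∈ ψ '' U :=
    hcont.continuousAt.preimage_mem_nhds (by simpa only [hπ] using hV)
  obtain ⟨δ, hδ, hδU⟩ := Metric.eventually_nhds_iff.1 hev
  have hmax : max (max R 0) (Real.pi - δ) < Real.pi :=
    max_lt (max_lt hRπ Real.pi_pos) (by linarith)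
  obtain ⟨t, ⟨ht1, ht2⟩, htq⟩ := exists_geo_ne (F := F) (pointVector_snd_ne_zero (p := p) hw0) q hmax
  have htR : R < t := (le_max_left _ _).trans_lt ((le_max_left _ _).trans_lt ht1)
  have ht0 : 0 < t := (le_max_right _ _).trans_lt ((le_max_left _ _).trans_lt ht1)
  have htδ : Real.pi - δ < t := (le_max_right _ _).trans_lt ht1
  rw [← expMap_smul ht0.le hw] at htq
  obtain ⟨y, ⟨hyψ, hyR⟩, hy⟩ := hδU (y := t) (by rw [Real.dist_eq, abs_lt]; constructor <;> linarith)
  rw [← hψ hyψ] at hy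
  have htw : F.norm (pointVector p (t • w)) = t := by rw [norm_pointVector_smul ht0.le, hw, mul_one]
  have hyR' : F.norm (pointVector p y) < R := hyR
  have heq := @injOn_expMap_of_ne _ _ _ _ _ _ F p hK φ y ⟨hyR'.trans hRπ, by rw [hy]; exact htq⟩
    (t • w) ⟨htw.trans_lt ht2, htq⟩ hy
  rw [heq, htw] at hyR'
  linarith

theorem injOn_expMap (hK : F.CurvatureOne)
    (φ : M ≃ₜ Metric.sphere (0 : EuclideanSpace ℝ (Fin 3)) 1) :
    InjOn (F.expMap p) {z | F.norm (pointVector p z) < Real.pi} :=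
  fun _ ha _ hb hab => injOn_expMap_of_ne hK φ ⟨ha, expMap_ne_conj hK φ ha⟩
    ⟨hb, expMap_ne_conj hK φ hb⟩ hab

end Injectivity

end Finsler

end

noncomputable section

namespace Finsler

variable {M : Type*} [TopologicalSpace M] [ChartedSpace Plane M] [IsManifold (𝓡 2) ∞ M]

/-! ### Reversibility and periodicity -/

theorem lift_comp_real {γ : ℝ → M} {h : ℝ → ℝ} {t : ℝ}
    (hγ : MDifferentiableAt 𝓘(ℝ, ℝ) (𝓡 2) γ (h t)) (hh : DifferentiableAt ℝ h t) :
    lift (γ ∘ h) t = ⟨(lift γ (h t)).1, deriv h t • (lift γ (h t)).2⟩ := by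
  refine Bundle.TotalSpace.ext rfl (heq_of_eq ?_)
  have h1 := (HasMFDerivAt.comp t hγ.hasMFDerivAt hh.hasFDerivAt.hasMFDerivAt).mfderiv
  change mfderiv 𝓘(ℝ, ℝ) (𝓡 2) (γ ∘ h) t (1 : ℝ) = deriv h t • mfderiv 𝓘(ℝ, ℝ) (𝓡 2) γ (h t) (1 : ℝ)
  rw [h1]
  let L : ℝ →L[ℝ] Plane := mfderiv 𝓘(ℝ, ℝ) (𝓡 2) γ (h t)
  change L (deriv h t) = deriv h t • L 1
  rw [← map_smul, smul_eq_mul, mul_one]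

section Reversible

variable [T2Space M] [CompactSpace M] {F : Metric M} {p : M} {u v : TangentBundle (𝓡 2) M} {t t' : ℝ}

/-- Injectivity of the exponential map in terms of geodesics; the times agree as well, being the
norms of the two arguments. -/
theorem eq_of_geo_eq (hK : F.CurvatureOne) (φ : M ≃ₜ Metric.sphere (0 : EuclideanSpace ℝ (Fin 3)) 1)
    (hu : F.norm u = 1) (hv : F.norm v = 1) (huv : v.1 = u.1) (ht : t ∈ Ioo 0 Real.pi)
    (ht' : t' ∈ Ioo 0 Real.pi) (h : F.geo u t = F.geo v t') : u = v := by
  obtain ⟨p, hp⟩ : ∃ p, p = u.1 := ⟨_, rfl⟩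
  obtain ⟨a, ha⟩ : ∃ a, pointVector p a = u := ⟨_, by rw [hp]; exact pointVector_tchart u⟩
  obtain ⟨b, hb⟩ : ∃ b, pointVector p b = v := ⟨_, by rw [hp, ← huv]; exact pointVector_tchart v⟩
  subst ha hb
  rw [← expMap_smul ht.1.le hu, ← expMap_smul ht'.1.le hv] at h
  have na : F.norm (pointVector p (t • a)) = t := by rw [norm_pointVector_smul ht.1.le, hu, mul_one]
  have nb : F.norm (pointVector p (t' • b)) = t' := by
    rw [norm_pointVector_smul ht'.1.le, hv, mul_one]
  have h1 := injOn_expMap hK φ (show F.norm _ < _ from na.trans_lt ht.2)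
    (show F.norm _ < _ from nb.trans_lt ht'.2) h
  have h2 : t = t' := by rw [← na, h1, nb]
  rw [← h2] at h1
  rw [smul_right_injective _ ht.1.ne' h1]

theorem geo_ne_conj (hK : F.CurvatureOne) (φ : M ≃ₜ Metric.sphere (0 : EuclideanSpace ℝ (Fin 3)) 1)
    (hu : F.norm u = 1) (ht : t ∈ Ico 0 Real.pi) : F.geo u t ≠ F.conj Real.pi u.1 := by
  obtain ⟨p, hp⟩ : ∃ p, p = u.1 := ⟨_, rfl⟩
  obtain ⟨a, ha⟩ : ∃ a, pointVector p a = u := ⟨_, by rw [hp]; exact pointVector_tchart u⟩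
  subst ha
  rw [← hp, ← expMap_smul ht.1 hu]
  refine expMap_ne_conj hK φ ?_
  rw [norm_pointVector_smul ht.1, hu, mul_one]
  exact ht.2

theorem geo_ne_self (hK : F.CurvatureOne) (φ : M ≃ₜ Metric.sphere (0 : EuclideanSpace ℝ (Fin 3)) 1)
    (hu : F.norm u = 1) (ht : t ∈ Ioc 0 Real.pi) : F.geo u t ≠ u.1 := by
  have hu0 := unit_snd_ne_zero F hu
  rcases ht.2.eq_or_lt with rfl | htπ
  · have h1 := geo_ne_conj hK φ hu (t := 0) ⟨le_rfl, Real.pi_pos⟩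
    rw [geo_zero hu0] at h1
    rw [geo_eq_conj hK Real.sin_pi hu0]
    exact h1.symm
  · obtain ⟨p, hp⟩ : ∃ p, p = u.1 := ⟨_, rfl⟩
    obtain ⟨a, ha⟩ : ∃ a, pointVector p a = u := ⟨_, by rw [hp]; exact pointVector_tchart u⟩
    subst ha
    rw [← hp, ← expMap_smul ht.1.le hu]
    intro h
    have na : F.norm (pointVector p (t • a)) = t := by
      rw [norm_pointVector_smul ht.1.le, hu, mul_one]
    have h1 := injOn_expMap hK φ (show F.norm _ < _ from na.trans_lt htπ)
      (show F.norm (pointVector p 0) < _ by rw [norm_pointVector_zero]; exact Real.pi_pos)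
      (h.trans expMap_zero.symm)
    rw [h1, norm_pointVector_zero] at na
    exact ht.1.ne na

/-- A reversed geodesic meets the backward conjugate point, in one of three ways. -/
theorem conj_cases (hK : F.CurvatureOne) (hrev : F.GeodesicallyReversible) {e : Plane}
    (he : F.norm (pointVector p e) = 1) :
    F.conj (-Real.pi) p = F.conj Real.pi p ∨
    (∃ c : ℝ, c < 0 ∧ ∃ T ∈ Ioo 0 Real.pi, F.norm (pointVector p (c • e)) = 1 ∧
      F.geo (pointVector p (c • e)) T = F.conj (-Real.pi) p) ∨
    ∃ τ ∈ Ioo (-Real.pi) 0, F.geo (pointVector p e) τ = F.conj Real.pi p := by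
  set u := pointVector p e with hu
  have hu0 : u.2 ≠ 0 := unit_snd_ne_zero F he
  have hπ' : Real.sin (-Real.pi) = 0 := by simp
  have hγ := isGeodesicOn_geo (F := F) hu0
  obtain ⟨h, S, hS, hSo, hbij, hsm, hneg, hg⟩ := hrev _ univ isOpen_univ ordConnected_univ hγ
  obtain ⟨s₀, hs₀, h0⟩ := hbij.surjOn (mem_univ 0)
  obtain ⟨s₁, hs₁, h1⟩ := hbij.surjOn (mem_univ (-Real.pi))
  -- The reparametrisation decreases, so the reversed geodesic leaves `p` at `s₀` and arrives at the
  -- backward conjugate point at the later time `s₁`. Its initial vector is the multiple of `e` by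
  -- `c = h'(s₀) < 0`.
  have hanti : StrictAntiOn h S := strictAntiOn_of_deriv_neg hSo.convex hsm.continuousOn
    (fun t ht => hneg t (interior_subset ht))
  have hlt : s₀ < s₁ := by
    rw [← hanti.lt_iff_gt hs₁ hs₀, h0, h1]
    linarith [Real.pi_pos]
  set c := deriv h s₀
  have hc : c < 0 := hneg s₀ hs₀
  have hv : lift (F.geo u ∘ h) s₀ = pointVector p (c • e) := by
    have hd : DifferentiableAt ℝ h s₀ :=
      (hsm.contDiffAt (hS.mem_nhds hs₀)).differentiableAt (by norm_num)
    rw [lift_comp_real (hγ.mdifferentiableAt isOpen_univ (mem_univ _)) hd, h0,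
      show lift (F.geo u) 0 = u from (flow_zero hu0).trans (unit_of_norm_eq_one F he)]
    exact (chartVector_smul ..).symm
  set v := pointVector p (c • e) with hvdef
  have hv1 : F.norm v = 1 := by
    rw [← hv]
    exact hg.unit_speed s₀ hs₀
  have hv0 := unit_snd_ne_zero F hv1
  have hδ := hg.comp_add s₀
  have hSp : ((fun s => s + s₀) ⁻¹' S).OrdConnected :=
    hSo.preimage_mono fun a b hab => by linarith
  have hSop : IsOpen ((fun s => s + s₀) ⁻¹' S) := hS.preimage (by fun_prop)
  have m0 : (0 : ℝ) ∈ (fun s => s + s₀) ⁻¹' S := by simpa using hs₀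
  have heq : ∀ t, t + s₀ ∈ S → F.geo u (h (t + s₀)) = F.geo v t := by
    intro t ht
    refine congrArg Bundle.TotalSpace.proj (eqOn_geo hSop hSp hδ m0 hv0 ?_ t ht)
    rw [lift_comp_add, zero_add, hv, unit_of_norm_eq_one F hv1]
  have mT : s₁ - s₀ + s₀ ∈ S := by simpa using hs₁
  have hT := heq (s₁ - s₀) mT
  rw [sub_add_cancel, h1, geo_eq_conj hK hπ' hu0, hu, pointVector_fst] at hT
  have hvπ : F.geo v Real.pi = F.conj Real.pi p := by
    rw [geo_eq_conj hK Real.sin_pi hv0, hvdef, pointVector_fst]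
  -- Arrival before, at or after time `π`. In the last case the reversed geodesic passes its own
  -- conjugate point `conj π p` on the way, at a parameter of the original geodesic between `-π` and
  -- `0`.
  rcases lt_trichotomy (s₁ - s₀) Real.pi with hlt' | hT' | hgt
  · exact Or.inr (Or.inl ⟨c, hc, s₁ - s₀, ⟨sub_pos.2 hlt, hlt'⟩, hv1, hT.symm⟩)
  · rw [hT', hvπ] at hT
    exact Or.inl hT
  · have mπ : Real.pi + s₀ ∈ S :=
      hSo.out hs₀ hs₁ ⟨by linarith [Real.pi_pos], by linarith⟩
    refine Or.inr (Or.inr ⟨h (Real.pi + s₀), ⟨?_, ?_⟩, (heq _ mπ).trans hvπ⟩)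
    · rw [← h1]
      exact hanti mπ hs₁ (by linarith)
    · rw [← h0]
      exact hanti hs₀ mπ (by linarith [Real.pi_pos])

theorem pointVector_injective (p : M) : Injective (pointVector p) := fun a b h => by
  have := congrArg (tchart p) h
  rw [tchart_pointVector, tchart_pointVector] at this
  exact congrArg Prod.snd this

/-- In the reversible case the conjugate point map is an involution. -/
theorem conj_neg_eq (hK : F.CurvatureOne) (φ : M ≃ₜ Metric.sphere (0 : EuclideanSpace ℝ (Fin 3)) 1)
    (hrev : F.GeodesicallyReversible) (p : M) : F.conj (-Real.pi) p = F.conj Real.pi p := by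
  by_contra hne
  have hπ' : Real.sin (-Real.pi) = 0 := by simp
  set B := {e : Plane | F.norm (pointVector p e) = 1 ∧ ∃ c : ℝ, c < 0 ∧ ∃ T ∈ Ioo 0 Real.pi,
    F.norm (pointVector p (c • e)) = 1 ∧ F.geo (pointVector p (c • e)) T = F.conj (-Real.pi) p}
  set C := {e : Plane | F.norm (pointVector p e) = 1 ∧ ∃ τ ∈ Ioo (-Real.pi) 0,
    F.geo (pointVector p e) τ = F.conj Real.pi p}
  -- Two such directions would have reversed geodesics from `p` meeting before time `π`, so `c • a =
  -- d • b`; the ratio of the two negative factors is positive and the unit norms force `a = b`.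
  have hB : B.Subsingleton := by
    rintro a ⟨ha, c, hc, T, hT, hca, h⟩ b ⟨hb, d, hd, T', hT', hdb, h'⟩
    have h1 := pointVector_injective p (eq_of_geo_eq hK φ hca hdb
      (by rw [pointVector_fst, pointVector_fst]) hT hT' (h.trans h'.symm))
    have h2 : a = (c⁻¹ * d) • b := by rw [mul_smul, ← h1, inv_smul_smul₀ hc.ne]
    have hcd : 0 < c⁻¹ * d := mul_pos_of_neg_of_neg (inv_lt_zero.2 hc) hd
    rw [h2, norm_pointVector_smul hcd.le, hb, mul_one] at ha
    rw [h2, ha, one_smul]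
  -- Seen from the backward conjugate point `conj (-π) p`, at time `-π`, both geodesics reach `conj
  -- π p` in time less than `π`. They therefore coincide there, and flowing forward by `π` recovers
  -- the directions at `p`.
  have hC : C.Subsingleton := by
    rintro a ⟨ha, τ, hτ, h⟩ b ⟨hb, τ', hτ', h'⟩
    have ha0 := unit_snd_ne_zero F ha
    have hb0 := unit_snd_ne_zero F hb
    have h1 : F.flow (pointVector p a) (-Real.pi) = F.flow (pointVector p b) (-Real.pi) := by
      refine eq_of_geo_eq hK φ (norm_flow ha0 _) (norm_flow hb0 _) ?_ (t := τ + Real.pi)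
        (t' := τ' + Real.pi) ⟨by linarith [hτ.1], by linarith [hτ.2]⟩
        ⟨by linarith [hτ'.1], by linarith [hτ'.2]⟩ ?_
      · rw [flow_fst, flow_fst, geo_eq_conj hK hπ' ha0, geo_eq_conj hK hπ' hb0, pointVector_fst,
          pointVector_fst]
      · rw [geo_add ha0, geo_add hb0, add_neg_cancel_right, add_neg_cancel_right, h, h']
    have h2 := congrArg (fun w => F.flow w Real.pi) h1
    rw [flow_add ha0, flow_add hb0, add_neg_cancel, flow_zero ha0, flow_zero hb0,
      unit_of_norm_eq_one F ha, unit_of_norm_eq_one F hb] at h2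
    exact pointVector_injective p h2
  have hBC : ∀ e : Plane, e ≠ 0 → (F.norm (pointVector p e))⁻¹ • e ∈ B ∪ C := by
    intro e he
    have hn := norm_pointVector_pos (F := F) (p := p) he
    have h1 : F.norm (pointVector p ((F.norm (pointVector p e))⁻¹ • e)) = 1 := by
      rw [norm_pointVector_smul (inv_nonneg.2 hn.le), inv_mul_cancel₀ hn.ne']
    rcases conj_cases hK hrev h1 with h | h | h
    · exact absurd h hne
    · exact Or.inl ⟨h1, h⟩
    · exact Or.inr ⟨h1, h⟩
  -- Three directions, no two on a common ray, cannot be distributed over two sets with at most one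
  -- element each.
  let e : Fin 3 → Plane := ![EuclideanSpace.single 0 1, EuclideanSpace.single 1 1,
    EuclideanSpace.single 0 1 + EuclideanSpace.single 1 1]
  have he : ∀ i, e i ≠ 0 := by
    intro i h
    have h0 := congrArg (fun w : Plane => w 0) h
    have h1 := congrArg (fun w : Plane => w 1) h
    fin_cases i <;> simp [e] at h0 h1
  have hdist : ∀ i j, i ≠ j → (F.norm (pointVector p (e i)))⁻¹ • e i
      ≠ (F.norm (pointVector p (e j)))⁻¹ • e j := by
    intro i j hij h
    have hi := (norm_pointVector_pos (F := F) (p := p) (he i)).ne'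
    have hj := (norm_pointVector_pos (F := F) (p := p) (he j)).ne'
    have h0 := congrArg (fun w : Plane => w 0) h
    have h1 := congrArg (fun w : Plane => w 1) h
    simp only [PiLp.smul_apply, smul_eq_mul] at h0 h1
    generalize F.norm (pointVector p (e i)) = x at *
    generalize F.norm (pointVector p (e j)) = y at *
    fin_cases i <;> fin_cases j <;> simp [e, hi] at hij h0 h1 <;> grind
  have key : ∀ i j, i ≠ j → ∀ D : Set Plane, D.Subsingleton →
      (F.norm (pointVector p (e i)))⁻¹ • e i ∈ D → (F.norm (pointVector p (e j)))⁻¹ • e j ∉ D :=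
    fun i j hij D hD hi hj => hdist i j hij (hD hi hj)
  rcases hBC _ (he 0) with h0 | h0 <;> rcases hBC _ (he 1) with h1 | h1 <;>
    rcases hBC _ (he 2) with h2 | h2
  · exact key 0 1 (by decide) B hB h0 h1
  · exact key 0 1 (by decide) B hB h0 h1
  · exact key 0 2 (by decide) B hB h0 h2
  · exact key 1 2 (by decide) C hC h1 h2
  · exact key 1 2 (by decide) B hB h1 h2
  · exact key 0 2 (by decide) C hC h0 h2
  · exact key 0 1 (by decide) C hC h0 h1
  · exact key 0 1 (by decide) C hC h0 h1

theorem conj_conj (hK : F.CurvatureOne) (φ : M ≃ₜ Metric.sphere (0 : EuclideanSpace ℝ (Fin 3)) 1)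
    (hrev : F.GeodesicallyReversible) (p : M) : F.conj Real.pi (F.conj Real.pi p) = p := by
  have h := conj_conj_neg hK Real.sin_pi p
  rwa [conj_neg_eq hK φ hrev] at h

theorem periodic_geo (hK : F.CurvatureOne) (φ : M ≃ₜ Metric.sphere (0 : EuclideanSpace ℝ (Fin 3)) 1)
    (hrev : F.GeodesicallyReversible) (hu : F.norm u = 1) : Periodic (F.geo u) (2 * Real.pi) := by
  intro t
  have hu0 := unit_snd_ne_zero F hu
  rw [show t + 2 * Real.pi = Real.pi + (Real.pi + t) by ring, ← conj_geo hK Real.sin_pi hu0,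
    ← conj_geo hK Real.sin_pi hu0, conj_conj hK φ hrev]

theorem not_periodic_geo (hK : F.CurvatureOne)
    (φ : M ≃ₜ Metric.sphere (0 : EuclideanSpace ℝ (Fin 3)) 1)
    (hrev : F.GeodesicallyReversible) (hu : F.norm u = 1) {T : ℝ} (hT : 0 < T)
    (hT' : T < 2 * Real.pi) : ¬ Periodic (F.geo u) T := by
  intro h
  have hu0 := unit_snd_ne_zero F hu
  rcases le_or_gt T Real.pi with hle | hgt
  · refine geo_ne_self hK φ hu ⟨hT, hle⟩ ?_
    rw [← zero_add T, h 0, geo_zero hu0]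
  -- A period above `π` is replaced by its complement `2π - T`, which lies in `(0, π)`, where the
  -- geodesic does not return to its initial point.
  · refine geo_ne_self hK φ hu (t := 2 * Real.pi - T) ⟨by linarith, by linarith⟩ ?_
    rw [← h (2 * Real.pi - T), sub_add_cancel, ← zero_add (2 * Real.pi),
      periodic_geo hK φ hrev hu 0, geo_zero hu0]

theorem exists_periodic_extension (hK : F.CurvatureOne)
    (φ : M ≃ₜ Metric.sphere (0 : EuclideanSpace ℝ (Fin 3)) 1)
    (hrev : F.GeodesicallyReversible) {γ : ℝ → M} {s : Set ℝ} (hs : IsOpen s) (hs' : s.OrdConnected)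
    (hne : s.Nonempty) (hγ : F.IsGeodesicOn γ s) :
    ∃ Γ : ℝ → M, F.IsGeodesicOn Γ univ ∧ EqOn γ Γ s ∧ Periodic Γ (2 * Real.pi) ∧
      ∀ T : ℝ, 0 < T → T < 2 * Real.pi → ¬ Periodic Γ T := by
  obtain ⟨a, ha⟩ := hne
  set u := lift γ a
  have hu : F.norm u = 1 := hγ.unit_speed a ha
  have hu0 := unit_snd_ne_zero F hu
  have hg := (isGeodesicOn_geo (F := F) hu0).comp_add (-a)
  rw [preimage_univ] at hg
  refine ⟨fun t => F.geo u (t + -a), hg, ?_, fun t => ?_, fun T h0 h1 hT => ?_⟩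
  · refine hγ.eqOn (hg.mono (subset_univ s)) hs hs' ha ?_
    rw [lift_comp_add, add_neg_cancel]
    exact ((flow_zero hu0).trans (unit_of_norm_eq_one F hu)).symm
  · simp only
    rw [← periodic_geo hK φ hrev hu (t + -a)]
    congr 1
    ring
  · refine not_periodic_geo hK φ hrev hu h0 h1 fun t => ?_
    have := hT (t + a)
    simp only at this
    rw [show t + a + T + -a = t + T by ring, add_neg_cancel_right] at this
    exact this

end Reversible

end Finsler

end

theorem mainTheorem4 {M : Type*} [TopologicalSpace M] [ChartedSpace Finsler.Plane M]
    [IsManifold (𝓡 2) ∞ M]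
    (hM : Nonempty (Diffeomorph (𝓡 2) (𝓡 2) M
      (Metric.sphere (0 : EuclideanSpace ℝ (Fin 3)) 1) ∞))
    (o : Finsler.OrientationForm M) (F : Finsler.Metric M)
    (hK : F.CurvatureOne) (hrev : F.GeodesicallyReversible) :
    (∃! α : Diffeomorph (𝓡 2) (𝓡 2) M M ∞, F.IsQuasiAntipodal o α) ∧
    (∀ α : Diffeomorph (𝓡 2) (𝓡 2) M M ∞, F.IsQuasiAntipodal o α → ∀ p : M, α (α p) = p) ∧
    (∀ (γ : ℝ → M) (s : Set ℝ), IsOpen s → s.OrdConnected → s.Nonempty → F.IsGeodesicOn γ s →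
      ∃ Γ : ℝ → M, F.IsGeodesicOn Γ Set.univ ∧ Set.EqOn γ Γ s ∧
        Function.Periodic Γ (2 * Real.pi) ∧
        ∀ T : ℝ, 0 < T → T < 2 * Real.pi → ¬ Function.Periodic Γ T) := by
  obtain ⟨d⟩ := hM
  have φ : M ≃ₜ Metric.sphere (0 : EuclideanSpace ℝ (Fin 3)) 1 := d.toHomeomorph
  -- Separation and compactness are inherited from the sphere.
  have : T2Space M := φ.isEmbedding.t2Space
  have : CompactSpace M := φ.symm.compactSpace
  refine ⟨⟨Finsler.conjDiffeomorph hK Real.sin_pi, Finsler.isQuasiAntipodal_conj o hK,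
    fun β hβ => Diffeomorph.ext fun p => Finsler.eq_conj_of_isQuasiAntipodal o hβ p⟩,
    fun α hα p => ?_, fun γ s hs hs' hne hγ =>
      Finsler.exists_periodic_extension hK φ hrev hs hs' hne hγ⟩
  rw [Finsler.eq_conj_of_isQuasiAntipodal o hα, Finsler.eq_conj_of_isQuasiAntipodal o hα]
  exact Finsler.conj_conj hK φ hrev p
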